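/- Let $w(x)=1+|x|$ and, for $1\le p\le\infty$ and $r\in\mathbb R$, let $L^p_r(\mathbb R)=\{g : w^r g\in L^p(\mathbb R)\}$. Let $s>s_1>\frac12$ and let $u\in L^2_s(\mathbb R)$ be real-valued. For $\lambda>0$ put $$\widetilde G_\lambda(x)=\frac1{2\pi}\int_{-\infty}^0\frac{e^{ix\xi}}{\xi-\lambda}\,d\xi=\frac1{2\pi}\lim_{R\to\infty}\int_{-R}^0\frac{e^{ix\xi}}{\xi-\lambda}\,d\xi\quad(x\ne0),\qquad G_{\lambda\pm0i}(x)=\pm i e^{i\lambda x}\chi_{\mathbb R^\pm}(x)-\widetilde G_\lambda(x),$$ where $\mathbb R^+=(0,\infty)$ and $\mathbb R^-=(-\infty,0)$. Then for every $\lambda>0$ and each choice of sign there are unique functions (up to equality almost everywhere) $m_1(\cdot,\lambda\pm0i)$ and $m_e(\cdot,\lambda\pm0i)$ in $L^\infty_{-(s-s_1)}(\mathbb R)$ (the Jost solutions) such that almost everywhere $$m_1(\cdot,\lambda\pm0i)=1+G_{\lambda\pm0i}*\bigl(u\,m_1(\cdot,\lambda\pm0i)\bigr),\qquad m_e(\cdot,\lambda\pm0i)=e^{i\lambda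 x}+G_{\lambda\pm0i}*\bigl(u\,m_e(\cdot,\lambda\pm0i)\bigr).$$ Define, for $\lambda>0$, $$\Gamma(\lambda)=1+i\int_{\mathbb R}u(x)m_e(x,\lambda+0i)e^{-i\lambda x}\,dx,\qquad \beta(\lambda)=i\int_{\mathbb R}u(x)m_1(x,\lambda+0i)e^{-i\lambda x}\,dx,$$ $$f(\lambda)=-\frac1{2\pi\lambda}\int_{\mathbb R}u(x)m_e(x,\lambda-0i)\,dx.$$ Then there is $\gamma\in(0,1)$ such that $\Gamma\in C^{1,\gamma}_{loc}(0,\infty)$ and $\beta,f\in C^{0,\gamma}_{loc}(0,\infty)$ (that is, $\Gamma$ is differentiable on $(0,\infty)$, and $\partial_\lambda\Gamma$, $\beta$ and $f$ are $\gamma$-Hölder continuous on every compact subset of $(0,\infty)$). Moreover, for every $\lambda>0$, $$|\Gamma(\lambda)|=1,\qquad f(\lambda)=\frac{\overline{\beta(\lambda)}}{2\pi i\lambda},\qquad |\beta(\lambda)|^2=2\,\mathrm{Im}\int_{\mathbb R}u(x)m_1(x,\lambda+0i)\,dx,\qquad \partial_\lambda\Gamma(\lambda)=\frac{|\beta(\lambda)|^2}{2\pi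 i\lambda}\,\Gamma(\lambda).$$ -/

import Mathlib

open MeasureTheory Filter Set
open scoped NNReal ENNReal Convolution ComplexConjugate

noncomputable section

namespace BenjaminOno

/-- `f ∈ L^p_s(ℝ)`: with the weight `w(x) = 1 + |x|`, the function `w^s f` is in `L^p(ℝ)`. -/
def MemWeightedLp {E : Type*} [NormedAddCommGroup E] [NormedSpace ℝ E]
    (p : ℝ≥0∞) (s : ℝ) (f : ℝ → E) : Prop :=
  MemLp (fun x : ℝ => ((1 + |x|) ^ s) • f x) p volume

/-- `g ∈ C^{0,γ}_loc(0,∞)`: `g` is `γ`-Hölder continuous on every compact subset of `(0,∞)`. -/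
def LocHolder (γ : ℝ≥0) (g : ℝ → ℂ) : Prop :=
  ∀ K : Set ℝ, K ⊆ Ioi 0 → IsCompact K → ∃ C : ℝ≥0, HolderOnWith C γ g K

/-- `g ∈ C^{1,γ}_loc(0,∞)`: `g` is differentiable on `(0,∞)` and its derivative is locally
`γ`-Hölder continuous there. -/
def LocC1Holder (γ : ℝ≥0) (g : ℝ → ℂ) : Prop :=
  DifferentiableOn ℝ g (Ioi 0) ∧ LocHolder γ (deriv g)

/-- The plane wave `e(x, lam) = exp(i lam x)`. -/
def planeWave (lam x : ℝ) : ℂ := Complex.exp (Complex.I * lam * x)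

/-- The kernel `(1/2π) ∫_{-∞}^0 exp(i x ξ) / (ξ - lam) dξ` for `lam > 0`. The integral is not
absolutely convergent, so it is the improper integral `lim_{R → ∞} ∫_{-R}^0`, which exists for
every `x ≠ 0`. -/
def tildeG (lam x : ℝ) : ℂ :=
  limUnder atTop (fun R : ℝ =>
    (1 / (2 * (Real.pi : ℂ))) *
      ∫ ξ in (-R)..0, Complex.exp (Complex.I * x * ξ) / ((ξ : ℂ) - lam))

/-- The two sides from which the spectral parameter approaches the positive half line:
`above` is `lam + 0i`, `below` is `lam - 0i`. -/
inductive Side where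
  | above
  | below

/-- The boundary values `G_{lam ± 0i}(x) = ± i exp(i lam x) χ_{ℝ^±}(x) - tildeG lam x`
of the kernel `G_k(x) = (1/2π) ∫_0^∞ exp(i x ξ) / (ξ - k) dξ`. -/
def boundaryG : Side → ℝ → ℝ → ℂ
  | .above, lam, x => (Ioi (0 : ℝ)).indicator (fun t => Complex.I * planeWave lam t) x
      - tildeG lam x
  | .below, lam, x => (Iio (0 : ℝ)).indicator (fun t => -(Complex.I * planeWave lam t)) x
      - tildeG lam x

/-- `m ∈ L^∞_{-r}(ℝ)` and `m = g + G_{lam ± 0i} * (u m)` almost everywhere. -/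
def IsJostSolution (r : ℝ) (u : ℝ → ℝ) (σ : Side) (lam : ℝ) (g m : ℝ → ℂ) : Prop :=
  MemWeightedLp ∞ (-r) m ∧
    ∀ᵐ x : ℝ, m x = g x +
      (boundaryG σ lam ⋆[ContinuousLinearMap.mul ℝ ℂ, volume] (fun y => (u y : ℂ) * m y)) x

/-- A solution in `L^∞_{-r}(ℝ)` of `m = g + G_{lam ± 0i} * (u m)`, if there is one. -/
def jostSolution (r : ℝ) (u : ℝ → ℝ) (σ : Side) (lam : ℝ) (g : ℝ → ℂ) : ℝ → ℂ :=
  Classical.epsilon (fun m : ℝ → ℂ => IsJostSolution r u σ lam g m)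

/-- The Jost function `m_1(x, lam ± 0i)`, in `L^∞_{-r}(ℝ)`. -/
def jostOne (r : ℝ) (u : ℝ → ℝ) (σ : Side) (lam : ℝ) : ℝ → ℂ :=
  jostSolution r u σ lam (fun _ => 1)

/-- The Jost function `m_e(x, lam ± 0i)`, in `L^∞_{-r}(ℝ)`. -/
def jostExp (r : ℝ) (u : ℝ → ℝ) (σ : Side) (lam : ℝ) : ℝ → ℂ :=
  jostSolution r u σ lam (planeWave lam)

/-- `Γ(lam) = 1 + i ∫ u(x) m_e(x, lam + 0i) exp(-i lam x) dx`. -/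
def Gam (r : ℝ) (u : ℝ → ℝ) (lam : ℝ) : ℂ :=
  1 + Complex.I * ∫ x : ℝ, (u x : ℂ) * jostExp r u .above lam x *
    Complex.exp (-(Complex.I * lam * x))

/-- `β(lam) = i ∫ u(x) m_1(x, lam + 0i) exp(-i lam x) dx`. -/
def beta (r : ℝ) (u : ℝ → ℝ) (lam : ℝ) : ℂ :=
  Complex.I * ∫ x : ℝ, (u x : ℂ) * jostOne r u .above lam x *
    Complex.exp (-(Complex.I * lam * x))

/-- `f(lam) = -(1 / (2 π lam)) ∫ u(x) m_e(x, lam - 0i) dx`. -/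
def coeffF (r : ℝ) (u : ℝ → ℝ) (lam : ℝ) : ℂ :=
  -(1 / (2 * (Real.pi : ℂ) * lam)) * ∫ x : ℝ, (u x : ℂ) * jostExp r u .below lam x

end BenjaminOno

end

noncomputable section

namespace BenjaminOno

open scoped Topology

/-! ### Hilbert–Schmidt integral operators on `L²(ℝ)` -/

/-! Put `M = w^{-t} e^{-iλx} m`. The equation `m = g + G * (u m)` becomes `(1 - A_λ) M = w^{-t}
e^{-iλx} g` on `L²(ℝ)`, where `A_λ` has the kernel `w(x)^{-t} e^{-iλ(x-y)} G(x-y) w(y)^t u(y)`.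
Since `G` is bounded apart from a mild singularity at `0`, `A_λ` is Hilbert–Schmidt, hence compact,
and the Fredholm alternative reduces existence and uniqueness to the absence of homogeneous
solutions.

That absence is the core (`ae_eq_zero_of_homogeneous`). Two facts about the kernels are used
throughout: convolutions with `G_{λ+0i}` and `G_{λ-0i}` are adjoint to each other
(`integral_conj_mul_cv`), and their difference is convolution with `i e^{iλx}`
(`cv_above_sub_below`). Let `φ` be a bounded homogeneous solution and `h = u φ`. Pairing the
equation with `h` gives `|ĥ(λ)|² = 0`, so `φ` solves the equations of both sides. At each `x` one
may then use the side whose plane wave does not reach `x` from near the origin, which yields `φ =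
O(1/|x|)`. Now `y h(y)` is integrable, `q = ĥ/(ξ-λ)` is integrable, and `φ` is the inverse Fourier
transform of `q` restricted to `(0,∞)`. Integrating the derivative of `|ĥ|²/(ξ-λ)` over `(0,∞)`
gives `∫|q|² = 2 Re ∫ ĥ' q̄ - |ĥ(0)|²/λ`. Because `u` is real, `∫ ĥ' q̄ = -2πi ∫ y u |φ|²` is purely
imaginary. Hence `q = 0` on `(0,∞)` and `φ = 0`.

The algebraic relations follow from the same two facts. The jump and uniqueness give `m_e^+ = Γ
m_e^-` and `m_1^+ = m_1^- + β m_e^-` (`IsJostSolution.above_ae_eq`); adjointness gives the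
reciprocity law `integral_mul_conj_planeWave`.

For regularity, removing `e^{iλx}` makes the plane-wave part of the kernel independent of `λ`. What
remains has the bounded `λ`-derivative `-e^{-iλx}/(2πλ)`, so `A_λ` is differentiable in operator
norm with a rank-one derivative (`hasDerivAt_jostOp`). In these variables the inhomogeneity of `m_e`
is the fixed function `w^{-t}`, so `Γ` is differentiable; the rank-one derivative sends `m_e` to a
multiple of the inhomogeneity of `m_1`, and this produces `|β|² Γ` (`hasDerivAt_Gam`). The
inhomogeneity `w^{-t} e^{-iλx}` of `m_1` is shown to be Hölder in `λ`, from which the Hölder bounds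
for `β`, `f` and `Γ'` follow. -/

lemma norm_integral_mul_sq_le {α : Type*} [MeasurableSpace α] {μ : Measure α} {f g : α → ℂ}
    (hf : MemLp f 2 μ) (hg : MemLp g 2 μ) :
    ‖∫ a, f a * g a ∂μ‖ ^ 2 ≤ (∫ a, ‖f a‖ ^ 2 ∂μ) * ∫ a, ‖g a‖ ^ 2 ∂μ := by
  have h := integral_mul_norm_le_Lp_mul_Lq (μ := μ) (f := f) (g := g) (p := 2) (q := 2)
    (by constructor <;> norm_num) (by simpa using hf) (by simpa using hg)
  have h1 : ‖∫ a, f a * g a ∂μ‖ ≤ ∫ a, ‖f a‖ * ‖g a‖ ∂μ := by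
    refine (norm_integral_le_integral_norm _).trans (le_of_eq ?_)
    simp
  have hA : 0 ≤ ∫ a, ‖f a‖ ^ 2 ∂μ := integral_nonneg fun _ => by positivity
  have hB : 0 ≤ ∫ a, ‖g a‖ ^ 2 ∂μ := integral_nonneg fun _ => by positivity
  have h2 := h1.trans h
  simp only [Real.rpow_two, ← Real.sqrt_eq_rpow] at h2
  calc ‖∫ a, f a * g a ∂μ‖ ^ 2
      ≤ (√(∫ a, ‖f a‖ ^ 2 ∂μ) * √(∫ a, ‖g a‖ ^ 2 ∂μ)) ^ 2 := by gcongr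
    _ = _ := by rw [mul_pow, Real.sq_sqrt hA, Real.sq_sqrt hB]

lemma norm_toLp_sq {α : Type*} [MeasurableSpace α] {μ : Measure α} {f : α → ℂ}
    (hf : MemLp f 2 μ) : ‖hf.toLp f‖ ^ 2 = ∫ a, ‖f a‖ ^ 2 ∂μ := by
  rw [@norm_sq_eq_re_inner ℂ, L2.inner_def]
  have : ∫ a, inner ℂ (hf.toLp f a) (hf.toLp f a) ∂μ = ∫ a, ((‖f a‖ ^ 2 : ℝ) : ℂ) ∂μ := by
    refine integral_congr_ae ?_
    filter_upwards [hf.coeFn_toLp] with a ha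
    rw [ha, inner_self_eq_norm_sq_to_K]
    simp
  rw [this, integral_complex_ofReal]
  simp

lemma norm_Lp_sq {α : Type*} [MeasurableSpace α] {μ : Measure α} (f : Lp ℂ 2 μ) :
    ‖f‖ ^ 2 = ∫ a, ‖f a‖ ^ 2 ∂μ := by
  conv_lhs => rw [← Lp.toLp_coeFn f (Lp.memLp f)]
  exact norm_toLp_sq _

lemma ae_memLp_two_section {k : ℝ × ℝ → ℂ} (hk : MemLp k 2) :
    ∀ᵐ x : ℝ, MemLp (fun y => k (x, y)) 2 := by
  have h1 := (memLp_two_iff_integrable_sq_norm hk.1).1 hk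
  have h2 := h1.prod_right_ae
  have h3 := hk.1.prodMk_left
  filter_upwards [h2, h3] with x hx hx'
  exact (memLp_two_iff_integrable_sq_norm hx').2 hx

lemma aestronglyMeasurable_integral_kernel {k : ℝ × ℝ → ℂ} (hk : MemLp k 2) {f : ℝ → ℂ}
    (hf : MemLp f 2) : AEStronglyMeasurable (fun x => ∫ y, k (x, y) * f y) volume :=
  (hk.1.mul hf.1.comp_snd).integral_prod_right'

lemma integrable_sq_section {k : ℝ × ℝ → ℂ} (hk : MemLp k 2) :
    Integrable (fun x => ∫ y, ‖k (x, y)‖ ^ 2) :=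
  ((memLp_two_iff_integrable_sq_norm hk.1).1 hk).integral_prod_left

lemma integral_sq_section {k : ℝ × ℝ → ℂ} (hk : MemLp k 2) :
    ∫ x, ∫ y, ‖k (x, y)‖ ^ 2 = ∫ z, ‖k z‖ ^ 2 :=
  (integral_prod _ ((memLp_two_iff_integrable_sq_norm hk.1).1 hk)).symm

lemma memLp_two_integral_kernel {k : ℝ × ℝ → ℂ} (hk : MemLp k 2) {f : ℝ → ℂ}
    (hf : MemLp f 2) : MemLp (fun x => ∫ y, k (x, y) * f y) 2 := by
  have hm := aestronglyMeasurable_integral_kernel hk hf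
  refine (memLp_two_iff_integrable_sq_norm hm).2 ?_
  refine ((integrable_sq_section hk).mul_const (∫ y, ‖f y‖ ^ 2)).mono' (hm.norm.pow 2) ?_
  filter_upwards [ae_memLp_two_section hk] with x hx
  rw [Real.norm_of_nonneg (by positivity)]
  exact norm_integral_mul_sq_le hx hf

lemma integral_sq_integral_kernel_le {k : ℝ × ℝ → ℂ} (hk : MemLp k 2) {f : ℝ → ℂ}
    (hf : MemLp f 2) :
    ∫ x, ‖∫ y, k (x, y) * f y‖ ^ 2 ≤ (∫ z, ‖k z‖ ^ 2) * ∫ y, ‖f y‖ ^ 2 := by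
  rw [← integral_sq_section hk, ← integral_mul_const]
  refine integral_mono_ae
    ((memLp_two_iff_integrable_sq_norm (memLp_two_integral_kernel hk hf).1).1
      (memLp_two_integral_kernel hk hf))
    ((integrable_sq_section hk).mul_const _) ?_
  filter_upwards [ae_memLp_two_section hk] with x hx
  exact norm_integral_mul_sq_le hx hf

/-- The integral operator on `L²(ℝ)` with square integrable kernel `k`. -/
def hsOp (k : ℝ × ℝ → ℂ) (hk : MemLp k 2) : Lp ℂ 2 (volume : Measure ℝ) →L[ℂ] Lp ℂ 2 (volume : Measure ℝ) :=
  LinearMap.mkContinuous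
    { toFun := fun f => (memLp_two_integral_kernel hk (Lp.memLp f)).toLp _
      map_add' := fun f g => by
        rw [← MemLp.toLp_add]
        refine MemLp.toLp_congr _ _ ?_
        filter_upwards [ae_memLp_two_section hk] with x hx
        simp only [Pi.add_apply]
        refine Eq.trans (integral_congr_ae ?_)
          (integral_add (hx.integrable_mul (Lp.memLp f)) (hx.integrable_mul (Lp.memLp g)))
        filter_upwards [Lp.coeFn_add f g] with y hy
        simp only [hy, Pi.add_apply]; ring
      map_smul' := fun c f => by
        rw [RingHom.id_apply, ← MemLp.toLp_const_smul]
        refine MemLp.toLp_congr _ _ (Eventually.of_forall fun x => ?_)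
        simp only [Pi.smul_apply, smul_eq_mul]
        rw [← integral_const_mul]
        refine integral_congr_ae ?_
        filter_upwards [Lp.coeFn_smul c f] with y hy
        simp only [hy, Pi.smul_apply, smul_eq_mul]; ring }
    (√(∫ z, ‖k z‖ ^ 2)) (fun f => by
      have h := integral_sq_integral_kernel_le hk (Lp.memLp f)
      rw [← norm_toLp_sq (memLp_two_integral_kernel hk (Lp.memLp f)), ← norm_Lp_sq f] at h
      have hA : 0 ≤ ∫ z, ‖k z‖ ^ 2 := integral_nonneg fun _ => by positivity
      refine abs_le_of_sq_le_sq' ?_ (by positivity) |>.2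
      rw [mul_pow, Real.sq_sqrt hA]
      exact h)

lemma hsOp_apply {k : ℝ × ℝ → ℂ} (hk : MemLp k 2) (f : Lp ℂ 2 (volume : Measure ℝ)) :
    hsOp k hk f =ᵐ[volume] fun x => ∫ y, k (x, y) * f y :=
  MemLp.coeFn_toLp (memLp_two_integral_kernel hk (Lp.memLp f))

lemma norm_hsOp_le {k : ℝ × ℝ → ℂ} (hk : MemLp k 2) : ‖hsOp k hk‖ ≤ √(∫ z, ‖k z‖ ^ 2) :=
  LinearMap.mkContinuous_norm_le _ (Real.sqrt_nonneg _) _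

lemma hsOp_sub {k l : ℝ × ℝ → ℂ} (hk : MemLp k 2) (hl : MemLp l 2) :
    hsOp k hk - hsOp l hl = hsOp (k - l) (hk.sub hl) := by
  ext1 f
  refine Lp.ext ?_
  filter_upwards [Lp.coeFn_sub (hsOp k hk f) (hsOp l hl f), hsOp_apply hk f, hsOp_apply hl f,
    hsOp_apply (hk.sub hl) f, ae_memLp_two_section hk, ae_memLp_two_section hl]
    with x h1 h2 h3 h4 h5 h6
  rw [sub_apply, h1, h4, Pi.sub_apply, h2, h3]
  refine (integral_sub (h5.integrable_mul (Lp.memLp f)) (h6.integrable_mul (Lp.memLp f))).symm.trans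
    ?_
  congr 1; ext y
  simp only [Pi.sub_apply, Pi.mul_apply]; ring

lemma hsOp_const_smul (c : ℂ) {k : ℝ × ℝ → ℂ} (hk : MemLp k 2) :
    c • hsOp k hk = hsOp (c • k) (hk.const_smul c) := by
  ext1 f
  refine Lp.ext ?_
  filter_upwards [Lp.coeFn_smul c (hsOp k hk f), hsOp_apply hk f, hsOp_apply (hk.const_smul c) f]
    with x h1 h2 h3
  rw [smul_apply, h1, h3, Pi.smul_apply, h2, smul_eq_mul, ← integral_const_mul]
  congr 1; ext y
  simp only [Pi.smul_apply, smul_eq_mul]; ring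

/-- Sequential Banach–Alaoglu, carried from the dual to the space itself by the Riesz isomorphism.
-/
lemma exists_weakly_convergent_subseq {H : Type*} [NormedAddCommGroup H] [InnerProductSpace ℂ H]
    [CompleteSpace H] [TopologicalSpace.SeparableSpace H] {f : ℕ → H} (hf : ∀ n, ‖f n‖ ≤ 1) :
    ∃ g : H, ‖g‖ ≤ 1 ∧ ∃ φ : ℕ → ℕ, StrictMono φ ∧
      ∀ v, Tendsto (fun n => inner ℂ (f (φ n)) v) atTop (𝓝 (inner ℂ g v)) := by
  have hc := WeakDual.isSeqCompact_closedBall ℂ H (0 : StrongDual ℂ H) 1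
  obtain ⟨a, ha, φ, hφ, hlim⟩ := hc
    (x := fun n => StrongDual.toWeakDual (InnerProductSpace.toDual ℂ H (f n))) (fun n => by
      simpa using hf n)
  refine ⟨(InnerProductSpace.toDual ℂ H).symm (WeakDual.toStrongDual a), ?_, φ, hφ, fun v => ?_⟩
  · simpa using ha
  · rw [InnerProductSpace.toDual_symm_apply]
    have := (WeakDual.eval_continuous v).continuousAt.tendsto.comp hlim
    simpa [Function.comp_def] using! this

/-- Almost every row of the kernel is an `L²` function, so weak convergence of the inputs gives
pointwise convergence of the outputs almost everywhere. Cauchy–Schwarz on rows supplies an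
integrable majorant, and dominated convergence turns this into norm convergence. -/
lemma isCompactOperator_hsOp {k : ℝ × ℝ → ℂ} (hk : MemLp k 2) :
    IsCompactOperator (hsOp k hk) := by
  suffices h : IsSeqCompact (hsOp k hk '' Metric.closedBall 0 1) from
    ⟨_, h.isCompact, mem_of_superset (Metric.closedBall_mem_nhds 0 one_pos)
      (subset_preimage_image _ _)⟩
  intro y hy
  choose f hf hfy using hy
  have hf1 : ∀ n, ‖f n‖ ≤ 1 := fun n => by simpa using hf n
  have : Fact ((2 : ℝ≥0∞) ≠ ∞) := ⟨by simp⟩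
  obtain ⟨g, hg, φ, hφ, hlim⟩ := exists_weakly_convergent_subseq hf1
  refine ⟨hsOp k hk g, ⟨g, by simpa using hg, rfl⟩, φ, hφ, ?_⟩
  have hdiff : ∀ n, ‖hsOp k hk (f (φ n)) - hsOp k hk g‖ ^ 2 =
      ∫ x, ‖∫ y, k (x, y) * (f (φ n) - g) y‖ ^ 2 := fun n => by
    rw [← map_sub]; exact norm_toLp_sq (memLp_two_integral_kernel hk (Lp.memLp _))
  have hpt : ∀ᵐ x : ℝ, Tendsto (fun n => ‖∫ y, k (x, y) * (f (φ n) - g : Lp ℂ 2 volume) y‖ ^ 2)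
      atTop (𝓝 0) := by
    filter_upwards [ae_memLp_two_section hk] with x hx
    have h1 : ∀ n, ∫ y, k (x, y) * (f (φ n) - g : Lp ℂ 2 volume) y =
        conj (inner ℂ (f (φ n) - g) (hx.star.toLp _)) := fun n => by
      rw [L2.inner_def, ← integral_conj]
      refine integral_congr_ae ?_
      filter_upwards [hx.star.coeFn_toLp] with y hy
      rw [hy]
      simp
    have h2 : Tendsto (fun n => inner ℂ (f (φ n) - g) (hx.star.toLp _)) atTop (𝓝 (0 : ℂ)) := by
      simp only [inner_sub_left]
      simpa using (hlim (hx.star.toLp _)).sub_const (inner ℂ g (hx.star.toLp _))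
    simp only [h1, RCLike.norm_conj]
    simpa using h2.norm.pow 2
  have hsq : Tendsto (fun n => ‖hsOp k hk (f (φ n)) - hsOp k hk g‖ ^ 2) atTop (𝓝 0) := by
    simp only [hdiff]
    rw [← integral_zero ℝ ℝ (μ := volume)]
    refine tendsto_integral_of_dominated_convergence
      -- The factor `4` is the square of `‖f (φ n) - g‖ ≤ 2`.
      (fun x => (∫ y, ‖k (x, y)‖ ^ 2) * 4)
      (fun n => (aestronglyMeasurable_integral_kernel hk (Lp.memLp _)).norm.pow 2)
      ((integrable_sq_section hk).mul_const 4) (fun n => ?_) hpt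
    filter_upwards [ae_memLp_two_section hk] with x hx
    rw [Real.norm_of_nonneg (by positivity)]
    refine (norm_integral_mul_sq_le hx (Lp.memLp _)).trans ?_
    rw [← norm_Lp_sq]
    have : ‖f (φ n) - g‖ ≤ 2 := (norm_sub_le _ _).trans (by linarith [hf1 (φ n)])
    have h0 : 0 ≤ ∫ y, ‖k (x, y)‖ ^ 2 := integral_nonneg fun _ => by positivity
    gcongr
    nlinarith [norm_nonneg (f (φ n) - g)]
  have h3 : Tendsto (fun n => ‖hsOp k hk (f (φ n)) - hsOp k hk g‖) atTop (𝓝 0) := by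
    simpa [Real.sqrt_sq (norm_nonneg _)] using hsq.sqrt
  have h4 := tendsto_iff_norm_sub_tendsto_zero.2 h3
  simpa [Function.comp_def, hfy] using h4

/-- The Fredholm alternative, in the form used here. -/
lemma isUnit_one_sub_of_isCompactOperator {H : Type*} [NormedAddCommGroup H] [NormedSpace ℂ H]
    [CompleteSpace H] {A : H →L[ℂ] H} (hA : IsCompactOperator A) (h : ∀ f, A f = f → f = 0) :
    IsUnit (1 - A) := by
  rcases hA.hasEigenvalue_or_mem_resolventSet (one_ne_zero (α := ℂ)) with h1 | h1
  · obtain ⟨v, hv⟩ := h1.exists_hasEigenvector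
    exact absurd (h v (by simpa using hv.apply_eq_smul)) hv.2
  · simpa [spectrum.mem_resolventSet_iff] using h1

/-! ### Weights and a locally singular majorant -/

/-- The weight `1 + |x|`. -/
def wt (x : ℝ) : ℝ := 1 + |x|

lemma one_le_wt (x : ℝ) : 1 ≤ wt x := by unfold wt; linarith [abs_nonneg x]

lemma wt_pos (x : ℝ) : 0 < wt x := zero_lt_one.trans_le (one_le_wt x)

lemma abs_le_wt (x : ℝ) : |x| ≤ wt x := by unfold wt; linarith

lemma continuous_wt : Continuous wt := by unfold wt; fun_prop

lemma wt_sub_le (x y : ℝ) : wt (x - y) ≤ wt x * wt y := by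
  unfold wt
  nlinarith [abs_sub x y, abs_nonneg x, abs_nonneg y, mul_nonneg (abs_nonneg x) (abs_nonneg y)]

lemma wt_rpow_pos (x a : ℝ) : 0 < wt x ^ a := Real.rpow_pos_of_pos (wt_pos x) a

lemma continuous_wt_rpow (a : ℝ) : Continuous fun x => wt x ^ a :=
  continuous_wt.rpow_const fun x => Or.inl (wt_pos x).ne'

lemma integrable_wt_rpow {a : ℝ} (ha : 1 < a) : Integrable fun x => wt x ^ (-a) := by
  have := integrable_one_add_norm (E := ℝ) (μ := volume) (r := a) (by simpa using ha)
  simpa [wt] using this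

lemma memLp_wt_rpow {a : ℝ} (ha : 1 / 2 < a) : MemLp (fun x => wt x ^ (-a)) 2 := by
  refine (memLp_two_iff_integrable_sq (continuous_wt_rpow _).aestronglyMeasurable).2 ?_
  refine (integrable_wt_rpow (a := 2 * a) (by linarith)).congr (Eventually.of_forall fun x => ?_)
  dsimp only
  rw [← Real.rpow_natCast, ← Real.rpow_mul (wt_pos x).le]
  congr 1; push_cast; ring

/-- A majorant for the singularity of the kernels. -/
def kap (z : ℝ) : ℝ := 1 + |z| ^ (-(1 / 4) : ℝ)

lemma one_le_kap (z : ℝ) : 1 ≤ kap z := by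
  unfold kap; linarith [Real.rpow_nonneg (abs_nonneg z) (-(1 / 4) : ℝ)]

lemma kap_pos (z : ℝ) : 0 < kap z := zero_lt_one.trans_le (one_le_kap z)

lemma kap_neg (z : ℝ) : kap (-z) = kap z := by simp [kap]

lemma measurable_kap : Measurable kap := by unfold kap; fun_prop

lemma integrable_local_rpow :
    Integrable ((Ioo (-1 : ℝ) 1).indicator fun z => |z| ^ (-(1 / 2) : ℝ)) := by
  rw [integrable_indicator_iff measurableSet_Ioo]
  have h1 : IntegrableOn (fun z : ℝ => |z| ^ (-(1 / 2) : ℝ)) (Ioc 0 1) := by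
    have h := (intervalIntegral.intervalIntegrable_rpow' (a := 0) (b := 1)
      (r := (-(1 / 2) : ℝ)) (by norm_num))
    rw [intervalIntegrable_iff_integrableOn_Ioc_of_le zero_le_one] at h
    exact h.congr_fun (fun z hz => by simp only [abs_of_pos hz.1]) measurableSet_Ioc
  have h2 : IntegrableOn (fun z : ℝ => |z| ^ (-(1 / 2) : ℝ)) (Ico (-1) 0) := by
    have h := (integrable_indicator_iff measurableSet_Ioc).2 h1 |>.comp_neg
    rw [← integrable_indicator_iff measurableSet_Ico]
    refine h.congr (Eventually.of_forall fun z => ?_)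
    simp only [indicator, mem_Ioc, mem_Ico, abs_neg]
    refine if_congr ⟨fun h => ⟨by linarith, by linarith⟩, fun h => ⟨by linarith, by linarith⟩⟩ rfl rfl
  have h3 : IntegrableOn (fun z : ℝ => |z| ^ (-(1 / 2) : ℝ)) {0} := by
    simp [integrableOn_singleton_iff]
  refine ((h1.union h2).union h3).mono_set fun z hz => ?_
  rcases lt_trichotomy z 0 with h | h | h
  · exact Or.inl (Or.inr ⟨hz.1.le, h⟩)
  · exact Or.inr h
  · exact Or.inl (Or.inl ⟨h, hz.2.le⟩)

/-- The AM–GM inequality separates the singularity from `v`: near `0` the product `|z|^{-1/4} v` is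
at most `|z|^{-1/2} + v²`, and elsewhere `kap z ≤ 2`. The singular term is integrable and the rest
does not involve `z`, so integrals of `kap (x - y) * v y` are bounded uniformly in `x`. -/
lemma kap_mul_le (z : ℝ) {v : ℝ} (hv : 0 ≤ v) :
    kap z * v ≤ (Ioo (-1 : ℝ) 1).indicator (fun z => |z| ^ (-(1 / 2) : ℝ)) z + (2 * v + v ^ 2) := by
  unfold kap
  by_cases hz : z ∈ Ioo (-1 : ℝ) 1
  · rw [indicator_of_mem hz]
    have h : (|z| ^ (-(1 / 2) : ℝ)) = (|z| ^ (-(1 / 4) : ℝ)) ^ 2 := by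
      rw [← Real.rpow_natCast, ← Real.rpow_mul (abs_nonneg z)]; norm_num
    rw [h]
    nlinarith [sq_nonneg (|z| ^ (-(1 / 4) : ℝ) - v), sq_nonneg (|z| ^ (-(1 / 4) : ℝ)), sq_nonneg v]
  · rw [indicator_of_notMem hz]
    have h1 : 1 ≤ |z| := by
      by_contra h
      push Not at h
      exact hz (abs_lt.1 h)
    have h2 : |z| ^ (-(1 / 4) : ℝ) ≤ 1 := Real.rpow_le_one_of_one_le_of_nonpos h1 (by norm_num)
    nlinarith [sq_nonneg v]

/-- The uniform bound for `∫ kap (x - y) v y dy`. -/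
def kapBound (v : ℝ → ℝ) : ℝ :=
  (∫ z, (Ioo (-1 : ℝ) 1).indicator (fun z => |z| ^ (-(1 / 2) : ℝ)) z) +
    ∫ y, (2 * v y + v y ^ 2)

lemma integrable_kap_majorant {v : ℝ → ℝ} (h1 : Integrable v) (h2 : Integrable fun y => v y ^ 2)
    (x : ℝ) : Integrable fun y =>
      (Ioo (-1 : ℝ) 1).indicator (fun z => |z| ^ (-(1 / 2) : ℝ)) (x - y) +
        (2 * v y + v y ^ 2) :=
  (integrable_local_rpow.comp_sub_left x).add ((h1.const_mul 2).add h2)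

lemma integrable_kap_mul {v : ℝ → ℝ} (hv : ∀ y, 0 ≤ v y) (h1 : Integrable v)
    (h2 : Integrable fun y => v y ^ 2) (x : ℝ) : Integrable fun y => kap (x - y) * v y := by
  refine (integrable_kap_majorant h1 h2 x).mono'
    ((measurable_kap.comp (measurable_const.sub measurable_id)).aestronglyMeasurable.mul h1.1)
    (Eventually.of_forall fun y => ?_)
  rw [Real.norm_of_nonneg (mul_nonneg (kap_pos _).le (hv y))]
  exact kap_mul_le _ (hv y)

lemma integral_kap_mul_le {v : ℝ → ℝ} (hv : ∀ y, 0 ≤ v y) (h1 : Integrable v)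
    (h2 : Integrable fun y => v y ^ 2) (x : ℝ) : ∫ y, kap (x - y) * v y ≤ kapBound v := by
  refine (integral_mono (integrable_kap_mul hv h1 h2 x) (integrable_kap_majorant h1 h2 x)
    fun y => kap_mul_le _ (hv y)).trans (le_of_eq ?_)
  refine (integral_add (integrable_local_rpow.comp_sub_left x) ((h1.const_mul 2).add h2)).trans ?_
  rw [integral_sub_left_eq_self (fun z => (Ioo (-1 : ℝ) 1).indicator (fun z => |z| ^ (-(1 / 2) : ℝ)) z)]
  rfl

/-! ### The Laplace representation of the kernel -/

/-- The absolutely convergent form of `tildeG lam x`, with the value `0` at the singularity. -/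
def lapG (lam x : ℝ) : ℂ :=
  if x = 0 then 0 else
    -(1 / (2 * (Real.pi : ℂ))) * ∫ t in Ioi (0 : ℝ), Complex.exp (-(lam * t)) / (t + Complex.I * x)

lemma le_norm_add_I_mul (t x : ℝ) : |x| ≤ ‖(t : ℂ) + Complex.I * x‖ := by
  simpa using Complex.abs_im_le_norm ((t : ℂ) + Complex.I * x)

lemma le_norm_add_I_mul' (t x : ℝ) : |t| ≤ ‖(t : ℂ) + Complex.I * x‖ := by
  simpa using Complex.abs_re_le_norm ((t : ℂ) + Complex.I * x)

lemma add_I_mul_ne_zero (t : ℝ) {x : ℝ} (hx : x ≠ 0) : (t : ℂ) + Complex.I * x ≠ 0 := by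
  have := (abs_pos.2 hx).trans_le (le_norm_add_I_mul t x)
  exact norm_pos_iff.1 this

lemma integrableOn_exp_neg_mul {lam : ℝ} (hl : 0 < lam) :
    IntegrableOn (fun t : ℝ => Real.exp (-(lam * t))) (Ioi 0) := by
  simpa using exp_neg_integrableOn_Ioi 0 hl

lemma integral_exp_neg_mul_Ioi' {lam : ℝ} (hl : 0 < lam) :
    ∫ t in Ioi (0 : ℝ), Real.exp (-(lam * t)) = 1 / lam := by
  have := integral_exp_mul_Ioi (a := -lam) (by linarith) 0
  simpa [neg_div_neg_eq] using this

lemma norm_cexp_neg_mul (lam t : ℝ) : ‖Complex.exp (-((lam : ℂ) * t))‖ = Real.exp (-(lam * t)) := by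
  rw [Complex.norm_exp]; simp

lemma norm_lap_integrand_le (lam t : ℝ) {x : ℝ} (hx : x ≠ 0) :
    ‖Complex.exp (-(lam * t)) / (t + Complex.I * x)‖ ≤ Real.exp (-(lam * t)) * (1 / |x|) := by
  rw [norm_div, norm_cexp_neg_mul, div_eq_mul_one_div]
  gcongr
  exact le_norm_add_I_mul t x

lemma continuous_lap_integrand (lam : ℝ) {x : ℝ} (hx : x ≠ 0) :
    Continuous fun t : ℝ => Complex.exp (-((lam : ℂ) * t)) / (t + Complex.I * x) :=
  Continuous.div (by fun_prop) (by fun_prop) fun t => add_I_mul_ne_zero t hx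

lemma integrableOn_lap_integrand {lam : ℝ} (hl : 0 < lam) {x : ℝ} (hx : x ≠ 0) :
    IntegrableOn (fun t : ℝ => Complex.exp (-((lam : ℂ) * t)) / (t + Complex.I * x)) (Ioi 0) :=
  ((integrableOn_exp_neg_mul hl).mul_const (1 / |x|)).mono'
    (continuous_lap_integrand lam hx).aestronglyMeasurable
    (Eventually.of_forall fun t => norm_lap_integrand_le lam t hx)

lemma norm_one_sub_exp_le {t : ℝ} (ht : 0 ≤ t) (x : ℝ) {R : ℝ} (hR : 0 ≤ R) :
    ‖1 - Complex.exp (-((t + Complex.I * x) * R))‖ ≤ 2 := by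
  refine (norm_sub_le _ _).trans ?_
  rw [norm_one, Complex.norm_exp]
  have h4 : (-((t + Complex.I * x) * R) : ℂ).re = -(t * R) := by simp
  rw [h4]
  have : Real.exp (-(t * R)) ≤ 1 := Real.exp_le_one_iff.2 (by nlinarith)
  linarith

/-- For `ξ ≤ 0 < lam` one has `1/(ξ - lam) = -∫₀^∞ e^{(ξ-lam)t} dt`; after exchanging the integrals
the one over `ξ` is elementary. -/
lemma intervalIntegral_plane_div {lam : ℝ} (hl : 0 < lam) {x : ℝ} (hx : x ≠ 0) {R : ℝ}
    (hR : 0 ≤ R) :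
    ∫ ξ in (-R)..0, Complex.exp (Complex.I * x * ξ) / ((ξ : ℂ) - lam) =
      -∫ t in Ioi (0 : ℝ), Complex.exp (-(lam * t)) / (t + Complex.I * x) *
        (1 - Complex.exp (-((t + Complex.I * x) * R))) := by
  have h1 : ∀ ξ ∈ Ioc (-R) 0, Complex.exp (Complex.I * x * ξ) / ((ξ : ℂ) - lam) =
      -∫ t in Ioi (0 : ℝ), Complex.exp (Complex.I * x * ξ) * Complex.exp (((ξ : ℂ) - lam) * t) := by
    intro ξ hξ
    rw [integral_const_mul, integral_exp_mul_complex_Ioi (by simp; linarith [hξ.2])]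
    simp [div_eq_mul_inv]
  rw [intervalIntegral.integral_of_le (by linarith), setIntegral_congr_fun measurableSet_Ioc h1,
    integral_neg, integral_integral_swap]
  · congr 1
    refine integral_congr_ae (Eventually.of_forall fun t => ?_)
    dsimp only
    have h2 : ∀ ξ : ℝ, Complex.exp (Complex.I * x * ξ) * Complex.exp (((ξ : ℂ) - lam) * t) =
        Complex.exp (-(lam * t)) * Complex.exp ((t + Complex.I * x) * ξ) := fun ξ => by
      rw [← Complex.exp_add, ← Complex.exp_add]; congr 1; ring
    simp only [h2]
    rw [integral_const_mul, ← intervalIntegral.integral_of_le (by linarith),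
      integral_exp_mul_complex (add_I_mul_ne_zero t hx)]
    simp; ring
  · have hi : Integrable (fun z : ℝ × ℝ => (1 : ℝ) * Real.exp (-(lam * z.2)))
        ((volume.restrict (Ioc (-R) 0)).prod (volume.restrict (Ioi 0))) :=
      (integrable_const 1).mul_prod (integrableOn_exp_neg_mul hl)
    refine hi.mono' (by fun_prop) ?_
    rw [Measure.prod_restrict]
    refine (ae_restrict_iff' (measurableSet_Ioc.prod measurableSet_Ioi)).2
      (Eventually.of_forall fun z hz => ?_)
    simp only [Function.uncurry]
    rw [norm_mul, Complex.norm_exp, Complex.norm_exp, one_mul]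
    have ha : (Complex.I * x * z.1 : ℂ).re = 0 := by simp
    have hb : (((z.1 : ℂ) - lam) * z.2).re = (z.1 - lam) * z.2 := by simp
    rw [ha, hb, Real.exp_zero, one_mul]
    apply Real.exp_le_exp.2
    have := hz.1.2
    have h3 : 0 < z.2 := hz.2
    nlinarith

lemma tendsto_intervalIntegral_plane_div {lam : ℝ} (hl : 0 < lam) {x : ℝ} (hx : x ≠ 0) :
    Tendsto (fun R : ℝ => ∫ ξ in (-R)..0, Complex.exp (Complex.I * x * ξ) / ((ξ : ℂ) - lam)) atTop
      (𝓝 (-∫ t in Ioi (0 : ℝ), Complex.exp (-(lam * t)) / (t + Complex.I * x))) := by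
  have hc : (fun R : ℝ => -∫ t in Ioi (0 : ℝ), Complex.exp (-(lam * t)) / (t + Complex.I * x) *
      (1 - Complex.exp (-((t + Complex.I * x) * R)))) =ᶠ[atTop]
      fun R : ℝ => ∫ ξ in (-R)..0, Complex.exp (Complex.I * x * ξ) / ((ξ : ℂ) - lam) := by
    filter_upwards [eventually_ge_atTop 0] with R hR
    exact (intervalIntegral_plane_div hl hx hR).symm
  refine Tendsto.congr' hc ?_
  refine Tendsto.neg ?_
  refine tendsto_integral_filter_of_dominated_convergence
    (fun t => Real.exp (-(lam * t)) * (1 / |x|) * 2) ?_ ?_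
    (((integrableOn_exp_neg_mul hl).mul_const _).mul_const _) ?_
  · refine Eventually.of_forall fun R => Continuous.aestronglyMeasurable ?_
    exact (continuous_lap_integrand lam hx).mul (by fun_prop)
  · filter_upwards [eventually_ge_atTop 0] with R hR
    refine (ae_restrict_iff' measurableSet_Ioi).2 (Eventually.of_forall fun t ht => ?_)
    have ht : 0 < t := ht
    rw [norm_mul]
    exact mul_le_mul (norm_lap_integrand_le lam t hx) (norm_one_sub_exp_le ht.le x hR) (norm_nonneg _) (by positivity)
  · refine (ae_restrict_iff' measurableSet_Ioi).2 (Eventually.of_forall fun t ht => ?_)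
    have ht : 0 < t := ht
    have h5 : Tendsto (fun R : ℝ => Complex.exp (-((t + Complex.I * x) * R))) atTop (𝓝 0) := by
      rw [tendsto_zero_iff_norm_tendsto_zero]
      have h6 : ∀ R : ℝ, ‖Complex.exp (-((t + Complex.I * x) * R))‖ = Real.exp (-(t * R)) :=
        fun R => by rw [Complex.norm_exp]; simp
      simp only [h6]
      exact Real.tendsto_exp_neg_atTop_nhds_zero.comp (tendsto_id.const_mul_atTop ht)
    simpa using (h5.const_sub 1).const_mul (Complex.exp (-(lam * t)) / (t + Complex.I * x))

lemma tildeG_eq_lapG {lam : ℝ} (hl : 0 < lam) {x : ℝ} (hx : x ≠ 0) :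
    tildeG lam x = lapG lam x := by
  refine Tendsto.limUnder_eq ?_
  rw [lapG, if_neg hx, neg_mul_comm]
  exact (tendsto_intervalIntegral_plane_div hl hx).const_mul _

lemma measurable_lapG (lam : ℝ) : Measurable (lapG lam) := by
  refine Measurable.ite (measurableSet_singleton 0) measurable_const (Measurable.const_mul ?_ _)
  refine StronglyMeasurable.measurable ?_
  refine StronglyMeasurable.integral_prod_right (f := fun x t : ℝ =>
    Complex.exp (-((lam : ℂ) * t)) / (t + Complex.I * x)) ?_
  refine Measurable.stronglyMeasurable ?_
  unfold Function.uncurry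
  fun_prop

lemma lapG_neg (lam x : ℝ) : lapG lam (-x) = conj (lapG lam x) := by
  by_cases hx : x = 0
  · simp [lapG, hx]
  rw [lapG, if_neg (neg_ne_zero.2 hx), lapG, if_neg hx, map_mul, ← integral_conj]
  congr 1
  · simp only [map_neg, map_div₀, map_mul, map_one, map_ofNat, Complex.conj_ofReal]
  · refine integral_congr_ae (Eventually.of_forall fun t => ?_)
    simp [← Complex.exp_conj]

lemma norm_two_pi_inv_le : ‖-(1 / (2 * (Real.pi : ℂ)))‖ ≤ 1 := by
  rw [norm_neg, norm_div, norm_mul]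
  simp only [norm_one, Complex.norm_ofNat, Complex.norm_real, Real.norm_eq_abs,
    abs_of_pos Real.pi_pos]
  rw [div_le_one (by positivity)]
  linarith [Real.pi_gt_three]

lemma norm_lapG_le_div {lam : ℝ} (hl : 0 < lam) (x : ℝ) :
    ‖lapG lam x‖ ≤ 1 / lam * (1 / |x|) := by
  by_cases hx : x = 0
  · simp [lapG, hx]
  rw [lapG, if_neg hx, norm_mul]
  calc _ ≤ 1 * (∫ t in Ioi (0 : ℝ), Real.exp (-(lam * t)) * (1 / |x|)) := by
        gcongr
        · exact norm_two_pi_inv_le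
        · exact norm_integral_le_of_norm_le ((integrableOn_exp_neg_mul hl).mul_const _)
            (Eventually.of_forall fun t => norm_lap_integrand_le lam t hx)
    _ = _ := by rw [integral_mul_const, integral_exp_neg_mul_Ioi' hl, one_mul]

/-- Since `|t + ix|` dominates both `t` and `|x|`, it dominates `t^{7/8} |x|^{1/8}`, and `t^{-7/8}
e^{-lam t}` is still integrable. The exponent `1/8` is small enough for the square of the kernel to
be bounded by a multiple of `kap`. -/
lemma exists_integral_norm_lap_le {lam : ℝ} (hl : 0 < lam) :
    ∃ C, 0 ≤ C ∧ ∀ x : ℝ, x ≠ 0 → ∫ t in Ioi (0 : ℝ), ‖Complex.exp (-(lam * t)) / (t + Complex.I * x)‖ ≤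
      C * |x| ^ (-(1 / 8) : ℝ) := by
  have hint : IntegrableOn (fun t : ℝ => t ^ (-(7 / 8) : ℝ) * Real.exp (-lam * t)) (Ioi 0) := by
    have := integrableOn_rpow_mul_exp_neg_mul_rpow (p := 1) (s := -(7 / 8)) (by norm_num)
      one_pos hl
    simpa using this
  refine ⟨∫ t in Ioi (0 : ℝ), t ^ (-(7 / 8) : ℝ) * Real.exp (-lam * t),
    setIntegral_nonneg measurableSet_Ioi fun t ht => ?_, fun x hx => ?_⟩
  · have := Real.rpow_nonneg (le_of_lt (mem_Ioi.1 ht)) (-(7 / 8) : ℝ)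
    positivity
  rw [← integral_mul_const]
  refine setIntegral_mono_on (integrableOn_lap_integrand hl hx).norm (hint.mul_const _)
    measurableSet_Ioi fun t ht => ?_
  have ht : 0 < t := ht
  have hx' := abs_pos.2 hx
  rw [norm_div, norm_cexp_neg_mul, ← neg_mul]
  have hn := norm_pos_iff.2 (add_I_mul_ne_zero t hx)
  have h1 : t ^ (7 / 8 : ℝ) * |x| ^ (1 / 8 : ℝ) ≤ ‖(t : ℂ) + Complex.I * x‖ := by
    calc _ ≤ ‖(t : ℂ) + Complex.I * x‖ ^ (7 / 8 : ℝ) *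
          ‖(t : ℂ) + Complex.I * x‖ ^ (1 / 8 : ℝ) := by
          gcongr
          · exact (le_abs_self t).trans (le_norm_add_I_mul' t x)
          · exact le_norm_add_I_mul t x
      _ = _ := by rw [← Real.rpow_add hn]; norm_num
  have h2 : t ^ (-(7 / 8) : ℝ) * Real.exp (-lam * t) * |x| ^ (-(1 / 8) : ℝ) =
      Real.exp (-lam * t) / (t ^ (7 / 8 : ℝ) * |x| ^ (1 / 8 : ℝ)) := by
    rw [Real.rpow_neg ht.le, Real.rpow_neg hx'.le]
    field_simp
  rw [h2]
  gcongr

lemma exists_norm_lapG_le_rpow {lam : ℝ} (hl : 0 < lam) :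
    ∃ C, 0 ≤ C ∧ ∀ x, ‖lapG lam x‖ ≤ C * |x| ^ (-(1 / 8) : ℝ) := by
  obtain ⟨C, hC, h⟩ := exists_integral_norm_lap_le hl
  refine ⟨C, hC, fun x => ?_⟩
  by_cases hx : x = 0
  · simp [lapG, hx]
  rw [lapG, if_neg hx, norm_mul]
  calc _ ≤ 1 * ∫ t in Ioi (0 : ℝ), ‖Complex.exp (-(lam * t)) / (t + Complex.I * x)‖ :=
        mul_le_mul norm_two_pi_inv_le (norm_integral_le_integral_norm _) (norm_nonneg _) zero_le_one
    _ ≤ _ := by rw [one_mul]; exact h x hx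

/-- Uniformity in `R` is the point: this is the majorant for letting `R → ∞` under a convolution
integral. -/
lemma exists_norm_intervalIntegral_plane_div_le {lam : ℝ} (hl : 0 < lam) :
    ∃ C, 0 ≤ C ∧ ∀ R, 0 ≤ R → ∀ x : ℝ, x ≠ 0 →
      ‖∫ ξ in (-R)..0, Complex.exp (Complex.I * x * ξ) / ((ξ : ℂ) - lam)‖ ≤
        C * |x| ^ (-(1 / 8) : ℝ) := by
  obtain ⟨C, hC, h⟩ := exists_integral_norm_lap_le hl
  refine ⟨C * 2, by positivity, fun R hR x hx => ?_⟩
  rw [intervalIntegral_plane_div hl hx hR, norm_neg]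
  calc _ ≤ ∫ t in Ioi (0 : ℝ), ‖Complex.exp (-(lam * t)) / (t + Complex.I * x)‖ * 2 := by
        refine norm_integral_le_of_norm_le ((integrableOn_lap_integrand hl hx).norm.mul_const 2)
          ((ae_restrict_iff' measurableSet_Ioi).2 (Eventually.of_forall fun t ht => ?_))
        rw [norm_mul]
        exact mul_le_mul_of_nonneg_left (norm_one_sub_exp_le (le_of_lt ht) x hR) (norm_nonneg _)
    _ ≤ _ := by
        rw [integral_mul_const]
        nlinarith [h x hx]

/-- `exp(-i lam x) lapG lam x` is differentiable in `lam`, with an elementary derivative. -/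
lemma hasDerivAt_exp_mul_lapG {lam : ℝ} (hl : 0 < lam) {x : ℝ} (hx : x ≠ 0) :
    HasDerivAt (fun l : ℝ => Complex.exp (-(Complex.I * l * x)) * lapG l x)
      (Complex.exp (-(Complex.I * lam * x)) / (2 * Real.pi * lam)) lam := by
  -- Once the oscillation is absorbed, the integrand is `e^{-l(t+ix)}/(t+ix)`. Differentiation in
  -- `l` cancels the denominator, and restricting to `l > lam/2` gives the majorant `e^{-lam t/2}`.
  have h := (hasDerivAt_integral_of_dominated_loc_of_deriv_le
    (μ := volume.restrict (Ioi (0 : ℝ))) (x₀ := lam) (s := Ioi (lam / 2))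
    (F := fun (l : ℝ) (t : ℝ) => Complex.exp (-(l * (t + Complex.I * x))) / (t + Complex.I * x))
    (F' := fun (l : ℝ) (t : ℝ) => -Complex.exp (-(l * (t + Complex.I * x))))
    (bound := fun t => Real.exp (-(lam / 2 * t))) (Ioi_mem_nhds (by linarith)) ?_ ?_ ?_ ?_ ?_ ?_).2
  · have hfun : (fun l : ℝ => Complex.exp (-(Complex.I * l * x)) * lapG l x) = fun l : ℝ =>
        -(1 / (2 * (Real.pi : ℂ))) * ∫ t in Ioi (0 : ℝ),
          Complex.exp (-(l * (t + Complex.I * x))) / (t + Complex.I * x) := by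
      ext l
      rw [lapG, if_neg hx, mul_left_comm, ← integral_const_mul]
      congr 2; ext t
      rw [← mul_div_assoc, ← Complex.exp_add]
      congr 2; ring
    rw [hfun]
    refine (h.const_mul (-(1 / (2 * (Real.pi : ℂ))))).congr_deriv ?_
    rw [integral_neg]
    have h2 : ∀ t : ℝ, Complex.exp (-((lam : ℂ) * (t + Complex.I * x))) =
        Complex.exp (-(Complex.I * lam * x)) * Complex.exp (-(lam : ℂ) * t) := fun t => by
      rw [← Complex.exp_add]; congr 1; ring
    simp only [h2]
    rw [integral_const_mul, integral_exp_mul_complex_Ioi (by simpa using hl)]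
    have : (lam : ℂ) ≠ 0 := by exact_mod_cast hl.ne'
    have hpi : (Real.pi : ℂ) ≠ 0 := by exact_mod_cast Real.pi_ne_zero
    simp
    field_simp
  · refine Eventually.of_forall fun l => Continuous.aestronglyMeasurable ?_
    exact Continuous.div (by fun_prop) (by fun_prop) fun t => add_I_mul_ne_zero t hx
  · have := (integrableOn_lap_integrand hl hx).const_mul (Complex.exp (-(Complex.I * lam * x)))
    refine this.congr (Eventually.of_forall fun t => ?_)
    dsimp only
    rw [← mul_div_assoc, ← Complex.exp_add]
    congr 2; ring
  · exact Continuous.aestronglyMeasurable (by fun_prop)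
  · refine (ae_restrict_iff' measurableSet_Ioi).2 (Eventually.of_forall fun t ht l hl' => ?_)
    have ht : 0 < t := ht
    have hl' : lam / 2 < l := hl'
    rw [norm_neg, Complex.norm_exp]
    apply Real.exp_le_exp.2
    simp
    nlinarith
  · exact integrableOn_exp_neg_mul (by linarith)
  · refine Eventually.of_forall fun t l _ => ?_
    have h3 : HasDerivAt (fun l : ℝ => -((l : ℂ) * (t + Complex.I * x)))
        (-(1 * (t + Complex.I * x))) l := (Complex.ofRealCLM.hasDerivAt.mul_const _).neg
    refine (h3.cexp.div_const _).congr_deriv ?_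
    have := add_I_mul_ne_zero t hx
    field_simp

/-! ### The boundary kernels and convolution with them -/

/-- The kernels `boundaryG` with `tildeG` in its absolutely convergent form. -/
def kerG : Side → ℝ → ℝ → ℂ
  | .above, lam, x => (Ioi (0 : ℝ)).indicator (fun t => Complex.I * planeWave lam t) x
      - lapG lam x
  | .below, lam, x => (Iio (0 : ℝ)).indicator (fun t => -(Complex.I * planeWave lam t)) x
      - lapG lam x

lemma norm_planeWave (lam x : ℝ) : ‖planeWave lam x‖ = 1 := by
  rw [planeWave, Complex.norm_exp]; simp

lemma continuous_planeWave (lam : ℝ) : Continuous (planeWave lam) := by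
  unfold planeWave; fun_prop

lemma planeWave_mul_exp_neg (lam x : ℝ) :
    planeWave lam x * Complex.exp (-(Complex.I * lam * x)) = 1 := by
  rw [planeWave, ← Complex.exp_add, add_neg_cancel, Complex.exp_zero]

lemma conj_planeWave (lam x : ℝ) :
    conj (planeWave lam x) = Complex.exp (-(Complex.I * lam * x)) := by
  rw [planeWave, ← Complex.exp_conj]; simp

lemma planeWave_neg (lam x : ℝ) : planeWave lam (-x) = conj (planeWave lam x) := by
  rw [conj_planeWave, planeWave]; simp

lemma planeWave_sub (lam x y : ℝ) :
    planeWave lam (x - y) = planeWave lam x * Complex.exp (-(Complex.I * lam * y)) := by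
  rw [planeWave, planeWave, ← Complex.exp_add]; congr 1; push_cast; ring

lemma measurable_kerG (σ : Side) (lam : ℝ) : Measurable (kerG σ lam) := by
  cases σ
  · exact (((continuous_planeWave lam).measurable.const_mul _).indicator measurableSet_Ioi).sub
      (measurable_lapG lam)
  · exact (((continuous_planeWave lam).measurable.const_mul _).neg.indicator measurableSet_Iio).sub
      (measurable_lapG lam)

lemma boundaryG_ae_eq (σ : Side) {lam : ℝ} (hl : 0 < lam) :
    boundaryG σ lam =ᵐ[volume] kerG σ lam := by
  filter_upwards [compl_mem_ae_iff.2 (measure_singleton (0 : ℝ))] with x hx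
  cases σ <;> simp only [boundaryG, kerG, tildeG_eq_lapG hl hx]

lemma norm_kerG_le (σ : Side) (lam x : ℝ) : ‖kerG σ lam x‖ ≤ 1 + ‖lapG lam x‖ := by
  cases σ
  all_goals
    refine (norm_sub_le _ _).trans ?_
    gcongr
    refine (norm_indicator_le_norm_self _ _).trans ?_
    simp [norm_planeWave]

/-- With `a = |x|^{-1/8}` one has `kap x = 1 + a²`, and `(1 + C a)² ≤ 2 (1 + C)² (1 + a²)`. The
first power serves the convolution bounds, the square the Hilbert–Schmidt norm and the iteration of
the equation. -/
lemma exists_norm_kerG_le (σ : Side) {lam : ℝ} (hl : 0 < lam) :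
    ∃ C, 0 ≤ C ∧ ∀ x, ‖kerG σ lam x‖ ≤ C * kap x ∧ ‖kerG σ lam x‖ ^ 2 ≤ C * kap x := by
  obtain ⟨C, hC, h⟩ := exists_norm_lapG_le_rpow hl
  refine ⟨2 * (1 + C) ^ 2, by positivity, fun x => ?_⟩
  have h1 := (norm_kerG_le σ lam x).trans (add_le_add_right (h x) 1)
  set a := |x| ^ (-(1 / 8) : ℝ) with ha
  have ha0 : 0 ≤ a := Real.rpow_nonneg (abs_nonneg x) _
  have hk : kap x = 1 + a ^ 2 := by
    rw [kap, ha, ← Real.rpow_natCast, ← Real.rpow_mul (abs_nonneg x)]; norm_num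
  have h2 : (1 + C * a) ^ 2 ≤ 2 * (1 + C) ^ 2 * kap x := by
    rw [hk]
    nlinarith [sq_nonneg (1 - C * a), mul_nonneg hC (sq_nonneg a), sq_nonneg C, sq_nonneg a]
  have h3 : 1 ≤ 1 + C * a := by nlinarith [mul_nonneg hC ha0]
  constructor
  · refine h1.trans (le_trans ?_ h2)
    nlinarith
  · exact le_trans (by gcongr) h2

/-- This symmetry of the kernels is what makes the two convolution operators adjoint to each other.
-/
lemma kerG_below_eq (lam x : ℝ) : kerG .below lam x = conj (kerG .above lam (-x)) := by
  simp only [kerG, map_sub, lapG_neg, Complex.conj_conj]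
  congr 1
  by_cases hx : x < 0
  · simp [hx, planeWave_neg]
  · simp [hx]

/-- The common `lapG` part cancels and the two half-line waves join into a full plane wave. -/
lemma kerG_above_sub_below (lam : ℝ) {x : ℝ} (hx : x ≠ 0) :
    kerG .above lam x - kerG .below lam x = Complex.I * planeWave lam x := by
  simp only [kerG]
  rcases lt_or_gt_of_ne hx with h | h
  · simp [h, not_lt.2 h.le]; ring
  · simp [h, not_lt.2 h.le]

/-- `h` is integrable and square integrable. -/
def L1L2 (h : ℝ → ℂ) : Prop := Integrable h ∧ Integrable fun x => ‖h x‖ ^ 2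

/-- Convolution with the boundary kernel. -/
def cv (σ : Side) (lam : ℝ) (h : ℝ → ℂ) (x : ℝ) : ℂ := ∫ y, kerG σ lam (x - y) * h y

lemma convolution_boundaryG (σ : Side) {lam : ℝ} (hl : 0 < lam) (h : ℝ → ℂ) (x : ℝ) :
    (boundaryG σ lam ⋆[ContinuousLinearMap.mul ℝ ℂ, volume] h) x = cv σ lam h x := by
  rw [convolution_def, cv, ← integral_sub_left_eq_self (fun y => kerG σ lam (x - y) * h y) volume x]
  refine integral_congr_ae ?_
  filter_upwards [boundaryG_ae_eq σ hl] with t ht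
  simp [ht]

lemma cv_congr (σ : Side) (lam : ℝ) {h k : ℝ → ℂ} (hk : h =ᵐ[volume] k) :
    cv σ lam h = cv σ lam k := by
  ext x
  refine integral_congr_ae ?_
  filter_upwards [hk] with y hy
  rw [hy]

lemma aestronglyMeasurable_kerG_sub (σ : Side) (lam x : ℝ) :
    AEStronglyMeasurable (fun y => kerG σ lam (x - y)) volume :=
  ((measurable_kerG σ lam).comp (measurable_const.sub measurable_id)).aestronglyMeasurable

lemma L1L2.kap {h : ℝ → ℂ} (hh : L1L2 h) (x : ℝ) : Integrable fun y => kap (x - y) * ‖h y‖ :=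
  integrable_kap_mul (fun _ => norm_nonneg _) hh.1.norm hh.2 x

lemma integrable_kerG_mul (σ : Side) {lam : ℝ} (hl : 0 < lam) {h : ℝ → ℂ} (hh : L1L2 h) (x : ℝ) :
    Integrable fun y => kerG σ lam (x - y) * h y := by
  obtain ⟨C, hC, hb⟩ := exists_norm_kerG_le σ hl
  refine ((hh.kap x).const_mul C).mono' ((aestronglyMeasurable_kerG_sub σ lam x).mul hh.1.1)
    (Eventually.of_forall fun y => ?_)
  rw [norm_mul, ← mul_assoc]
  exact mul_le_mul_of_nonneg_right (hb _).1 (norm_nonneg _)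

lemma exists_integral_norm_kerG_mul_le (σ : Side) {lam : ℝ} (hl : 0 < lam) {h : ℝ → ℂ}
    (hh : L1L2 h) : ∃ C, 0 ≤ C ∧ ∀ x, ∫ y, ‖kerG σ lam (x - y) * h y‖ ≤ C := by
  obtain ⟨C, hC, hb⟩ := exists_norm_kerG_le σ hl
  have key : ∀ x, ∫ y, ‖kerG σ lam (x - y) * h y‖ ≤ C * kapBound fun y => ‖h y‖ := fun x => by
    calc _ ≤ ∫ y, C * (kap (x - y) * ‖h y‖) := by
          refine integral_mono (integrable_kerG_mul σ hl hh x).norm ((hh.kap x).const_mul C)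
            fun y => ?_
          dsimp only
          rw [norm_mul, ← mul_assoc]
          exact mul_le_mul_of_nonneg_right (hb _).1 (norm_nonneg _)
      _ ≤ _ := by
          rw [integral_const_mul]
          exact mul_le_mul_of_nonneg_left
            (integral_kap_mul_le (fun _ => norm_nonneg _) hh.1.norm hh.2 x) hC
  exact ⟨_, (integral_nonneg fun _ => norm_nonneg _).trans (key 0), key⟩

lemma exists_norm_cv_le (σ : Side) {lam : ℝ} (hl : 0 < lam) {h : ℝ → ℂ} (hh : L1L2 h) :
    ∃ C, 0 ≤ C ∧ ∀ x, ‖cv σ lam h x‖ ≤ C := by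
  obtain ⟨C, hC, hb⟩ := exists_integral_norm_kerG_mul_le σ hl hh
  exact ⟨C, hC, fun x => (norm_integral_le_integral_norm _).trans (hb x)⟩

lemma aestronglyMeasurable_kerG_prod (σ : Side) (lam : ℝ) {h : ℝ → ℂ}
    (hh : AEStronglyMeasurable h volume) :
    AEStronglyMeasurable (fun z : ℝ × ℝ => kerG σ lam (z.1 - z.2) * h z.2)
      (volume.prod volume) :=
  ((measurable_kerG σ lam).comp (measurable_fst.sub measurable_snd)).aestronglyMeasurable.mul
    hh.comp_snd

lemma aestronglyMeasurable_cv (σ : Side) (lam : ℝ) {h : ℝ → ℂ}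
    (hh : AEStronglyMeasurable h volume) : AEStronglyMeasurable (cv σ lam h) volume :=
  (aestronglyMeasurable_kerG_prod σ lam hh).integral_prod_right'

lemma integrable_mul_kerG_mul (σ : Side) {lam : ℝ} (hl : 0 < lam) {h k : ℝ → ℂ} (hh : L1L2 h)
    (hk : Integrable k) :
    Integrable (fun z : ℝ × ℝ => k z.1 * (kerG σ lam (z.1 - z.2) * h z.2))
      (volume.prod volume) := by
  have hm : AEStronglyMeasurable (fun z : ℝ × ℝ => k z.1 * (kerG σ lam (z.1 - z.2) * h z.2))
      (volume.prod volume) := hk.1.comp_fst.mul (aestronglyMeasurable_kerG_prod σ lam hh.1.1)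
  obtain ⟨C, hC, hb⟩ := exists_integral_norm_kerG_mul_le σ hl hh
  refine (integrable_prod_iff hm).2 ⟨Eventually.of_forall fun x =>
    (integrable_kerG_mul σ hl hh x).const_mul (k x), ?_⟩
  refine (hk.norm.mul_const C).mono' hm.norm.integral_prod_right'
    (Eventually.of_forall fun x => ?_)
  rw [Real.norm_of_nonneg (integral_nonneg fun _ => norm_nonneg _)]
  simp only [norm_mul (k x)]
  rw [integral_const_mul]
  exact mul_le_mul_of_nonneg_left (hb x) (norm_nonneg _)

/-- Formal adjointness of the two boundary operators: Fubini together with `kerG_below_eq`. -/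
lemma integral_conj_mul_cv {lam : ℝ} (hl : 0 < lam) {h k : ℝ → ℂ} (hh : L1L2 h) (hk : L1L2 k) :
    ∫ x, conj (k x) * cv .above lam h x = ∫ y, conj (cv .below lam k y) * h y := by
  have hk' : Integrable fun x => conj (k x) :=
    Complex.conjCLE.toContinuousLinearMap.integrable_comp hk.1
  have h1 := integrable_mul_kerG_mul .above hl hh hk'
  calc ∫ x, conj (k x) * cv .above lam h x
      = ∫ x, ∫ y, conj (k x) * (kerG .above lam (x - y) * h y) := by
        simp only [cv, integral_const_mul]
    _ = ∫ y, ∫ x, conj (k x) * (kerG .above lam (x - y) * h y) := integral_integral_swap h1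
    _ = _ := by
        congr 1; ext y
        rw [cv, ← integral_conj, ← integral_mul_const]
        congr 1; ext x
        rw [kerG_below_eq, map_mul, Complex.conj_conj, neg_sub]
        ring

lemma cv_above_sub_below {lam : ℝ} (hl : 0 < lam) {h : ℝ → ℂ} (hh : L1L2 h) (x : ℝ) :
    cv .above lam h x - cv .below lam h x =
      Complex.I * planeWave lam x * ∫ y, h y * Complex.exp (-(Complex.I * lam * y)) := by
  rw [cv, cv, ← integral_sub (integrable_kerG_mul _ hl hh x) (integrable_kerG_mul _ hl hh x),
    ← integral_const_mul]
  refine integral_congr_ae ?_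
  filter_upwards [compl_mem_ae_iff.2 (measure_singleton x)] with y hy
  rw [← sub_mul, kerG_above_sub_below lam (sub_ne_zero.2 (Ne.symm hy)), planeWave_sub]
  ring

/-! ### Boundedness of solutions -/

lemma lintegral_kap_mul_le {v : ℝ → ℝ} (h1 : Integrable v)
    (h2 : Integrable fun y => v y ^ 2) (x : ℝ) :
    ∫⁻ y, ENNReal.ofReal (kap (x - y) * |v y|) ≤ ENNReal.ofReal (kapBound fun y => |v y|) := by
  have h2' : Integrable fun y => |v y| ^ 2 := by simpa using h2
  rw [← ofReal_integral_eq_lintegral_ofReal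
    (integrable_kap_mul (fun _ => abs_nonneg _) h1.abs h2' x)
    (Eventually.of_forall fun y => mul_nonneg (kap_pos _).le (abs_nonneg _))]
  exact ENNReal.ofReal_le_ofReal (integral_kap_mul_le (fun _ => abs_nonneg _) h1.abs h2' x)

lemma enorm_cv_le (σ : Side) (lam : ℝ) (h : ℝ → ℂ) (x : ℝ) :
    ‖cv σ lam h x‖ₑ ≤ ∫⁻ y, ‖kerG σ lam (x - y)‖ₑ * ‖h y‖ₑ := by
  refine (enorm_integral_le_lintegral_enorm _).trans (le_of_eq ?_)
  simp only [enorm_mul]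

/-- A solution of the integral equation with bounded inhomogeneity and integrable `u m` is bounded:
iterate the equation twice. -/
lemma exists_ae_bound_of_eq_add_cv (σ : Side) {lam : ℝ} (hl : 0 < lam) {u : ℝ → ℝ}
    (hu1 : Integrable u) (hu2 : Integrable fun x => u x ^ 2) {g m : ℝ → ℂ} {B : ℝ}
    (hg : ∀ x, ‖g x‖ ≤ B) (hm : Integrable fun y => (u y : ℂ) * m y)
    (heq : ∀ᵐ x, m x = g x + cv σ lam (fun y => (u y : ℂ) * m y) x) :
    ∃ B', 0 ≤ B' ∧ ∀ᵐ x, ‖m x‖ ≤ B' := by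
  obtain ⟨C, hC, hb⟩ := exists_norm_kerG_le σ hl
  set k : ℝ → ℝ≥0∞ := fun z => ‖kerG σ lam z‖ₑ with hkdef
  have hkm : Measurable k := (measurable_kerG σ lam).enorm
  set D : ℝ≥0∞ := ENNReal.ofReal C * ENNReal.ofReal (kapBound fun y => |u y|) with hD
  have hum : AEMeasurable (fun y => ‖u y‖ₑ) volume := hu1.1.enorm
  have hhm : AEMeasurable (fun y => ‖(u y : ℂ) * m y‖ₑ) volume := hm.1.enorm
  have eC : ∀ r v : ℝ, 0 ≤ r → ENNReal.ofReal C * ENNReal.ofReal (r * |v|) =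
      ENNReal.ofReal (C * r) * ‖v‖ₑ := fun r v hr => by
    rw [← ofReal_norm, Real.norm_eq_abs, ← ENNReal.ofReal_mul hC,
      ← ENNReal.ofReal_mul (by positivity), mul_assoc]
  have hk1 : ∀ x, ∫⁻ y, k (x - y) * ‖u y‖ₑ ≤ D := fun x => by
    rw [hD]
    refine le_trans ?_ (mul_le_mul_right (lintegral_kap_mul_le hu1 hu2 x) _)
    rw [← lintegral_const_mul' _ _ ENNReal.ofReal_ne_top]
    refine lintegral_mono fun y => ?_
    dsimp only
    rw [eC _ _ (kap_pos _).le]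
    gcongr
    rw [hkdef]
    dsimp only
    rw [← ofReal_norm]
    exact ENNReal.ofReal_le_ofReal (hb _).1
  have hk2 : ∀ x, ∫⁻ y, k (x - y) ^ 2 * ‖u y‖ₑ ≤ D := fun x => by
    rw [hD]
    refine le_trans ?_ (mul_le_mul_right (lintegral_kap_mul_le hu1 hu2 x) _)
    rw [← lintegral_const_mul' _ _ ENNReal.ofReal_ne_top]
    refine lintegral_mono fun y => ?_
    dsimp only
    rw [eC _ _ (kap_pos _).le]
    gcongr
    rw [hkdef]
    dsimp only
    rw [← ofReal_norm, ← ENNReal.ofReal_pow (norm_nonneg _)]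
    exact ENNReal.ofReal_le_ofReal (hb _).2
  have hk3 : ∀ y, ∫⁻ z, k (z - y) ^ 2 * ‖u z‖ₑ ≤ D := fun y => by
    rw [hD]
    refine le_trans ?_ (mul_le_mul_right (lintegral_kap_mul_le hu1 hu2 y) _)
    rw [← lintegral_const_mul' _ _ ENNReal.ofReal_ne_top]
    refine lintegral_mono fun z => ?_
    dsimp only
    rw [eC _ _ (kap_pos _).le]
    gcongr
    rw [hkdef]
    dsimp only
    rw [← ofReal_norm, ← ENNReal.ofReal_pow (norm_nonneg _), ← kap_neg, neg_sub]
    exact ENNReal.ofReal_le_ofReal (hb _).2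
  set E : ℝ≥0∞ := ENNReal.ofReal B with hE
  have hgE : ∀ x, ‖g x‖ₑ ≤ E := fun x => by
    rw [← ofReal_norm]; exact ENNReal.ofReal_le_ofReal (hg x)
  set M : ℝ≥0∞ := ∫⁻ y, ‖(u y : ℂ) * m y‖ₑ with hM
  have hMtop : M ≠ ∞ := hm.2.ne
  have step : ∀ᵐ x, ‖m x‖ₑ ≤ E + ∫⁻ y, k (x - y) * ‖(u y : ℂ) * m y‖ₑ := by
    filter_upwards [heq] with x hx
    rw [hx]
    refine (enorm_add_le _ _).trans (add_le_add (hgE x) ?_)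
    exact enorm_cv_le σ lam _ x
  -- The equation is substituted into its own right-hand side. From `k(x-z) k(z-y) ≤ k(x-z)² +
  -- k(z-y)²`, integration against `|u(z)|` costs at most `D + D` uniformly in `x` and `y`, so only
  -- the `L¹` norm `M` of `u m` is needed.
  have two : ∀ x, ∫⁻ z, k (x - z) * ‖(u z : ℂ) * m z‖ₑ ≤ D * E + (D + D) * M := fun x => by
    calc ∫⁻ z, k (x - z) * ‖(u z : ℂ) * m z‖ₑ
        ≤ ∫⁻ z, (k (x - z) * ‖u z‖ₑ * E +
            ∫⁻ y, k (x - z) * ‖u z‖ₑ * (k (z - y) * ‖(u y : ℂ) * m y‖ₑ)) := by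
          refine lintegral_mono_ae ?_
          filter_upwards [step] with z hz
          rw [enorm_mul, show ‖(u z : ℂ)‖ₑ = ‖u z‖ₑ by simp [← ofReal_norm], ← mul_assoc,
            lintegral_const_mul'' _ (by fun_prop), ← mul_add]
          gcongr
      _ = (∫⁻ z, k (x - z) * ‖u z‖ₑ * E) +
            ∫⁻ z, ∫⁻ y, k (x - z) * ‖u z‖ₑ * (k (z - y) * ‖(u y : ℂ) * m y‖ₑ) := by
          refine lintegral_add_left' ?_ _
          exact ((hkm.comp (measurable_const.sub measurable_id)).aemeasurable.mul hum).mul_const _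
      _ ≤ D * E + (D + D) * M := by
          refine add_le_add ?_ ?_
          · rw [lintegral_mul_const' _ _ ENNReal.ofReal_ne_top]
            exact mul_le_mul_left (hk1 x) _
          · rw [lintegral_lintegral_swap]
            · rw [hM, ← lintegral_const_mul'' _ hhm]
              refine lintegral_mono fun y => ?_
              calc ∫⁻ z, k (x - z) * ‖u z‖ₑ * (k (z - y) * ‖(u y : ℂ) * m y‖ₑ)
                  ≤ ∫⁻ z, (k (x - z) ^ 2 * ‖u z‖ₑ + k (z - y) ^ 2 * ‖u z‖ₑ) *
                      ‖(u y : ℂ) * m y‖ₑ := by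
                    refine lintegral_mono fun z => ?_
                    dsimp only
                    rw [← mul_assoc]
                    gcongr
                    rw [mul_right_comm, ← add_mul]
                    gcongr
                    rcases le_total (k (x - z)) (k (z - y)) with h | h
                    · calc _ ≤ k (z - y) * k (z - y) := by gcongr
                        _ = k (z - y) ^ 2 := (sq _).symm
                        _ ≤ _ := le_add_self
                    · calc _ ≤ k (x - z) * k (x - z) := by gcongr
                        _ = k (x - z) ^ 2 := (sq _).symm
                        _ ≤ _ := le_self_add
                _ = (∫⁻ z, (k (x - z) ^ 2 * ‖u z‖ₑ + k (z - y) ^ 2 * ‖u z‖ₑ)) *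
                      ‖(u y : ℂ) * m y‖ₑ := lintegral_mul_const' _ _ enorm_ne_top
                _ ≤ _ := by
                    gcongr
                    rw [lintegral_add_left']
                    · exact add_le_add (hk2 x) (hk3 y)
                    · exact ((hkm.comp (measurable_const.sub measurable_id)).pow_const 2
                        |>.aemeasurable.mul hum)
            · refine AEMeasurable.mul (AEMeasurable.mul ?_ hum.comp_fst) (AEMeasurable.mul ?_ hhm.comp_snd)
              · exact (hkm.comp (measurable_const.sub measurable_fst)).aemeasurable
              · exact (hkm.comp (measurable_fst.sub measurable_snd)).aemeasurable
  have htop : E + (D * E + (D + D) * M) ≠ ∞ := by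
    have hDt : D ≠ ∞ := ENNReal.mul_ne_top ENNReal.ofReal_ne_top ENNReal.ofReal_ne_top
    have hEt : E ≠ ∞ := ENNReal.ofReal_ne_top
    finiteness
  refine ⟨(E + (D * E + (D + D) * M)).toReal, ENNReal.toReal_nonneg, ?_⟩
  filter_upwards [step] with x hx
  rw [← toReal_enorm]
  exact ENNReal.toReal_mono htop (hx.trans (add_le_add le_rfl (two x)))

/-! ### Integrability of the potential -/

lemma MemWeightedLp.memLp_wt_rpow_mul {s : ℝ} {u : ℝ → ℝ} (hu : MemWeightedLp 2 s u) {a : ℝ}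
    (ha : a ≤ s) : MemLp (fun x => wt x ^ a * u x) 2 := by
  have h : ∀ x, wt x ^ a * u x = wt x ^ (a - s) * ((1 + |x|) ^ s • u x) := fun x => by
    rw [smul_eq_mul, ← mul_assoc]
    change _ = wt x ^ (a - s) * wt x ^ s * u x
    rw [← Real.rpow_add (wt_pos x)]; simp
  have hm : AEStronglyMeasurable (fun x => wt x ^ a * u x) volume := by
    simp only [h]
    exact (continuous_wt_rpow _).aestronglyMeasurable.mul hu.1
  refine MemLp.of_le hu hm (Eventually.of_forall fun x => ?_)
  rw [h, norm_mul, Real.norm_of_nonneg (wt_rpow_pos x _).le]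
  refine mul_le_of_le_one_left (norm_nonneg _) ?_
  exact Real.rpow_le_one_of_one_le_of_nonpos (one_le_wt x) (by linarith)

lemma MemWeightedLp.integrable_wt_rpow_mul {s : ℝ} {u : ℝ → ℝ} (hu : MemWeightedLp 2 s u) {a : ℝ}
    (ha : a < s - 1 / 2) : Integrable fun x => wt x ^ a * u x := by
  have h := (memLp_wt_rpow (a := s - a) (by linarith)).integrable_mul
    (hu.memLp_wt_rpow_mul le_rfl)
  refine h.congr (Eventually.of_forall fun x => ?_)
  simp only [Pi.mul_apply]
  rw [← mul_assoc, ← Real.rpow_add (wt_pos x)]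
  congr 2; ring

lemma MemWeightedLp.integrable_sq_wt_rpow_mul {s : ℝ} {u : ℝ → ℝ} (hu : MemWeightedLp 2 s u)
    {a : ℝ} (ha : a ≤ s) : Integrable fun x => (wt x ^ a * u x) ^ 2 :=
  (hu.memLp_wt_rpow_mul ha).integrable_sq

lemma MemWeightedLp.integrable {s : ℝ} {u : ℝ → ℝ} (hu : MemWeightedLp 2 s u)
    (hs : 1 / 2 < s) : Integrable u := by
  simpa using hu.integrable_wt_rpow_mul (a := 0) (by linarith)

lemma MemWeightedLp.integrable_sq {s : ℝ} {u : ℝ → ℝ} (hu : MemWeightedLp 2 s u)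
    (hs : 1 / 2 < s) : Integrable fun x => u x ^ 2 := by
  simpa using hu.integrable_sq_wt_rpow_mul (a := 0) (by linarith)

lemma L1L2.of_bound {u : ℝ → ℝ} (h1 : Integrable u) (h2 : Integrable fun x => u x ^ 2)
    {f : ℝ → ℂ} (hf : AEStronglyMeasurable f volume) {B : ℝ} (hB : ∀ᵐ x, ‖f x‖ ≤ B) :
    L1L2 fun x => (u x : ℂ) * f x := by
  have hm : AEStronglyMeasurable (fun x => (u x : ℂ) * f x) volume := h1.ofReal.1.mul hf
  refine ⟨(h1.norm.mul_const B).mono' hm ?_, (h2.mul_const (B ^ 2)).mono' (hm.norm.pow 2) ?_⟩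
  · filter_upwards [hB] with x hx
    rw [norm_mul, Complex.norm_real]
    gcongr
  · filter_upwards [hB] with x hx
    rw [norm_mul, Complex.norm_real, Real.norm_of_nonneg (by positivity), mul_pow,
      Real.norm_eq_abs, sq_abs]
    gcongr

/-! ### Homogeneous solutions: the resonance coefficient vanishes -/

lemma integrable_mul_exp {h : ℝ → ℂ} (hh : Integrable h) (a : ℝ) :
    Integrable fun y => h y * Complex.exp (-(Complex.I * a * y)) := by
  refine hh.norm.mono' (hh.1.mul (Continuous.aestronglyMeasurable (by fun_prop)))
    (Eventually.of_forall fun y => ?_)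
  rw [norm_mul, ← conj_planeWave, RCLike.norm_conj, norm_planeWave, mul_one]

/-- Pair the equation with `h = u φ`. One of the two boundary convolutions of `h` is `φ`, the other
differs from it by `± i e^{iλx} J`. As `u` is real, `h̄ φ = h φ̄`, so adjointness leaves only a
multiple of `|J|²`. -/
lemma integral_mul_exp_eq_zero_of_homogeneous {lam : ℝ} (hl : 0 < lam) {u : ℝ → ℝ} {σ : Side}
    {φ : ℝ → ℂ} (hh : L1L2 fun y => (u y : ℂ) * φ y)
    (heq : ∀ x, φ x = cv σ lam (fun y => (u y : ℂ) * φ y) x) :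
    ∫ y, (u y : ℂ) * φ y * Complex.exp (-(Complex.I * lam * y)) = 0 := by
  set h : ℝ → ℂ := fun y => (u y : ℂ) * φ y with hdef
  set J : ℂ := ∫ y, h y * Complex.exp (-(Complex.I * lam * y)) with hJ
  have hadj := integral_conj_mul_cv hl hh hh
  have hdiff := cv_above_sub_below hl hh
  have hae := aestronglyMeasurable_cv .above lam hh.1.1
  have hconj : Integrable fun x => conj (h x) :=
    Complex.conjCLE.toContinuousLinearMap.integrable_comp hh.1
  obtain ⟨C, -, hC⟩ := exists_norm_cv_le .above hl hh
  obtain ⟨C', -, hC'⟩ := exists_norm_cv_le .below hl hh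
  have i1 : Integrable fun x => conj (h x) * cv .above lam h x :=
    hconj.mul_bdd (c := C) hae (Eventually.of_forall hC)
  have i2 : Integrable fun x => conj (cv .below lam h x) * h x := by
    refine hh.1.bdd_mul (c := C') ?_ (Eventually.of_forall fun x => by
      rw [RCLike.norm_conj]; exact hC' x)
    exact RCLike.continuous_conj.comp_aestronglyMeasurable
      (aestronglyMeasurable_cv .below lam hh.1.1)
  have hzero : ∫ x, (conj (h x) * cv .above lam h x - conj (cv .below lam h x) * h x) = 0 := by
    rw [integral_sub i1 i2, hadj, sub_self]
  have hpt : ∀ x, conj (h x) * cv .above lam h x - conj (cv .below lam h x) * h x =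
      Complex.I * (match σ with
        | .above => -conj J * (h x * Complex.exp (-(Complex.I * lam * x)))
        | .below => J * conj (h x * Complex.exp (-(Complex.I * lam * x)))) := by
    intro x
    have hd := hdiff x
    rw [← hJ] at hd
    have hx := heq x
    cases σ
    · have hb : cv .below lam h x = φ x - Complex.I * planeWave lam x * J := by
        rw [hx]; linear_combination -hd
      rw [← hx, hb]
      simp only [hdef, map_sub, map_mul, Complex.conj_ofReal, Complex.conj_I, conj_planeWave]
      ring
    · have hb : cv .above lam h x = φ x + Complex.I * planeWave lam x * J := by
        rw [hx]; linear_combination hd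
      rw [← hx, hb]
      simp only [← conj_planeWave]
      simp only [hdef, map_mul, Complex.conj_ofReal, Complex.conj_conj]
      ring
  simp only [hpt] at hzero
  rw [integral_const_mul] at hzero
  have h3 : conj J * J = 0 := by
    cases σ
    · simp only [integral_const_mul] at hzero
      simpa [← hJ] using hzero
    · simp only [integral_const_mul, integral_conj] at hzero
      simpa [← hJ] using hzero
  simpa using h3

lemma cv_above_eq_cv_below {lam : ℝ} (hl : 0 < lam) {h : ℝ → ℂ} (hh : L1L2 h)
    (hJ : ∫ y, h y * Complex.exp (-(Complex.I * lam * y)) = 0) (x : ℝ) :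
    cv .above lam h x = cv .below lam h x := by
  have := cv_above_sub_below hl hh x
  rw [hJ, mul_zero] at this
  exact sub_eq_zero.1 this

/-! ### Homogeneous solutions: decay -/

/-- For `|y| < |x|/2` the sign of `x - y` is that of `x`, so for one of the two sides the half-line
wave vanishes there and only the decaying part `lapG` remains. -/
lemma exists_side_norm_kerG_le {lam : ℝ} (hl : 0 < lam) {x : ℝ} (hx : x ≠ 0) :
    ∃ σ : Side, ∀ y, |y| < |x| / 2 → ‖kerG σ lam (x - y)‖ ≤ 2 / lam * (1 / |x|) := by
  have hx' := abs_pos.2 hx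
  have key : ∀ y, |y| < |x| / 2 → ‖lapG lam (x - y)‖ ≤ 2 / lam * (1 / |x|) := fun y hy => by
    have h1 : |x| / 2 ≤ |x - y| := by linarith [abs_sub_abs_le_abs_sub x y]
    refine (norm_lapG_le_div hl _).trans ?_
    calc 1 / lam * (1 / |x - y|) ≤ 1 / lam * (1 / (|x| / 2)) := by gcongr
      _ = _ := by field_simp
  rcases lt_or_gt_of_ne hx with h | h
  · refine ⟨.above, fun y hy => ?_⟩
    have : ¬ (0 < x - y) := by
      rw [abs_of_neg h] at hy
      linarith [neg_abs_le y]
    simp only [kerG, indicator, mem_Ioi, this, if_false, zero_sub, norm_neg]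
    exact key y hy
  · refine ⟨.below, fun y hy => ?_⟩
    have : ¬ (x - y < 0) := by
      rw [abs_of_pos h] at hy
      linarith [le_abs_self y]
    simp only [kerG, indicator, mem_Iio, this, if_false, zero_sub, norm_neg]
    exact key y hy

/-- Split the convolution at `|y| = |x|/2`. The inner part is `O(1/|x|)` by
`exists_side_norm_kerG_le`; the side depends on the sign of `x`, so the equation is needed on both
sides. On the outer part a spare factor `w^ε` is taken from `u`; the choice `ε = (s - 1/2)/2` keeps
`w^ε u` in `L¹ ∩ L²`. -/
lemma exists_decay_step {s : ℝ} (hs : 1 / 2 < s) {u : ℝ → ℝ} (hu : MemWeightedLp 2 s u) {lam : ℝ}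
    (hl : 0 < lam) {φ : ℝ → ℂ} (hh : L1L2 fun y => (u y : ℂ) * φ y)
    (heq : ∀ σ x, φ x = cv σ lam (fun y => (u y : ℂ) * φ y) x) :
    ∃ D A : ℝ, 0 ≤ D ∧ 0 ≤ A ∧ ∀ x, x ≠ 0 → ∀ S, 0 ≤ S → (∀ y, |x| / 2 ≤ |y| → ‖φ y‖ ≤ S) →
      ‖φ x‖ ≤ D * (1 / |x|) + A * wt (|x| / 2) ^ (-((s - 1 / 2) / 2)) * S := by
  set ε := (s - 1 / 2) / 2 with hε
  have hε0 : 0 < ε := by rw [hε]; linarith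
  obtain ⟨C₁, hC₁, hb₁⟩ := exists_norm_kerG_le .above hl
  obtain ⟨C₂, hC₂, hb₂⟩ := exists_norm_kerG_le .below hl
  set C := max C₁ C₂ with hCdef
  have hC : 0 ≤ C := hC₁.trans (le_max_left _ _)
  have hb : ∀ σ x, ‖kerG σ lam x‖ ≤ C * kap x := fun σ x => by
    cases σ
    · exact (hb₁ x).1.trans (mul_le_mul_of_nonneg_right (le_max_left _ _) (kap_pos x).le)
    · exact (hb₂ x).1.trans (mul_le_mul_of_nonneg_right (le_max_right _ _) (kap_pos x).le)
  set v : ℝ → ℝ := fun y => |wt y ^ ε * u y| with hv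
  have hv0 : ∀ y, 0 ≤ v y := fun y => abs_nonneg _
  have hv1 : Integrable v := (hu.integrable_wt_rpow_mul (a := ε) (by linarith)).abs
  have hv2 : Integrable fun y => v y ^ 2 := by
    refine (hu.integrable_sq_wt_rpow_mul (a := ε) (by linarith)).congr
      (Eventually.of_forall fun y => (sq_abs _).symm)
  have hK : 0 ≤ kapBound v := (integral_nonneg fun y => mul_nonneg (kap_pos _).le (hv0 y)).trans
    (integral_kap_mul_le hv0 hv1 hv2 0)
  set h : ℝ → ℂ := fun y => (u y : ℂ) * φ y with hdef
  refine ⟨2 / lam * ∫ y, ‖h y‖, C * kapBound v, mul_nonneg (by positivity)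
    (integral_nonneg fun _ => norm_nonneg _), mul_nonneg hC hK, fun x hx S hS hφ => ?_⟩
  obtain ⟨σ, hσ⟩ := exists_side_norm_kerG_le hl hx
  set q := wt (|x| / 2) ^ (-ε) with hq
  have hq0 : 0 < q := wt_rpow_pos _ _
  have hpt : ∀ y, ‖kerG σ lam (x - y) * h y‖ ≤
      2 / lam * (1 / |x|) * ‖h y‖ + C * q * S * (kap (x - y) * v y) := fun y => by
    have t1 : 0 ≤ 2 / lam * (1 / |x|) * ‖h y‖ := by positivity
    have t2 : 0 ≤ C * q * S * (kap (x - y) * v y) :=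
      mul_nonneg (by positivity) (mul_nonneg (kap_pos _).le (hv0 y))
    rw [norm_mul]
    rcases lt_or_ge |y| (|x| / 2) with hy | hy
    · have := mul_le_mul_of_nonneg_right (hσ y hy) (norm_nonneg (h y))
      linarith
    · have h1 : |u y| ≤ q * v y := by
        rw [hv, hq]
        simp only [abs_mul, abs_of_pos (wt_rpow_pos y ε), ← mul_assoc]
        refine le_mul_of_one_le_left (abs_nonneg _) ?_
        rw [Real.rpow_neg (wt_pos _).le, inv_mul_eq_div, one_le_div (wt_rpow_pos _ _)]
        refine Real.rpow_le_rpow (wt_pos _).le ?_ hε0.le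
        unfold wt
        rw [abs_of_nonneg (by positivity : 0 ≤ |x| / 2)]
        linarith
      have h2 : ‖h y‖ ≤ q * v y * S := by
        rw [hdef]
        simp only [norm_mul, Complex.norm_real, Real.norm_eq_abs]
        exact mul_le_mul h1 (hφ y hy) (norm_nonneg _) (mul_nonneg hq0.le (hv0 y))
      have h3 := mul_le_mul (hb σ (x - y)) h2 (norm_nonneg _) (mul_nonneg hC (kap_pos _).le)
      calc _ ≤ C * kap (x - y) * (q * v y * S) := h3
        _ = C * q * S * (kap (x - y) * v y) := by ring
        _ ≤ _ := by linarith
  have iR1 : Integrable fun y => 2 / lam * (1 / |x|) * ‖h y‖ := hh.1.norm.const_mul _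
  have iR2 : Integrable fun y => C * q * S * (kap (x - y) * v y) :=
    (integrable_kap_mul hv0 hv1 hv2 x).const_mul _
  calc ‖φ x‖ = ‖cv σ lam h x‖ := by rw [← heq σ x]
    _ ≤ ∫ y, ‖kerG σ lam (x - y) * h y‖ := norm_integral_le_integral_norm _
    _ ≤ ∫ y, (2 / lam * (1 / |x|) * ‖h y‖ + C * q * S * (kap (x - y) * v y)) :=
        integral_mono (integrable_kerG_mul σ hl hh x).norm (iR1.add iR2) hpt
    _ = 2 / lam * (1 / |x|) * (∫ y, ‖h y‖) + C * q * S * ∫ y, kap (x - y) * v y := by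
        rw [integral_add iR1 iR2, integral_const_mul, integral_const_mul]
    _ ≤ 2 / lam * (1 / |x|) * (∫ y, ‖h y‖) + C * q * S * kapBound v := by
        gcongr
        exact integral_kap_mul_le hv0 hv1 hv2 x
    _ = _ := by ring

/-- A function whose size at `x` is controlled by `1/|x|` plus a small multiple of its size on
`|y| ≥ |x|/2` is `O(1/|x|)`. -/
lemma exists_le_div_wt_of_decay_step {φ : ℝ → ℂ} {B D A ε : ℝ} (hε : 0 < ε) (hB : ∀ x, ‖φ x‖ ≤ B)
    (hA : 0 ≤ A)
    (hstep : ∀ x, x ≠ 0 → ∀ S, 0 ≤ S → (∀ y, |x| / 2 ≤ |y| → ‖φ y‖ ≤ S) →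
      ‖φ x‖ ≤ D * (1 / |x|) + A * wt (|x| / 2) ^ (-ε) * S) :
    ∃ C, 0 ≤ C ∧ ∀ x, ‖φ x‖ ≤ C / wt x := by
  have hB0 : 0 ≤ B := (norm_nonneg _).trans (hB 0)
  have hlim : Tendsto (fun R : ℝ => A * (1 + R) ^ (-ε)) atTop (𝓝 0) := by
    have := ((tendsto_rpow_neg_atTop hε).comp (tendsto_atTop_add_const_left atTop 1 tendsto_id))
    simpa using this.const_mul A
  obtain ⟨R, hR1, hR⟩ := ((hlim.eventually (gt_mem_nhds (by norm_num : (0 : ℝ) < 1 / 4))).and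
    (eventually_gt_atTop 0)).exists
  obtain ⟨R0, hR0, rfl⟩ : ∃ R0 : ℝ, 0 < R0 ∧ R0 / 2 = R := ⟨2 * R, by linarith, by ring⟩
  set M := max B (2 * D / R0) with hM
  have hM0 : 0 ≤ M := hB0.trans (le_max_left _ _)
  have hMD : D ≤ M * R0 / 2 := by
    have : 2 * D / R0 ≤ M := le_max_right _ _
    rw [div_le_iff₀ hR0] at this
    linarith
  -- Dyadic induction. Beyond `R0` the coefficient of `S` is at most `1/4`, so the previous bound
  -- contributes half of `M / 2^(n+1)`; the requirement `M ≥ 2D/R0` makes `D/|x|` contribute at most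
  -- the other half.
  have P : ∀ n : ℕ, ∀ x, 2 ^ n * R0 ≤ |x| → ‖φ x‖ ≤ M / 2 ^ n := by
    intro n
    induction n with
    | zero => intro x _; rw [pow_zero, div_one]; exact (hB x).trans (le_max_left _ _)
    | succ n ih =>
      intro x hx
      have h2 : (0 : ℝ) < 2 ^ (n + 1) * R0 := by positivity
      have hx0 : 0 < |x| := h2.trans_le hx
      have h3 := hstep x (abs_pos.1 hx0) (M / 2 ^ n) (by positivity) fun y hy =>
        ih y (le_trans (by rw [pow_succ] at hx; linarith) hy)
      have h4 : A * wt (|x| / 2) ^ (-ε) ≤ 1 / 4 := by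
        refine le_trans ?_ hR1.le
        refine mul_le_mul_of_nonneg_left ?_ hA
        refine Real.rpow_le_rpow_of_nonpos (by positivity) ?_ (by linarith)
        unfold wt
        rw [abs_of_nonneg (by positivity : 0 ≤ |x| / 2)]
        have : R0 ≤ |x| := le_trans (le_mul_of_one_le_left hR0.le
          (one_le_pow₀ (by norm_num))) hx
        linarith
      have h5 : D * (1 / |x|) ≤ M / 2 / 2 ^ (n + 1) := by
        calc D * (1 / |x|) ≤ (M * R0 / 2) * (1 / (2 ^ (n + 1) * R0)) := by gcongr
          _ = _ := by field_simp
      have h6 : A * wt (|x| / 2) ^ (-ε) * (M / 2 ^ n) ≤ 1 / 4 * (M / 2 ^ n) := by gcongr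
      calc ‖φ x‖ ≤ M / 2 / 2 ^ (n + 1) + 1 / 4 * (M / 2 ^ n) := by linarith
        _ = M / 2 ^ (n + 1) := by rw [pow_succ]; field_simp; ring
  refine ⟨max (B * (1 + R0)) (2 * M * (R0 + 1)), le_max_of_le_left (by positivity), fun x => ?_⟩
  rw [le_div_iff₀ (wt_pos x)]
  rcases lt_or_ge |x| R0 with hx | hx
  · refine le_trans ?_ (le_max_left _ _)
    unfold wt
    exact mul_le_mul (hB x) (by linarith) (by positivity) hB0
  · refine le_trans ?_ (le_max_right _ _)
    obtain ⟨n, hn1, hn2⟩ := exists_nat_pow_near (x := |x| / R0) (y := 2)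
      ((one_le_div hR0).2 hx) (by norm_num)
    rw [le_div_iff₀ hR0] at hn1
    rw [div_lt_iff₀ hR0] at hn2
    have h7 := P n x hn1
    have h8 : wt x ≤ 2 ^ n * (2 * (R0 + 1)) := by
      unfold wt
      rw [pow_succ] at hn2
      have : (1 : ℝ) ≤ 2 ^ n := one_le_pow₀ (by norm_num)
      nlinarith
    calc ‖φ x‖ * wt x ≤ M / 2 ^ n * (2 ^ n * (2 * (R0 + 1))) :=
          mul_le_mul h7 h8 (wt_pos x).le (by positivity)
      _ = _ := by field_simp

/-! ### The Fourier transform of the density -/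

/-- The Fourier transform `∫ h(y) exp(-i ξ y) dy`. -/
def ft (h : ℝ → ℂ) (ξ : ℝ) : ℂ := ∫ y, h y * Complex.exp (-(Complex.I * ξ * y))

lemma norm_exp_neg_I_mul (ξ y : ℝ) : ‖Complex.exp (-(Complex.I * ξ * y))‖ = 1 := by
  rw [← conj_planeWave, RCLike.norm_conj, norm_planeWave]

lemma norm_ft_le (h : ℝ → ℂ) (ξ : ℝ) : ‖ft h ξ‖ ≤ ∫ y, ‖h y‖ := by
  refine (norm_integral_le_integral_norm _).trans (le_of_eq ?_)
  simp only [norm_mul, norm_exp_neg_I_mul, mul_one]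

lemma hasDerivAt_ft {h : ℝ → ℂ} (hh : Integrable h) (hyh : Integrable fun y : ℝ => (y : ℂ) * h y)
    (ξ : ℝ) : HasDerivAt (ft h) (ft (fun y : ℝ => -Complex.I * (y * h y)) ξ) ξ := by
  refine (hasDerivAt_integral_of_dominated_loc_of_deriv_le (μ := volume) (x₀ := ξ) (s := univ)
    (F := fun ξ y : ℝ => h y * Complex.exp (-(Complex.I * ξ * y)))
    (F' := fun (ξ y : ℝ) => -Complex.I * (y * h y) * Complex.exp (-(Complex.I * ξ * y)))
    (bound := fun y : ℝ => ‖(y : ℂ) * h y‖) univ_mem ?_ ?_ ?_ ?_ ?_ ?_).2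
  · exact Eventually.of_forall fun ξ => (integrable_mul_exp hh ξ).1
  · exact integrable_mul_exp hh ξ
  · exact (integrable_mul_exp (hyh.const_mul (-Complex.I)) ξ).1
  · refine Eventually.of_forall fun y ξ _ => le_of_eq ?_
    rw [norm_mul, norm_exp_neg_I_mul, norm_mul, norm_neg, Complex.norm_I, one_mul, mul_one]
  · exact hyh.norm
  · refine Eventually.of_forall fun y ξ _ => ?_
    have h3 : HasDerivAt (fun ξ : ℝ => -(Complex.I * (ξ : ℂ) * y)) (-(Complex.I * 1 * y)) ξ :=
      ((Complex.ofRealCLM.hasDerivAt.const_mul Complex.I).mul_const _).neg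
    refine (h3.cexp.const_mul (h y)).congr_deriv ?_
    ring

lemma continuous_ft {h : ℝ → ℂ} (hh : Integrable h) : Continuous (ft h) := by
  refine continuous_of_dominated (fun ξ => (integrable_mul_exp hh ξ).1) (bound := fun y => ‖h y‖)
    (fun ξ => Eventually.of_forall fun y => ?_) hh.norm (Eventually.of_forall fun y => by fun_prop)
  rw [norm_mul, norm_exp_neg_I_mul, mul_one]

lemma norm_ft_sub_le {h : ℝ → ℂ} (hh : Integrable h) (hyh : Integrable fun y : ℝ => (y : ℂ) * h y)
    (ξ η : ℝ) : ‖ft h ξ - ft h η‖ ≤ (∫ y : ℝ, ‖(y : ℂ) * h y‖) * |ξ - η| := by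
  have := Convex.norm_image_sub_le_of_norm_hasDerivWithin_le (f := ft h) (s := univ)
    (C := ∫ y : ℝ, ‖(y : ℂ) * h y‖) (x := η) (y := ξ)
    (fun x _ => (hasDerivAt_ft hh hyh x).hasDerivWithinAt) (fun x _ => by
      refine (norm_ft_le _ _).trans (le_of_eq ?_)
      simp only [norm_mul, norm_neg, Complex.norm_I, one_mul]) convex_univ (mem_univ _) (mem_univ _)
  simpa using this

lemma integral_gauss_mul_exp {ε : ℝ} (hε : 0 < ε) (v : ℝ) :
    ∫ ξ : ℝ, (Real.exp (-ε * ξ ^ 2) : ℂ) * Complex.exp (-(Complex.I * ξ * v)) =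
      ((√(Real.pi / ε) * Real.exp (-(1 / (4 * ε)) * v ^ 2) : ℝ) : ℂ) := by
  have h := fourierIntegral_gaussian (b := (ε : ℂ)) (by simpa using hε) (-(v : ℂ))
  have h2 : ((Real.pi : ℂ) / ε) ^ (1 / 2 : ℂ) = ((√(Real.pi / ε) : ℝ) : ℂ) := by
    rw [Real.sqrt_eq_rpow, Complex.ofReal_cpow (by positivity)]
    push_cast
    rfl
  rw [h2] at h
  push_cast
  refine Eq.trans (integral_congr_ae (Eventually.of_forall fun ξ => ?_)) (h.trans ?_)
  · dsimp only
    rw [mul_comm]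
    congr 2; ring
  · congr 2
    field_simp

lemma integral_gauss_majorant {ε : ℝ} (hε : 0 < ε) :
    ∫ v : ℝ, √(Real.pi / ε) * Real.exp (-(1 / (4 * ε)) * v ^ 2) = 2 * Real.pi := by
  rw [integral_const_mul, integral_gaussian, ← Real.sqrt_mul (by positivity)]
  have : Real.pi / ε * (Real.pi / (1 / (4 * ε))) = (2 * Real.pi) ^ 2 := by field_simp; ring
  rw [this, Real.sqrt_sq (by positivity)]

/-- Expanding `|ĥ|²` as a double integral and integrating in `ξ` first gives a Gaussian kernel in `y
- y'` whose mass is `2π` for every `ε`. The inequality `ab ≤ (a² + b²)/2` then bounds the quadratic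
form independently of `ε`. -/
lemma integral_gauss_mul_sq_ft_le {h : ℝ → ℂ} (hh : L1L2 h) {ε : ℝ} (hε : 0 < ε) :
    ∫ ξ : ℝ, Real.exp (-ε * ξ ^ 2) * ‖ft h ξ‖ ^ 2 ≤ 2 * Real.pi * ∫ y, ‖h y‖ ^ 2 := by
  set g : ℝ → ℝ := fun v => √(Real.pi / ε) * Real.exp (-(1 / (4 * ε)) * v ^ 2) with hg
  have hg0 : ∀ v, 0 ≤ g v := fun v => by rw [hg]; positivity
  have hgi : Integrable g := (integrable_exp_neg_mul_sq (by positivity)).const_mul _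
  have hgeven : ∀ v, g (-v) = g v := fun v => by simp [hg]
  set H : ℝ × ℝ → ℂ := fun z => h z.1 * conj (h z.2) with hH
  have hconj : Integrable fun x => conj (h x) :=
    Complex.conjCLE.toContinuousLinearMap.integrable_comp hh.1
  have hHi : Integrable H (volume.prod volume) := hh.1.mul_prod hconj
  have hgauss : Integrable fun ξ : ℝ => (Real.exp (-ε * ξ ^ 2) : ℂ) :=
    (integrable_exp_neg_mul_sq hε).ofReal
  have hprod : ∀ ξ : ℝ, ((‖ft h ξ‖ ^ 2 : ℝ) : ℂ) =
      ∫ z, H z * Complex.exp (-(Complex.I * ξ * ((z.1 - z.2 : ℝ) : ℂ))) ∂(volume.prod volume) := by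
    intro ξ
    have h1 : ((‖ft h ξ‖ ^ 2 : ℝ) : ℂ) = ft h ξ * conj (ft h ξ) := by
      rw [Complex.mul_conj, Complex.normSq_eq_norm_sq]
    rw [h1, ft, ← integral_conj, ← integral_prod_mul]
    congr 1; ext z
    rw [hH, map_mul, ← Complex.exp_conj]
    simp only [map_neg, map_mul, Complex.conj_I, Complex.conj_ofReal]
    rw [mul_mul_mul_comm, ← Complex.exp_add]
    congr 2
    push_cast; ring
  have hint : Integrable (Function.uncurry fun (ξ : ℝ) (z : ℝ × ℝ) =>
      (Real.exp (-ε * ξ ^ 2) : ℂ) *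
        (H z * Complex.exp (-(Complex.I * ξ * ((z.1 - z.2 : ℝ) : ℂ)))))
      (volume.prod (volume.prod volume)) := by
    refine (hgauss.mul_prod hHi).norm.mono' ?_ (Eventually.of_forall fun p => ?_)
    · refine AEStronglyMeasurable.mul (Continuous.aestronglyMeasurable (by fun_prop)) ?_
      exact hHi.1.comp_snd.mul (Continuous.aestronglyMeasurable (by fun_prop))
    · simp only [Function.uncurry, norm_mul, norm_exp_neg_I_mul, mul_one, le_refl]
  have hswap : ((∫ ξ : ℝ, Real.exp (-ε * ξ ^ 2) * ‖ft h ξ‖ ^ 2 : ℝ) : ℂ) =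
      ∫ z, H z * ((g (z.1 - z.2) : ℝ) : ℂ) ∂(volume.prod volume) := by
    rw [← integral_complex_ofReal]
    have h2 : ∀ ξ : ℝ, ((Real.exp (-ε * ξ ^ 2) * ‖ft h ξ‖ ^ 2 : ℝ) : ℂ) =
        ∫ z, (Real.exp (-ε * ξ ^ 2) : ℂ) *
          (H z * Complex.exp (-(Complex.I * ξ * ((z.1 - z.2 : ℝ) : ℂ)))) ∂(volume.prod volume) :=
      fun ξ => by rw [Complex.ofReal_mul, hprod, integral_const_mul]
    simp only [h2]
    rw [integral_integral_swap hint]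
    congr 1; ext z
    rw [hg, ← integral_gauss_mul_exp hε, ← integral_const_mul]
    congr 1; ext ξ
    ring
  have hA : Integrable (fun z : ℝ × ℝ => ‖h z.2‖ ^ 2 * g (z.1 - z.2)) (volume.prod volume) :=
    Integrable.convolution_integrand (ContinuousLinearMap.mul ℝ ℝ) hh.2 hgi
  have hA' : Integrable (fun z : ℝ × ℝ => ‖h z.1‖ ^ 2 * g (z.1 - z.2)) (volume.prod volume) := by
    refine hA.swap.congr (Eventually.of_forall fun z => ?_)
    simp only [Function.comp_apply, Prod.fst_swap, Prod.snd_swap]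
    rw [← hgeven, neg_sub]
  have iA : ∫ z : ℝ × ℝ, ‖h z.2‖ ^ 2 * g (z.1 - z.2) ∂(volume.prod volume) =
      2 * Real.pi * ∫ y, ‖h y‖ ^ 2 := by
    rw [integral_prod_symm _ hA]
    simp only [integral_const_mul]
    rw [← integral_gauss_majorant hε, mul_comm, ← integral_mul_const]
    congr 1; ext y
    rw [integral_sub_right_eq_self g y]
  have iA' : ∫ z : ℝ × ℝ, ‖h z.1‖ ^ 2 * g (z.1 - z.2) ∂(volume.prod volume) =
      2 * Real.pi * ∫ y, ‖h y‖ ^ 2 := by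
    rw [integral_prod _ hA']
    simp only [integral_const_mul]
    rw [← integral_gauss_majorant hε, mul_comm, ← integral_mul_const]
    congr 1; ext y
    rw [integral_sub_left_eq_self g volume y]
  calc ∫ ξ : ℝ, Real.exp (-ε * ξ ^ 2) * ‖ft h ξ‖ ^ 2
      ≤ ‖((∫ ξ : ℝ, Real.exp (-ε * ξ ^ 2) * ‖ft h ξ‖ ^ 2 : ℝ) : ℂ)‖ := by
        rw [Complex.norm_real]; exact le_abs_self _
    _ ≤ ∫ z : ℝ × ℝ, (1 / 2 * (‖h z.1‖ ^ 2 * g (z.1 - z.2)) +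
          1 / 2 * (‖h z.2‖ ^ 2 * g (z.1 - z.2))) ∂(volume.prod volume) := by
        rw [hswap]
        refine norm_integral_le_of_norm_le ((hA'.const_mul _).add (hA.const_mul _))
          (Eventually.of_forall fun z => ?_)
        rw [norm_mul, hH, norm_mul, RCLike.norm_conj, Complex.norm_real,
          Real.norm_of_nonneg (hg0 _)]
        nlinarith [mul_nonneg (sq_nonneg (‖h z.1‖ - ‖h z.2‖)) (hg0 (z.1 - z.2))]
    _ = 2 * Real.pi * ∫ y, ‖h y‖ ^ 2 := by
        rw [integral_add (hA'.const_mul _) (hA.const_mul _), integral_const_mul,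
          integral_const_mul, iA, iA']
        ring

/-- Plancherel's theorem, as an integrability statement for functions in `L¹ ∩ L²`. -/
lemma integrable_sq_ft {h : ℝ → ℂ} (hh : L1L2 h) : Integrable fun ξ => ‖ft h ξ‖ ^ 2 := by
  have hc : Continuous fun ξ => ‖ft h ξ‖ ^ 2 := (continuous_ft hh.1).norm.pow 2
  -- Fatou's lemma along `ε = 1/(n+1)`, the Gaussian bound being independent of `n`.
  refine integrable_of_tendsto (G := fun n ξ => Real.exp (-(1 / ((n : ℝ) + 1)) * ξ ^ 2) *
    ‖ft h ξ‖ ^ 2) (Eventually.of_forall fun ξ => ?_)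
    (fun n => Continuous.aestronglyMeasurable (by fun_prop)) ?_
  · have h1 : Tendsto (fun n : ℕ => -(1 / ((n : ℝ) + 1)) * ξ ^ 2) atTop (𝓝 0) := by
      simpa using (tendsto_one_div_add_atTop_nhds_zero_nat (𝕜 := ℝ)).neg.mul_const (ξ ^ 2)
    have h2 := (Real.continuous_exp.tendsto 0).comp h1
    simpa using h2.mul_const (‖ft h ξ‖ ^ 2)
  · refine ne_top_of_le_ne_top (b := ENNReal.ofReal (2 * Real.pi * ∫ y, ‖h y‖ ^ 2))
      ENNReal.ofReal_ne_top (liminf_le_of_frequently_le' (Frequently.of_forall fun n => ?_))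
    have hn : (0 : ℝ) < 1 / ((n : ℝ) + 1) := by positivity
    have hi : Integrable fun ξ : ℝ => Real.exp (-(1 / ((n : ℝ) + 1)) * ξ ^ 2) * ‖ft h ξ‖ ^ 2 := by
      refine (integrable_exp_neg_mul_sq hn).mul_bdd (c := (∫ y, ‖h y‖) ^ 2)
        hc.aestronglyMeasurable (Eventually.of_forall fun ξ => ?_)
      rw [norm_pow, norm_norm]
      exact pow_le_pow_left₀ (norm_nonneg _) (norm_ft_le h ξ) 2
    have h3 := integral_gauss_mul_sq_ft_le hh hn
    rw [← ofReal_integral_norm_eq_lintegral_enorm hi]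
    refine ENNReal.ofReal_le_ofReal (le_trans (le_of_eq ?_) h3)
    congr 1; ext ξ
    rw [Real.norm_of_nonneg (by positivity)]

/-- The quotient `ĥ(ξ) / (ξ - lam)`. -/
def ftQuot (h : ℝ → ℂ) (lam ξ : ℝ) : ℂ := ft h ξ / ((ξ : ℂ) - lam)

lemma norm_ftQuot_le {h : ℝ → ℂ} (hh : Integrable h) (hyh : Integrable fun y : ℝ => (y : ℂ) * h y)
    {lam : ℝ} (h0 : ft h lam = 0) (ξ : ℝ) : ‖ftQuot h lam ξ‖ ≤ ∫ y : ℝ, ‖(y : ℂ) * h y‖ := by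
  have h1 := norm_ft_sub_le hh hyh ξ lam
  rw [h0, sub_zero] at h1
  rw [ftQuot, norm_div, ← Complex.ofReal_sub, Complex.norm_real, Real.norm_eq_abs]
  exact div_le_of_le_mul₀ (abs_nonneg _) (integral_nonneg fun _ => norm_nonneg _) h1

lemma measurable_ftQuot {h : ℝ → ℂ} (hh : Integrable h) (lam : ℝ) : Measurable (ftQuot h lam) :=
  (continuous_ft hh).measurable.div (by fun_prop)

/-- Within distance `1` of `lam` the quotient is bounded, because `ĥ` is Lipschitz and vanishes at
`lam`. Farther away it is a product of the two square integrable functions `ĥ` and `1/|ξ - lam|`. A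
single majorant covers both cases, since `(1 + a)²` is at most `4` in the first and at most `4a²` in
the second. -/
lemma integrable_ftQuot {h : ℝ → ℂ} (hh : L1L2 h) (hyh : Integrable fun y : ℝ => (y : ℂ) * h y)
    {lam : ℝ} (h0 : ft h lam = 0) : Integrable (ftQuot h lam) := by
  set L := ∫ y : ℝ, ‖(y : ℂ) * h y‖ with hL
  have hL0 : 0 ≤ L := integral_nonneg fun _ => norm_nonneg _
  have hw : Integrable fun ξ => wt (ξ - lam) ^ (-2 : ℝ) :=
    (integrable_wt_rpow (by norm_num)).comp_sub_right lam
  refine ((integrable_sq_ft hh).add (hw.const_mul (4 * (L + 1)))).mono'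
    (measurable_ftQuot hh.1 lam).aestronglyMeasurable (Eventually.of_forall fun ξ => ?_)
  simp only [Pi.add_apply]
  have hwt : wt (ξ - lam) ^ (-2 : ℝ) = 1 / (1 + |ξ - lam|) ^ 2 := by
    rw [Real.rpow_neg (wt_pos _).le, one_div, wt]
    norm_cast
  rw [hwt]
  set a := |ξ - lam| with ha
  have ha0 : 0 ≤ a := abs_nonneg _
  have hF : ‖ftQuot h lam ξ‖ ≤ L := norm_ftQuot_le hh.1 hyh h0 ξ
  rcases le_or_gt a 1 with h1 | h1
  · have h2 : L ≤ 4 * (L + 1) * (1 / (1 + a) ^ 2) := by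
      rw [mul_one_div, le_div_iff₀ (by positivity)]
      nlinarith [mul_nonneg hL0 ha0, mul_nonneg hL0 (sub_nonneg.2 h1),
        mul_nonneg (mul_nonneg hL0 ha0) (sub_nonneg.2 h1)]
    nlinarith [sq_nonneg ‖ft h ξ‖]
  · have h3 : ‖ftQuot h lam ξ‖ = ‖ft h ξ‖ * (1 / a) := by
      rw [ftQuot, norm_div, ← Complex.ofReal_sub, Complex.norm_real, Real.norm_eq_abs,
        div_eq_mul_one_div]
    have h4 : (1 / a) ^ 2 ≤ 4 * (L + 1) * (1 / (1 + a) ^ 2) := by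
      rw [mul_one_div, le_div_iff₀ (by positivity), div_pow, one_pow, div_mul_eq_mul_div, one_mul,
        div_le_iff₀ (by positivity)]
      nlinarith [mul_nonneg hL0 (sq_nonneg a)]
    rw [h3]
    nlinarith [sq_nonneg (‖ft h ξ‖ - 1 / a), sq_nonneg (‖ft h ξ‖), sq_nonneg (1 / a)]

/-! ### Fourier representation of the convolution -/

/-- Fourier inversion, rescaled by `2π` to the normalisation of `ft`. -/
lemma eq_integral_ft_of_continuous {p : ℝ → ℂ} (hc : Continuous p) (hp : Integrable p)
    (hfp : Integrable (ft p)) (x : ℝ) :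
    p x = 1 / (2 * (Real.pi : ℂ)) * ∫ ξ : ℝ, ft p ξ * Complex.exp (Complex.I * x * ξ) := by
  have h1 : ∀ w : ℝ, FourierTransform.fourier p w = ft p (2 * Real.pi * w) := fun w => by
    rw [Real.fourier_real_eq_integral_exp_smul, ft]
    congr 1; ext v
    rw [smul_eq_mul, mul_comm]
    congr 2; push_cast; ring
  have hpi : (2 * Real.pi) ≠ 0 := by positivity
  have h2 : Integrable (FourierTransform.fourier p : ℝ → ℂ) := by
    refine (hfp.comp_mul_left' hpi).congr (Eventually.of_forall fun w => ?_)
    exact (h1 w).symm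
  have h3 := congrFun (hc.fourierInv_fourier_eq hp h2) x
  rw [Real.fourierInv_eq'] at h3
  rw [← h3]
  have h4 : ∀ v : ℝ, Complex.exp (((2 * Real.pi * inner ℝ v x : ℝ) : ℂ) * Complex.I) •
      FourierTransform.fourier p v =
      (fun ξ : ℝ => ft p ξ * Complex.exp (Complex.I * x * ξ)) (2 * Real.pi * v) := fun v => by
    rw [h1, smul_eq_mul, mul_comm]
    dsimp only
    congr 2
    simp only [RCLike.inner_apply, conj_trivial]
    push_cast; ring
  rw [integral_congr_ae (Eventually.of_forall h4)]
  rw [Measure.integral_comp_mul_left (fun ξ : ℝ => ft p ξ * Complex.exp (Complex.I * x * ξ))]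
  rw [abs_of_pos (by positivity), Complex.real_smul]
  push_cast
  simp

/-- The difference of the indicator functions of `(y, ∞)` and `(0, ∞)`. -/
def stepDiff (x y : ℝ) : ℂ := (if y < x then 1 else 0) - (if 0 < x then 1 else 0)

lemma measurable_stepDiff : Measurable fun z : ℝ × ℝ => stepDiff z.1 z.2 :=
  (Measurable.ite (measurableSet_lt measurable_snd measurable_fst) measurable_const
    measurable_const).sub
    (Measurable.ite (measurableSet_lt measurable_const measurable_fst) measurable_const
      measurable_const)

lemma stepDiff_eq (x y : ℝ) : stepDiff x y =
    (Ioc y 0).indicator (fun _ => (1 : ℂ)) x - (Ioc 0 y).indicator (fun _ => (1 : ℂ)) x := by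
  unfold stepDiff
  simp only [indicator, mem_Ioc]
  rcases lt_or_ge y x with h1 | h1 <;> rcases lt_or_ge 0 x with h2 | h2 <;>
    simp [h1, h2, not_lt.2, not_le.2]

lemma norm_stepDiff (x y : ℝ) : ‖stepDiff x y‖ = (uIoc y 0).indicator (fun _ => (1 : ℝ)) x := by
  unfold stepDiff
  simp only [indicator, mem_uIoc]
  rcases lt_or_ge y x with h1 | h1 <;> rcases lt_or_ge 0 x with h2 | h2 <;>
    simp [h1, h2, not_lt.2, not_le.2]

lemma integral_stepDiff_mul {f : ℝ → ℂ} (hf : Continuous f) (y : ℝ) :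
    ∫ x, stepDiff x y * f x = ∫ x in y..0, f x := by
  have h1 : ∀ x, stepDiff x y * f x = (Ioc y 0).indicator f x - (Ioc 0 y).indicator f x := by
    intro x
    rw [stepDiff_eq, sub_mul]
    by_cases h1 : x ∈ Ioc y 0 <;> by_cases h2 : x ∈ Ioc 0 y <;> simp [h1, h2]
  simp only [h1]
  rw [integral_sub, integral_indicator measurableSet_Ioc, integral_indicator measurableSet_Ioc,
    intervalIntegral]
  · exact (integrable_indicator_iff measurableSet_Ioc).2
      ((hf.integrableOn_Icc).mono_set Ioc_subset_Icc_self)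
  · exact (integrable_indicator_iff measurableSet_Ioc).2
      ((hf.integrableOn_Icc).mono_set Ioc_subset_Icc_self)

lemma integral_norm_stepDiff (y : ℝ) : ∫ x, ‖stepDiff x y‖ = |y| := by
  simp only [norm_stepDiff]
  rw [integral_indicator measurableSet_uIoc]
  simp [uIoc, measureReal_def]
  rcases le_total y 0 with h | h <;> simp [h, abs_of_nonneg, abs_of_nonpos]

/-- For fixed `y` the step difference has `L¹` norm `|y|` in `x`, so the first moment of `k` is
exactly what is required. -/
lemma integrable_mul_stepDiff {k : ℝ → ℂ} (hk : Integrable k)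
    (hyk : Integrable fun y : ℝ => (y : ℂ) * k y) :
    Integrable (fun z : ℝ × ℝ => k z.2 * stepDiff z.1 z.2) (volume.prod volume) := by
  have hm : AEStronglyMeasurable (fun z : ℝ × ℝ => k z.2 * stepDiff z.1 z.2)
      (volume.prod volume) := hk.1.comp_snd.mul measurable_stepDiff.aestronglyMeasurable
  refine (integrable_prod_iff' hm).2 ⟨Eventually.of_forall fun y => ?_, ?_⟩
  · refine Integrable.const_mul ?_ (k y)
    have : Integrable fun x => (uIoc y 0).indicator (fun _ => (1 : ℝ)) x :=
      (integrable_indicator_iff measurableSet_uIoc).2 (by simp [uIoc])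
    refine this.mono' ?_ (Eventually.of_forall fun x => (norm_stepDiff x y).le)
    exact (measurable_stepDiff.comp (measurable_id.prodMk measurable_const)).aestronglyMeasurable
  · refine hyk.norm.congr (Eventually.of_forall fun y => ?_)
    simp only [norm_mul, integral_const_mul, integral_norm_stepDiff, Complex.norm_real,
      Real.norm_eq_abs]
    ring

/-- The part of the convolution coming from `± i exp(i lam x)` on a half line. -/
def halfConv (h : ℝ → ℂ) (lam x : ℝ) : ℂ :=
  Complex.I * planeWave lam x * ∫ y in Iic x, h y * Complex.exp (-(Complex.I * lam * y))

lemma continuous_halfConv {h : ℝ → ℂ} (hh : Integrable h) (lam : ℝ) :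
    Continuous (halfConv h lam) := by
  refine (continuous_const.mul (continuous_planeWave lam)).mul ?_
  have hk := integrable_mul_exp hh lam
  have h1 : (fun x : ℝ => ∫ y in Iic x, h y * Complex.exp (-(Complex.I * lam * y))) = fun x =>
      (∫ y in Iic (0 : ℝ), h y * Complex.exp (-(Complex.I * lam * y))) +
        ∫ y in (0 : ℝ)..x, h y * Complex.exp (-(Complex.I * lam * y)) := by
    ext x
    rw [← intervalIntegral.integral_Iic_sub_Iic hk.integrableOn hk.integrableOn]
    ring
  rw [h1]
  exact continuous_const.add (intervalIntegral.continuous_primitive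
    (fun a b => hk.intervalIntegrable) 0)

/-- Because `ĥ(lam) = 0`, a multiple of the full integral can be subtracted when `x > 0` without
changing the value. The resulting double integrand is absolutely integrable in `(x, y)`, which the
original one need not be. -/
lemma halfConv_eq_integral_stepDiff {h : ℝ → ℂ} (hh : Integrable h) {lam : ℝ}
    (h0 : ft h lam = 0) (x : ℝ) :
    halfConv h lam x = ∫ y, Complex.I * planeWave lam x *
      (h y * Complex.exp (-(Complex.I * lam * y)) * stepDiff x y) := by
  have hk := integrable_mul_exp hh lam
  rw [halfConv, integral_const_mul]
  congr 1
  have h1 : ∀ y, h y * Complex.exp (-(Complex.I * lam * y)) * stepDiff x y =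
      (Iio x).indicator (fun y => h y * Complex.exp (-(Complex.I * lam * y))) y -
        h y * Complex.exp (-(Complex.I * lam * y)) * (if 0 < x then 1 else 0) := fun y => by
    unfold stepDiff
    simp only [indicator, mem_Iio, mul_sub, mul_ite, mul_one, mul_zero]
  simp only [h1]
  rw [integral_sub (hk.indicator measurableSet_Iio) (hk.mul_const _), integral_mul_const,
    integral_indicator measurableSet_Iio, integral_Iic_eq_integral_Iio]
  change _ = _ - ft h lam * _
  rw [h0, zero_mul, sub_zero]

lemma integrable_mul_halfConv {h : ℝ → ℂ} (hh : Integrable h)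
    (hyh : Integrable fun y : ℝ => (y : ℂ) * h y) (lam : ℝ) (c : ℝ → ℂ) (hc : Continuous c)
    (hc1 : ∀ x, ‖c x‖ ≤ 1) :
    Integrable (fun z : ℝ × ℝ => c z.1 * (Complex.I * planeWave lam z.1 *
      (h z.2 * Complex.exp (-(Complex.I * lam * z.2)) * stepDiff z.1 z.2)))
      (volume.prod volume) := by
  have hyk : Integrable fun y : ℝ => (y : ℂ) * (h y * Complex.exp (-(Complex.I * lam * y))) := by
    refine (integrable_mul_exp hyh lam).congr (Eventually.of_forall fun y => ?_)
    dsimp only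
    ring
  have h1 := integrable_mul_stepDiff (integrable_mul_exp hh lam) hyk
  refine h1.norm.mono' ?_ (Eventually.of_forall fun z => ?_)
  · have hcp := continuous_planeWave lam
    have h2 : Continuous fun z : ℝ × ℝ => Complex.I * planeWave lam z.1 := by fun_prop
    have h3 : Continuous fun z : ℝ × ℝ => c z.1 := by fun_prop
    exact h3.aestronglyMeasurable.mul (h2.aestronglyMeasurable.mul h1.1)
  · rw [norm_mul, norm_mul (Complex.I * planeWave lam z.1), norm_mul Complex.I, Complex.norm_I,
      norm_planeWave, one_mul, one_mul]
    exact mul_le_of_le_one_left (norm_nonneg _) (hc1 _)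

lemma integrable_halfConv {h : ℝ → ℂ} (hh : Integrable h)
    (hyh : Integrable fun y : ℝ => (y : ℂ) * h y) {lam : ℝ} (h0 : ft h lam = 0) :
    Integrable (halfConv h lam) := by
  have := (integrable_mul_halfConv hh hyh lam (fun _ => 1) continuous_const
    (by simp)).integral_prod_left
  refine this.congr (Eventually.of_forall fun x => ?_)
  simp only [one_mul]
  exact (halfConv_eq_integral_stepDiff hh h0 x).symm

/-- By Fubini the inner integral in `x` runs only over the interval between `y` and `0`, where it is
elementary. -/
lemma ft_halfConv {h : ℝ → ℂ} (hh : Integrable h) (hyh : Integrable fun y : ℝ => (y : ℂ) * h y)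
    {lam : ℝ} (h0 : ft h lam = 0) {ξ : ℝ} (hξ : ξ ≠ lam) :
    ft (halfConv h lam) ξ = ftQuot h lam ξ := by
  have hne : ((lam : ℂ) - ξ) ≠ 0 := by
    rw [← Complex.ofReal_sub]; exact_mod_cast sub_ne_zero.2 hξ.symm
  have hi := integrable_mul_halfConv hh hyh lam
    (fun x => Complex.exp (-(Complex.I * ξ * x))) (by fun_prop)
    (fun x => (norm_exp_neg_I_mul ξ x).le)
  calc ft (halfConv h lam) ξ
      = ∫ x : ℝ, ∫ y, Complex.exp (-(Complex.I * ξ * x)) * (Complex.I * planeWave lam x *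
          (h y * Complex.exp (-(Complex.I * lam * y)) * stepDiff x y)) := by
        rw [ft]
        congr 1; ext x
        rw [integral_const_mul, ← halfConv_eq_integral_stepDiff hh h0, mul_comm]
    _ = ∫ y, ∫ x : ℝ, Complex.exp (-(Complex.I * ξ * x)) * (Complex.I * planeWave lam x *
          (h y * Complex.exp (-(Complex.I * lam * y)) * stepDiff x y)) :=
        integral_integral_swap hi
    _ = ∫ y, 1 / ((lam : ℂ) - ξ) * (h y * Complex.exp (-(Complex.I * lam * y)) -
          h y * Complex.exp (-(Complex.I * ξ * y))) := by
        congr 1; ext y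
        have e1 : ∀ x : ℝ, Complex.exp (-(Complex.I * ξ * x)) * (Complex.I * planeWave lam x *
            (h y * Complex.exp (-(Complex.I * lam * y)) * stepDiff x y)) =
            Complex.I * h y * Complex.exp (-(Complex.I * lam * y)) *
              (stepDiff x y * Complex.exp (Complex.I * ((lam : ℂ) - ξ) * x)) := fun x => by
          have : Complex.exp (Complex.I * ((lam : ℂ) - ξ) * x) =
              Complex.exp (-(Complex.I * ξ * x)) * planeWave lam x := by
            rw [planeWave, ← Complex.exp_add]; congr 1; ring
          rw [this]; ring
        simp only [e1]
        rw [integral_const_mul, integral_stepDiff_mul (by fun_prop),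
          integral_exp_mul_complex (mul_ne_zero Complex.I_ne_zero hne)]
        have e2 : Complex.exp (-(Complex.I * ξ * y)) = Complex.exp (-(Complex.I * lam * y)) *
            Complex.exp (Complex.I * ((lam : ℂ) - ξ) * y) := by
          rw [← Complex.exp_add]; congr 1; ring
        rw [e2]
        have hI := Complex.I_ne_zero
        simp only [Complex.ofReal_zero, mul_zero, Complex.exp_zero]
        field_simp
    _ = 1 / ((lam : ℂ) - ξ) * (ft h lam - ft h ξ) := by
        rw [integral_const_mul, integral_sub (integrable_mul_exp hh lam) (integrable_mul_exp hh ξ)]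
        rfl
    _ = ftQuot h lam ξ := by
        have hne' : ((ξ : ℂ) - lam) ≠ 0 := by
          rw [← Complex.ofReal_sub]; exact_mod_cast sub_ne_zero.2 hξ
        rw [h0, ftQuot, zero_sub]
        field_simp
        ring

lemma halfConv_eq_integral_ftQuot {h : ℝ → ℂ} (hh : L1L2 h)
    (hyh : Integrable fun y : ℝ => (y : ℂ) * h y) {lam : ℝ} (h0 : ft h lam = 0) (x : ℝ) :
    halfConv h lam x =
      1 / (2 * (Real.pi : ℂ)) * ∫ ξ : ℝ, ftQuot h lam ξ * Complex.exp (Complex.I * x * ξ) := by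
  have hae : ft (halfConv h lam) =ᵐ[volume] ftQuot h lam := by
    filter_upwards [compl_mem_ae_iff.2 (measure_singleton lam)] with ξ hξ
    exact ft_halfConv hh.1 hyh h0 hξ
  rw [eq_integral_ft_of_continuous (continuous_halfConv hh.1 lam)
    (integrable_halfConv hh.1 hyh h0) ((integrable_ftQuot hh hyh h0).congr hae.symm)]
  congr 1
  refine integral_congr_ae ?_
  filter_upwards [hae] with ξ hξ
  rw [hξ]

lemma integrable_ftQuot_mul_exp {h : ℝ → ℂ} (hh : L1L2 h)
    (hyh : Integrable fun y : ℝ => (y : ℂ) * h y) {lam : ℝ} (h0 : ft h lam = 0) (x : ℝ) :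
    Integrable fun ξ : ℝ => ftQuot h lam ξ * Complex.exp (Complex.I * x * ξ) := by
  refine (integrable_ftQuot hh hyh h0).mul_bdd (c := 1)
    (Continuous.aestronglyMeasurable (by fun_prop)) (Eventually.of_forall fun ξ => ?_)
  have := norm_planeWave x ξ
  rw [planeWave] at this
  exact this.le

lemma intervalIntegral_ftQuot {h : ℝ → ℂ} (hh : Integrable h) {lam : ℝ} (hl : 0 < lam) (x : ℝ)
    {R : ℝ} (hR : 0 ≤ R) :
    ∫ ξ in (-R)..0, ftQuot h lam ξ * Complex.exp (Complex.I * x * ξ) =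
      ∫ y : ℝ, (∫ ξ in (-R)..0, Complex.exp (Complex.I * ((x - y : ℝ) : ℂ) * ξ) / ((ξ : ℂ) - lam)) *
        h y := by
  have e1 : ∀ ξ : ℝ, ftQuot h lam ξ * Complex.exp (Complex.I * x * ξ) = ∫ y : ℝ,
      Complex.exp (Complex.I * ((x - y : ℝ) : ℂ) * ξ) / ((ξ : ℂ) - lam) * h y := fun ξ => by
    rw [ftQuot, ft, div_mul_eq_mul_div, mul_div_assoc, ← integral_mul_const]
    congr 1; ext y
    have : Complex.exp (Complex.I * ((x - y : ℝ) : ℂ) * ξ) =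
        Complex.exp (-(Complex.I * ξ * y)) * Complex.exp (Complex.I * x * ξ) := by
      rw [← Complex.exp_add]; congr 1; push_cast; ring
    rw [this]; ring
  simp only [e1, intervalIntegral.integral_of_le (neg_nonpos.2 hR)]
  rw [integral_integral_swap]
  · congr 1; ext y
    rw [integral_mul_const]
  · have hi : Integrable (fun z : ℝ × ℝ => (1 / lam : ℝ) * ‖h z.2‖)
        ((volume.restrict (Ioc (-R) 0)).prod volume) := (integrable_const _).mul_prod hh.norm
    refine hi.mono' (AEStronglyMeasurable.mul (Measurable.aestronglyMeasurable ?_) hh.1.comp_snd) ?_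
    · fun_prop
    · have : ∀ᵐ z ∂((volume.restrict (Ioc (-R) 0)).prod (volume : Measure ℝ)),
          z.1 ∈ Ioc (-R) 0 :=
        Measure.quasiMeasurePreserving_fst.ae (ae_restrict_mem measurableSet_Ioc)
      filter_upwards [this] with z hz
      simp only [Function.uncurry, norm_mul, norm_div]
      refine mul_le_mul_of_nonneg_right ?_ (norm_nonneg _)
      have e3 := norm_planeWave (x - z.2) z.1
      rw [planeWave] at e3
      rw [e3, ← Complex.ofReal_sub, Complex.norm_real, Real.norm_eq_abs,
        abs_of_neg (by linarith [hz.2])]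
      exact one_div_le_one_div_of_le hl (by linarith [hz.2])

/-- For the frequency window `[-R, 0]` the identity is Fubini. As `R → ∞` the physical side
converges under the majorant `C * kap * |h|`, and the frequency side because the quotient is
integrable. -/
lemma integral_lapG_mul {h : ℝ → ℂ} (hh : L1L2 h)
    (hyh : Integrable fun y : ℝ => (y : ℂ) * h y) {lam : ℝ} (hl : 0 < lam) (h0 : ft h lam = 0)
    (x : ℝ) : ∫ y, lapG lam (x - y) * h y =
      1 / (2 * (Real.pi : ℂ)) *
        ∫ ξ in Iic (0 : ℝ), ftQuot h lam ξ * Complex.exp (Complex.I * x * ξ) := by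
  have hpi : (2 * (Real.pi : ℂ)) ≠ 0 := by simp
  have lim1 := intervalIntegral_tendsto_integral_Iic (μ := volume) (0 : ℝ)
    (integrable_ftQuot_mul_exp hh hyh h0 x).integrableOn tendsto_neg_atTop_atBot
  obtain ⟨C, hC, hb⟩ := exists_norm_intervalIntegral_plane_div_le hl
  have lim2 : Tendsto (fun R : ℝ => ∫ y : ℝ, (∫ ξ in (-R)..0,
      Complex.exp (Complex.I * ((x - y : ℝ) : ℂ) * ξ) / ((ξ : ℂ) - lam)) * h y) atTop
      (𝓝 (∫ y, 2 * (Real.pi : ℂ) * (lapG lam (x - y) * h y))) := by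
    refine tendsto_integral_filter_of_dominated_convergence (fun y => C * (kap (x - y) * ‖h y‖))
      ?_ ?_ ((hh.kap x).const_mul C) ?_
    · refine Eventually.of_forall fun R => AEStronglyMeasurable.mul ?_ hh.1.1
      refine StronglyMeasurable.aestronglyMeasurable ?_
      have hsm : StronglyMeasurable fun z : ℝ × ℝ =>
          Complex.exp (Complex.I * ((x - z.1 : ℝ) : ℂ) * z.2) / ((z.2 : ℂ) - lam) :=
        Measurable.stronglyMeasurable (by fun_prop)
      simp only [intervalIntegral]
      exact (hsm.integral_prod_right' (ν := volume.restrict (Ioc (-R) 0))).sub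
        (hsm.integral_prod_right' (ν := volume.restrict (Ioc 0 (-R))))
    · filter_upwards [eventually_ge_atTop 0] with R hR
      filter_upwards [compl_mem_ae_iff.2 (measure_singleton x)] with y hy
      rw [norm_mul, ← mul_assoc]
      refine mul_le_mul_of_nonneg_right ((hb R hR (x - y) (sub_ne_zero.2 (Ne.symm hy))).trans ?_)
        (norm_nonneg _)
      refine mul_le_mul_of_nonneg_left ?_ hC
      have : |x - y| ^ (-(1 / 4) : ℝ) = (|x - y| ^ (-(1 / 8) : ℝ)) ^ 2 := by
        rw [← Real.rpow_natCast, ← Real.rpow_mul (abs_nonneg _)]; norm_num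
      rw [kap, this]
      nlinarith [sq_nonneg (|x - y| ^ (-(1 / 8) : ℝ) - 1)]
    · filter_upwards [compl_mem_ae_iff.2 (measure_singleton x)] with y hy
      have hy' : x - y ≠ 0 := sub_ne_zero.2 (Ne.symm hy)
      have e4 : 2 * (Real.pi : ℂ) * (lapG lam (x - y) * h y) = (-∫ t in Ioi (0 : ℝ),
          Complex.exp (-(lam * t)) / (t + Complex.I * ((x - y : ℝ) : ℂ))) * h y := by
        rw [lapG, if_neg hy']
        field_simp
      rw [e4]
      exact (tendsto_intervalIntegral_plane_div hl hy').mul_const (h y)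
  have lim3 : Tendsto (fun R : ℝ => ∫ ξ in (-R)..0,
      ftQuot h lam ξ * Complex.exp (Complex.I * x * ξ)) atTop
      (𝓝 (∫ y, 2 * (Real.pi : ℂ) * (lapG lam (x - y) * h y))) := by
    refine lim2.congr' ?_
    filter_upwards [eventually_ge_atTop 0] with R hR
    exact (intervalIntegral_ftQuot hh.1 hl x hR).symm
  rw [tendsto_nhds_unique lim1 lim3, integral_const_mul]
  field_simp

/-- The half-line wave contributes the inverse transform of `ĥ/(ξ - lam)` over all frequencies, and
`lapG` removes the negative ones: the convolution inverts `ξ - lam` on the positive frequencies. -/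
lemma cv_above_eq_integral_ftQuot {h : ℝ → ℂ} (hh : L1L2 h)
    (hyh : Integrable fun y : ℝ => (y : ℂ) * h y) {lam : ℝ} (hl : 0 < lam) (h0 : ft h lam = 0)
    (x : ℝ) : cv .above lam h x = 1 / (2 * (Real.pi : ℂ)) *
      ∫ ξ in Ioi (0 : ℝ), ftQuot h lam ξ * Complex.exp (Complex.I * x * ξ) := by
  have hk := integrable_mul_exp hh.1 lam
  have i1 : Integrable fun y => Complex.I * planeWave lam x *
      (Iio x).indicator (fun y => h y * Complex.exp (-(Complex.I * lam * y))) y :=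
    (hk.indicator measurableSet_Iio).const_mul _
  have e1 : ∀ y, kerG .above lam (x - y) * h y = Complex.I * planeWave lam x *
      (Iio x).indicator (fun y => h y * Complex.exp (-(Complex.I * lam * y))) y -
        lapG lam (x - y) * h y := fun y => by
    simp only [kerG, indicator, mem_Ioi, mem_Iio, sub_pos, sub_mul, planeWave_sub]
    split_ifs <;> ring
  have i2 : Integrable fun y => lapG lam (x - y) * h y := by
    refine (i1.sub (integrable_kerG_mul .above hl hh x)).congr (Eventually.of_forall fun y => ?_)
    simp only [Pi.sub_apply, e1]
    ring
  have e2 : cv .above lam h x = halfConv h lam x - ∫ y, lapG lam (x - y) * h y := by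
    rw [cv]
    simp only [e1]
    rw [integral_sub i1 i2, integral_const_mul, integral_indicator measurableSet_Iio,
      ← integral_Iic_eq_integral_Iio, halfConv]
  rw [e2, halfConv_eq_integral_ftQuot hh hyh h0, integral_lapG_mul hh hyh hl h0, ← mul_sub,
    ← intervalIntegral.integral_Iic_add_Ioi (b := (0 : ℝ))
      (integrable_ftQuot_mul_exp hh hyh h0 x).integrableOn
      (integrable_ftQuot_mul_exp hh hyh h0 x).integrableOn, add_sub_cancel_left]

/-! ### The energy identity -/

lemma hasDerivAt_sq_ft_div {h : ℝ → ℂ} (hh : Integrable h)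
    (hyh : Integrable fun y : ℝ => (y : ℂ) * h y) {lam ξ : ℝ} (hξ : ξ ≠ lam) :
    HasDerivAt (fun ξ => ‖ft h ξ‖ ^ 2 / (ξ - lam))
      (2 * (ft (fun y : ℝ => -Complex.I * (y * h y)) ξ * conj (ftQuot h lam ξ)).re -
        ‖ftQuot h lam ξ‖ ^ 2) ξ := by
  have hne : ξ - lam ≠ 0 := sub_ne_zero.2 hξ
  have h1 := (hasDerivAt_ft hh hyh ξ).norm_sq
  have h2 := h1.div ((hasDerivAt_id ξ).sub_const lam) hne
  refine h2.congr_deriv ?_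
  have e1 : ftQuot h lam ξ = ((1 / (ξ - lam) : ℝ) : ℂ) * ft h ξ := by
    rw [ftQuot]; push_cast; ring
  rw [e1, map_mul, Complex.conj_ofReal, mul_left_comm, Complex.re_ofReal_mul, norm_mul,
    Complex.norm_real, mul_pow, Real.norm_eq_abs, sq_abs, Complex.inner]
  simp only [id_eq]
  field_simp

lemma continuous_sq_ft_div {h : ℝ → ℂ} (hh : Integrable h)
    (hyh : Integrable fun y : ℝ => (y : ℂ) * h y) {lam : ℝ} (h0 : ft h lam = 0) :
    Continuous fun ξ => ‖ft h ξ‖ ^ 2 / (ξ - lam) := by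
  rw [continuous_iff_continuousAt]
  intro ξ
  by_cases hξ : ξ = lam
  · subst hξ
    set L := ∫ y : ℝ, ‖(y : ℂ) * h y‖
    rw [ContinuousAt, sub_self, div_zero, tendsto_zero_iff_norm_tendsto_zero]
    refine squeeze_zero (fun _ => norm_nonneg _) (g := fun η => L ^ 2 * |η - ξ|) (fun η => ?_) ?_
    · have h1 := norm_ft_sub_le hh hyh η ξ
      rw [h0, sub_zero] at h1
      rw [norm_div, norm_pow, norm_norm, Real.norm_eq_abs]
      refine div_le_of_le_mul₀ (abs_nonneg _) (by positivity) ?_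
      calc ‖ft h η‖ ^ 2 ≤ (L * |η - ξ|) ^ 2 := by gcongr
        _ = _ := by ring
    · have : Continuous fun η : ℝ => L ^ 2 * |η - ξ| := by fun_prop
      simpa using this.tendsto ξ
  · have := continuous_ft hh
    exact ContinuousAt.div (by fun_prop) (by fun_prop) (sub_ne_zero.2 hξ)

lemma integrable_deriv_mul_conj_ftQuot {h : ℝ → ℂ} (hh : L1L2 h)
    (hyh : Integrable fun y : ℝ => (y : ℂ) * h y) {lam : ℝ} (h0 : ft h lam = 0) :
    Integrable fun ξ => ft (fun y : ℝ => -Complex.I * (y * h y)) ξ * conj (ftQuot h lam ξ) :=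
  (Complex.conjCLE.toContinuousLinearMap.integrable_comp (integrable_ftQuot hh hyh h0)).bdd_mul
    (continuous_ft (hyh.const_mul _)).aestronglyMeasurable
    (Eventually.of_forall fun ξ => norm_ft_le _ ξ)

lemma integrable_sq_ftQuot {h : ℝ → ℂ} (hh : L1L2 h)
    (hyh : Integrable fun y : ℝ => (y : ℂ) * h y) {lam : ℝ} (h0 : ft h lam = 0) :
    Integrable fun ξ => ‖ftQuot h lam ξ‖ ^ 2 := by
  have h1 := (integrable_ftQuot hh hyh h0).norm
  refine (h1.mul_bdd (c := ∫ y : ℝ, ‖(y : ℂ) * h y‖) h1.1 (Eventually.of_forall fun ξ => ?_)).congr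
    (Eventually.of_forall fun ξ => (sq _).symm)
  rw [norm_norm]; exact norm_ftQuot_le hh.1 hyh h0 ξ

/-- The fundamental theorem of calculus for `|ĥ|²/(ξ - lam)`, which tends to `0` at infinity and
equals `-|ĥ(0)|²/lam` at the origin. -/
lemma integral_sq_ftQuot {h : ℝ → ℂ} (hh : L1L2 h)
    (hyh : Integrable fun y : ℝ => (y : ℂ) * h y) {lam : ℝ} (h0 : ft h lam = 0) :
    ∫ ξ in Ioi (0 : ℝ), ‖ftQuot h lam ξ‖ ^ 2 =
      2 * (∫ ξ in Ioi (0 : ℝ), ft (fun y : ℝ => -Complex.I * (y * h y)) ξ *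
        conj (ftQuot h lam ξ)).re - ‖ft h 0‖ ^ 2 / lam := by
  have i1 := integrable_deriv_mul_conj_ftQuot hh hyh h0
  have i2 := integrable_sq_ftQuot hh hyh h0
  have i1' : Integrable fun ξ => (ft (fun y : ℝ => -Complex.I * (y * h y)) ξ *
      conj (ftQuot h lam ξ)).re := i1.re
  have i3 : Integrable fun ξ => 2 * (ft (fun y : ℝ => -Complex.I * (y * h y)) ξ *
      conj (ftQuot h lam ξ)).re - ‖ftQuot h lam ξ‖ ^ 2 := (i1'.const_mul 2).sub i2
  have lim1 := intervalIntegral_tendsto_integral_Ioi (μ := volume) (0 : ℝ) i3.integrableOn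
    tendsto_id
  have ftc : ∀ R : ℝ, ∫ ξ in (0 : ℝ)..R, (2 * (ft (fun y : ℝ => -Complex.I * (y * h y)) ξ *
      conj (ftQuot h lam ξ)).re - ‖ftQuot h lam ξ‖ ^ 2) =
      ‖ft h R‖ ^ 2 / (R - lam) - ‖ft h 0‖ ^ 2 / (0 - lam) := fun R =>
    -- The zero of `ĥ` makes the function continuous through `lam`, so the one point where the
    -- derivative formula is not available does no harm.
    integral_eq_of_hasDerivAt_off_countable (fun ξ => ‖ft h ξ‖ ^ 2 / (ξ - lam)) _
      (countable_singleton lam) (continuous_sq_ft_div hh.1 hyh h0).continuousOn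
      (fun ξ hξ => hasDerivAt_sq_ft_div hh.1 hyh hξ.2) i3.intervalIntegrable
  have lim2 : Tendsto (fun R : ℝ => ‖ft h R‖ ^ 2 / (R - lam)) atTop (𝓝 0) := by
    have hb : Tendsto (fun R : ℝ => (∫ y, ‖h y‖) ^ 2 / (R - lam)) atTop (𝓝 0) :=
      (tendsto_atTop_add_const_right atTop (-lam) tendsto_id).const_div_atTop _
    refine squeeze_zero' ?_ ?_ hb
    · filter_upwards [eventually_gt_atTop lam] with R hR
      have := sub_pos.2 hR
      positivity
    · filter_upwards [eventually_gt_atTop lam] with R hR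
      have := sub_pos.2 hR
      have h2 := norm_ft_le h R
      gcongr
  simp only [id_eq, ftc] at lim1
  have h3 := tendsto_nhds_unique lim1 (lim2.sub_const (‖ft h 0‖ ^ 2 / (0 - lam)))
  rw [integral_sub (i1'.const_mul 2).integrableOn i2.integrableOn, integral_const_mul] at h3
  have h4 : ∫ ξ in Ioi (0 : ℝ), (ft (fun y : ℝ => -Complex.I * (y * h y)) ξ *
      conj (ftQuot h lam ξ)).re = (∫ ξ in Ioi (0 : ℝ), ft (fun y : ℝ => -Complex.I * (y * h y)) ξ *
      conj (ftQuot h lam ξ)).re := integral_re i1.integrableOn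
  rw [h4] at h3
  have h5 : ‖ft h 0‖ ^ 2 / (0 - lam) = -(‖ft h 0‖ ^ 2 / lam) := by
    rw [zero_sub, div_neg]
  rw [h5] at h3
  linarith

/-- Parseval's identity proved by Fubini: `ĥ'` is the transform of `-i y h`, and the `ξ` integral
reassembles the conjugate of the convolution. -/
lemma integral_deriv_mul_conj_ftQuot {h : ℝ → ℂ} (hh : L1L2 h)
    (hyh : Integrable fun y : ℝ => (y : ℂ) * h y) {lam : ℝ} (hl : 0 < lam) (h0 : ft h lam = 0) :
    ∫ ξ in Ioi (0 : ℝ), ft (fun y : ℝ => -Complex.I * (y * h y)) ξ * conj (ftQuot h lam ξ) =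
      ∫ y : ℝ, -Complex.I * (y * h y) * (2 * Real.pi * conj (cv .above lam h y)) := by
  have hi : Integrable (Function.uncurry fun (ξ y : ℝ) => -Complex.I * (y * h y) *
      Complex.exp (-(Complex.I * ξ * y)) * conj (ftQuot h lam ξ))
      ((volume.restrict (Ioi (0 : ℝ))).prod volume) := by
    have h1 := ((integrable_ftQuot hh hyh h0).integrableOn (s := Ioi (0 : ℝ))).norm.mul_prod
      (ν := (volume : Measure ℝ)) (hyh.const_mul (-Complex.I)).norm
    refine h1.mono' ?_ (Eventually.of_forall fun z => ?_)
    · refine AEStronglyMeasurable.mul (AEStronglyMeasurable.mul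
        (hyh.const_mul (-Complex.I)).1.comp_snd
        (Continuous.aestronglyMeasurable (by fun_prop))) ?_
      have hm := Complex.continuous_conj.measurable.comp (measurable_ftQuot hh.1 lam)
      exact (hm.comp measurable_fst).aestronglyMeasurable
    · simp only [Function.uncurry, norm_mul, norm_exp_neg_I_mul, RCLike.norm_conj, mul_one]
      exact le_of_eq (mul_comm _ _)
  calc _ = ∫ ξ in Ioi (0 : ℝ), ∫ y : ℝ, -Complex.I * (y * h y) *
        Complex.exp (-(Complex.I * ξ * y)) * conj (ftQuot h lam ξ) := by
        simp only [ft, integral_mul_const]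
    _ = ∫ y : ℝ, ∫ ξ in Ioi (0 : ℝ), -Complex.I * (y * h y) *
        Complex.exp (-(Complex.I * ξ * y)) * conj (ftQuot h lam ξ) := integral_integral_swap hi
    _ = _ := by
        congr 1; ext y
        rw [cv_above_eq_integral_ftQuot hh hyh hl h0, map_mul, ← integral_conj]
        have e1 : 2 * (Real.pi : ℂ) * (conj (1 / (2 * (Real.pi : ℂ))) *
            ∫ ξ in Ioi (0 : ℝ), conj (ftQuot h lam ξ * Complex.exp (Complex.I * y * ξ))) =
            ∫ ξ in Ioi (0 : ℝ), conj (ftQuot h lam ξ * Complex.exp (Complex.I * y * ξ)) := by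
          have hpi : (Real.pi : ℂ) ≠ 0 := by exact_mod_cast Real.pi_ne_zero
          simp only [map_div₀, map_mul, map_one, map_ofNat, Complex.conj_ofReal]
          field_simp
        rw [e1, ← integral_const_mul]
        congr 1; ext ξ
        rw [map_mul, ← Complex.exp_conj]
        simp only [map_mul, Complex.conj_I, Complex.conj_ofReal]
        have e2 : Complex.exp (-Complex.I * y * ξ) = Complex.exp (-(Complex.I * ξ * y)) := by
          congr 1; ring
        rw [e2]; ring

/-- Homogeneous solutions with integrable first moment of the density vanish: a positive
number is not an embedded eigenvalue. -/
lemma eq_zero_of_homogeneous_of_moment {lam : ℝ} (hl : 0 < lam) {u : ℝ → ℝ} {φ : ℝ → ℂ}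
    (hh : L1L2 fun y => (u y : ℂ) * φ y)
    (hyh : Integrable fun y : ℝ => (y : ℂ) * ((u y : ℂ) * φ y))
    (heq : ∀ x, φ x = cv .above lam (fun y => (u y : ℂ) * φ y) x)
    (h0 : ft (fun y => (u y : ℂ) * φ y) lam = 0) (x : ℝ) : φ x = 0 := by
  have h1 := integral_sq_ftQuot hh hyh h0
  have h2 : (∫ ξ in Ioi (0 : ℝ), ft (fun y : ℝ => -Complex.I * (y * ((u y : ℂ) * φ y))) ξ *
      conj (ftQuot (fun y => (u y : ℂ) * φ y) lam ξ)).re = 0 := by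
    rw [integral_deriv_mul_conj_ftQuot hh hyh hl h0]
    -- By the homogeneous equation the integrand is `-i` times the real quantity `2π y u |φ|²`, so
    -- the integral has no real part. The energy identity then equates a nonnegative number with a
    -- nonpositive one.
    have e1 : ∀ y : ℝ, -Complex.I * (y * ((u y : ℂ) * φ y)) *
        (2 * Real.pi * conj (cv .above lam (fun y => (u y : ℂ) * φ y) y)) =
        -Complex.I * ((y * u y * (2 * Real.pi) * ‖φ y‖ ^ 2 : ℝ) : ℂ) := fun y => by
      rw [← heq y]
      have := Complex.mul_conj' (φ y)
      push_cast
      rw [← this]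
      ring
    simp only [e1]
    rw [integral_const_mul, integral_complex_ofReal]
    simp
  rw [h2, mul_zero, zero_sub] at h1
  have h3 : 0 ≤ ∫ ξ in Ioi (0 : ℝ), ‖ftQuot (fun y => (u y : ℂ) * φ y) lam ξ‖ ^ 2 :=
    integral_nonneg fun _ => by positivity
  have h4 : 0 ≤ ‖ft (fun y => (u y : ℂ) * φ y) 0‖ ^ 2 / lam := by positivity
  have h5 : ∫ ξ in Ioi (0 : ℝ), ‖ftQuot (fun y => (u y : ℂ) * φ y) lam ξ‖ ^ 2 = 0 := by linarith
  rw [integral_eq_zero_iff_of_nonneg (fun _ => by positivity)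
    (integrable_sq_ftQuot hh hyh h0).integrableOn] at h5
  rw [heq x, cv_above_eq_integral_ftQuot hh hyh hl h0]
  have h6 : ∫ ξ in Ioi (0 : ℝ), ftQuot (fun y => (u y : ℂ) * φ y) lam ξ *
      Complex.exp (Complex.I * x * ξ) = 0 := by
    refine integral_eq_zero_of_ae ?_
    filter_upwards [h5] with ξ hξ
    have : ftQuot (fun y => (u y : ℂ) * φ y) lam ξ = 0 := by simpa using hξ
    simp [this]
  rw [h6, mul_zero]

/-- Bounded homogeneous solutions vanish. -/
lemma ae_eq_zero_of_homogeneous {s : ℝ} (hs : 1 / 2 < s) {u : ℝ → ℝ} (hu : MemWeightedLp 2 s u)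
    {lam : ℝ} (hl : 0 < lam) (σ : Side) {m : ℝ → ℂ} (hm : AEStronglyMeasurable m volume) {B : ℝ}
    (hB : ∀ᵐ x, ‖m x‖ ≤ B) (heq : ∀ᵐ x, m x = cv σ lam (fun y => (u y : ℂ) * m y) x) :
    ∀ᵐ x, m x = 0 := by
  have hu1 := hu.integrable hs
  have hu2 := hu.integrable_sq hs
  have hhm := L1L2.of_bound hu1 hu2 hm hB
  -- The representative `φ` of `m` satisfies the equation at every point, as the pointwise decay
  -- argument requires.
  set φ := cv σ lam (fun y => (u y : ℂ) * m y) with hφ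
  have hmφ : (fun y => (u y : ℂ) * m y) =ᵐ[volume] fun y => (u y : ℂ) * φ y := by
    filter_upwards [heq] with y hy
    rw [hy]
  have hφeq : ∀ x, φ x = cv σ lam (fun y => (u y : ℂ) * φ y) x := fun x => by
    rw [← cv_congr σ lam hmφ]
  obtain ⟨C, hC, hCb⟩ := exists_norm_cv_le σ hl hhm
  have hφm : AEStronglyMeasurable φ volume := aestronglyMeasurable_cv σ lam hhm.1.1
  have hh : L1L2 fun y => (u y : ℂ) * φ y :=
    L1L2.of_bound hu1 hu2 hφm (Eventually.of_forall hCb)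
  have h0 := integral_mul_exp_eq_zero_of_homogeneous hl hh hφeq
  have hab := cv_above_eq_cv_below hl hh h0
  have hboth : ∀ σ' x, φ x = cv σ' lam (fun y => (u y : ℂ) * φ y) x := fun σ' x => by
    have := hφeq x
    cases σ <;> cases σ'
    · exact this
    · rw [← hab]; exact this
    · rw [hab]; exact this
    · exact this
  obtain ⟨D, A, hD, hA, hstep⟩ := exists_decay_step hs hu hl hh hboth
  obtain ⟨K, hK, hdecay⟩ := exists_le_div_wt_of_decay_step (by linarith) hCb hA hstep
  have hyh : Integrable fun y : ℝ => (y : ℂ) * ((u y : ℂ) * φ y) := by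
    refine (hu1.norm.mul_const K).mono'
      ((Continuous.aestronglyMeasurable (by fun_prop)).mul hh.1.1)
      (Eventually.of_forall fun y => ?_)
    have h1 := hdecay y
    rw [le_div_iff₀ (wt_pos y)] at h1
    simp only [norm_mul, Complex.norm_real]
    have h2 : ‖y‖ ≤ wt y := abs_le_wt y
    calc ‖y‖ * (‖u y‖ * ‖φ y‖) ≤ wt y * (‖u y‖ * ‖φ y‖) := by gcongr
      _ = ‖u y‖ * (‖φ y‖ * wt y) := by ring
      _ ≤ ‖u y‖ * K := by gcongr
  filter_upwards [heq] with x hx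
  rw [hx]
  exact eq_zero_of_homogeneous_of_moment hl hh hyh (hboth .above) h0 x

/-! ### The integral equation in `L²(ℝ)` -/

/-- The exponents and the potential for which the integral equation is solved in `L²`: solutions
in `L^∞_{-r}` are turned into elements of `L²` by the weight `w^{-t}`, and `γ` is a Hölder
exponent in the spectral parameter. -/
structure Admissible (r t γ : ℝ) (u : ℝ → ℝ) : Prop where
  gamma_pos : 0 < γ
  gamma_lt_one : γ < 1
  r_nonneg : 0 ≤ r
  r_lt : 1 / 2 < t - r
  gamma_lt : 1 / 2 < t - γ
  exists_weight : ∃ s, t + γ ≤ s ∧ MemWeightedLp 2 s u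

namespace Admissible

variable {r t γ : ℝ} {u : ℝ → ℝ}

lemma half_lt (h : Admissible r t γ u) : 1 / 2 < t := by linarith [h.gamma_lt, h.gamma_pos]

lemma integrable (h : Admissible r t γ u) : Integrable u := by
  obtain ⟨s, h1, h2⟩ := h.exists_weight
  exact h2.integrable (by linarith [h.half_lt, h.gamma_pos])

lemma integrable_sq (h : Admissible r t γ u) : Integrable fun x => u x ^ 2 := by
  obtain ⟨s, h1, h2⟩ := h.exists_weight
  exact h2.integrable_sq (by linarith [h.half_lt, h.gamma_pos])

lemma memLp_wt_mul (h : Admissible r t γ u) : MemLp (fun x => wt x ^ t * u x) 2 := by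
  obtain ⟨s, h1, h2⟩ := h.exists_weight
  exact h2.memLp_wt_rpow_mul (by linarith [h.gamma_pos])

lemma memLp_wt_add_mul (h : Admissible r t γ u) : MemLp (fun x => wt x ^ (t + γ) * u x) 2 := by
  obtain ⟨s, h1, h2⟩ := h.exists_weight
  exact h2.memLp_wt_rpow_mul h1

lemma ae_eq_zero (h : Admissible r t γ u) {lam : ℝ} (hl : 0 < lam) (σ : Side) {m : ℝ → ℂ}
    (hm : AEStronglyMeasurable m volume) {B : ℝ} (hB : ∀ᵐ x, ‖m x‖ ≤ B)
    (heq : ∀ᵐ x, m x = cv σ lam (fun y => (u y : ℂ) * m y) x) : ∀ᵐ x, m x = 0 := by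
  obtain ⟨s, h1, h2⟩ := h.exists_weight
  exact ae_eq_zero_of_homogeneous (by linarith [h.half_lt, h.gamma_pos]) h2 hl σ hm hB heq

end Admissible

/-- The weighted convolution kernel `w(x)^{-t} g(x - y) w(y)^t u(y)`. -/
def hsK (t : ℝ) (u : ℝ → ℝ) (g : ℝ → ℂ) (z : ℝ × ℝ) : ℂ :=
  ((wt z.1 ^ (-t) : ℝ) : ℂ) * g (z.1 - z.2) * ((wt z.2 ^ t * u z.2 : ℝ) : ℂ)

lemma norm_hsK_sq (t : ℝ) (u : ℝ → ℝ) (g : ℝ → ℂ) (z : ℝ × ℝ) :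
    ‖hsK t u g z‖ ^ 2 = (wt z.1 ^ (-t)) ^ 2 * ‖g (z.1 - z.2)‖ ^ 2 * (wt z.2 ^ t * u z.2) ^ 2 := by
  rw [hsK, norm_mul, norm_mul, Complex.norm_real, Complex.norm_real, mul_pow, mul_pow,
    Real.norm_eq_abs, Real.norm_eq_abs, sq_abs, sq_abs]

section Kernel

variable {r t γ : ℝ} {u : ℝ → ℝ}

lemma aestronglyMeasurable_hsK (h : Admissible r t γ u) {g : ℝ → ℂ} (hg : Measurable g) :
    AEStronglyMeasurable (hsK t u g) (volume.prod volume) := by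
  have h1 : Measurable fun z : ℝ × ℝ => ((wt z.1 ^ (-t) : ℝ) : ℂ) * g (z.1 - z.2) :=
    (Complex.measurable_ofReal.comp ((continuous_wt_rpow (-t)).measurable.comp measurable_fst)).mul
      (hg.comp (measurable_fst.sub measurable_snd))
  have h2 : AEStronglyMeasurable (fun y => ((wt y ^ t * u y : ℝ) : ℂ)) volume :=
    Complex.continuous_ofReal.comp_aestronglyMeasurable h.memLp_wt_mul.1
  exact h1.aestronglyMeasurable.mul h2.comp_snd

/-- Integrate in `x` first. Since `t > 1/2`, `w^{-2t}` is integrable and bounded by `1`, so its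
integral against `kap` is bounded uniformly in `y`; what remains is the `L²` norm of `w^t u`. -/
lemma memLp_hsK_of_kap (h : Admissible r t γ u) {g : ℝ → ℂ} (hg : Measurable g) {C : ℝ}
    (hC : ∀ z, ‖g z‖ ^ 2 ≤ C * kap z) : MemLp (hsK t u g) 2 := by
  have hm := aestronglyMeasurable_hsK h hg
  refine (memLp_two_iff_integrable_sq_norm hm).2 ?_
  have hm2 : AEStronglyMeasurable (fun z => ‖hsK t u g z‖ ^ 2) (volume.prod volume) :=
    hm.norm.pow 2
  have hC0 : 0 ≤ C := by
    have := (sq_nonneg _).trans (hC 0)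
    exact nonneg_of_mul_nonneg_left this (kap_pos 0)
  set v : ℝ → ℝ := fun x => (wt x ^ (-t)) ^ 2 with hv
  have hv0 : ∀ x, 0 ≤ v x := fun x => sq_nonneg _
  have hv1 : Integrable v := (memLp_wt_rpow h.half_lt).integrable_sq
  have hv2 : Integrable fun x => v x ^ 2 := by
    refine hv1.mono' ((((continuous_wt_rpow (-t)).pow 2).pow 2).aestronglyMeasurable)
      (Eventually.of_forall fun x => ?_)
    have h1 : wt x ^ (-t) ≤ 1 :=
      Real.rpow_le_one_of_one_le_of_nonpos (one_le_wt x) (by linarith [h.half_lt])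
    have h2 := (wt_rpow_pos x (-t)).le
    rw [Real.norm_of_nonneg (by positivity), hv]
    exact pow_le_of_le_one (by positivity) (pow_le_one₀ h2 h1) two_ne_zero
  have hU := h.memLp_wt_mul.integrable_sq
  have hb : ∀ x y, ‖hsK t u g (x, y)‖ ^ 2 ≤ C * (wt y ^ t * u y) ^ 2 * (kap (y - x) * v x) :=
    fun x y => by
      rw [norm_hsK_sq]
      have h1 := hC (x - y)
      rw [← kap_neg, neg_sub] at h1
      calc _ ≤ (wt x ^ (-t)) ^ 2 * (C * kap (y - x)) * (wt y ^ t * u y) ^ 2 := by gcongr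
        _ = _ := by rw [hv]; ring
  have hk := fun y => integrable_kap_mul hv0 hv1 hv2 y
  have hi : ∀ᵐ y, Integrable fun x => ‖hsK t u g (x, y)‖ ^ 2 := by
    filter_upwards [hm2.prod_swap.prodMk_left] with y hy
    refine ((hk y).const_mul (C * (wt y ^ t * u y) ^ 2)).mono' hy (Eventually.of_forall fun x => ?_)
    rw [Real.norm_of_nonneg (by positivity)]
    exact hb x y
  refine (integrable_prod_iff' hm2).2 ⟨hi, ?_⟩
  refine (hU.const_mul (C * kapBound v)).mono' hm2.norm.prod_swap.integral_prod_right' ?_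
  filter_upwards [hi] with y hy
  rw [Real.norm_of_nonneg (integral_nonneg fun _ => norm_nonneg _)]
  calc ∫ x, ‖‖hsK t u g (x, y)‖ ^ 2‖ ≤ ∫ x, C * (wt y ^ t * u y) ^ 2 * (kap (y - x) * v x) := by
        refine integral_mono hy.norm ((hk y).const_mul _) fun x => ?_
        dsimp only
        rw [Real.norm_of_nonneg (by positivity)]
        exact hb x y
    _ ≤ C * (wt y ^ t * u y) ^ 2 * kapBound v := by
        rw [integral_const_mul]
        exact mul_le_mul_of_nonneg_left (integral_kap_mul_le hv0 hv1 hv2 y) (by positivity)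
    _ = _ := by ring

/-- The Hilbert–Schmidt bound for kernels dominated by `w^γ`. -/
def hsBound (t γ : ℝ) (u : ℝ → ℝ) : ℝ :=
  (∫ x, (wt x ^ (-(t - γ))) ^ 2) * ∫ y, (wt y ^ (t + γ) * u y) ^ 2

/-- Submultiplicativity `w(x-y) ≤ w(x) w(y)` shares the growth `w^γ` between the two factors. They
become `w^{-(t-γ)}` and `w^{t+γ} u`, which the exponents in `Admissible` keep in `L²`. -/
lemma norm_hsK_sq_le {g : ℝ → ℂ} (hγ : 0 ≤ γ) {c : ℝ} {z : ℝ × ℝ}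
    (hz : ‖g (z.1 - z.2)‖ ≤ c * wt (z.1 - z.2) ^ γ) :
    ‖hsK t u g z‖ ^ 2 ≤ c ^ 2 * ((wt z.1 ^ (-(t - γ))) ^ 2 * (wt z.2 ^ (t + γ) * u z.2) ^ 2) := by
  have hc : 0 ≤ c := nonneg_of_mul_nonneg_left ((norm_nonneg _).trans hz) (wt_rpow_pos _ γ)
  have h1 : wt (z.1 - z.2) ^ γ ≤ wt z.1 ^ γ * wt z.2 ^ γ := by
    rw [← Real.mul_rpow (wt_pos _).le (wt_pos _).le]
    exact Real.rpow_le_rpow (wt_pos _).le (wt_sub_le _ _) hγ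
  have h2 : ‖g (z.1 - z.2)‖ ^ 2 ≤ (c * (wt z.1 ^ γ * wt z.2 ^ γ)) ^ 2 := by
    refine pow_le_pow_left₀ (norm_nonneg _) (hz.trans ?_) 2
    gcongr
  rw [norm_hsK_sq]
  calc _ ≤ (wt z.1 ^ (-t)) ^ 2 * (c * (wt z.1 ^ γ * wt z.2 ^ γ)) ^ 2 * (wt z.2 ^ t * u z.2) ^ 2 := by
        gcongr
    _ = _ := by
        rw [show -(t - γ) = -t + γ by ring, Real.rpow_add (wt_pos _), Real.rpow_add (wt_pos _)]
        ring

lemma integrable_hsBound (h : Admissible r t γ u) : Integrable (fun z : ℝ × ℝ =>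
    (wt z.1 ^ (-(t - γ))) ^ 2 * (wt z.2 ^ (t + γ) * u z.2) ^ 2) (volume.prod volume) :=
  (memLp_wt_rpow h.gamma_lt).integrable_sq.mul_prod h.memLp_wt_add_mul.integrable_sq

lemma ae_sub_of_ae {P : ℝ → Prop} (hP : ∀ᵐ x, P x) :
    ∀ᵐ z : ℝ × ℝ ∂(volume.prod volume), P (z.1 - z.2) :=
  (quasiMeasurePreserving_sub_of_right_invariant volume volume).ae hP

lemma memLp_hsK_of_wt (h : Admissible r t γ u) {g : ℝ → ℂ} (hg : Measurable g) {c : ℝ}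
    (hc : ∀ᵐ z, ‖g z‖ ≤ c * wt z ^ γ) : MemLp (hsK t u g) 2 := by
  have hm := aestronglyMeasurable_hsK h hg
  refine (memLp_two_iff_integrable_sq_norm hm).2 ?_
  refine ((integrable_hsBound h).const_mul (c ^ 2)).mono' (hm.norm.pow 2) ?_
  filter_upwards [ae_sub_of_ae hc] with z hz
  rw [Real.norm_of_nonneg (by positivity)]
  exact norm_hsK_sq_le h.gamma_pos.le hz

lemma integral_norm_hsK_sq_le (h : Admissible r t γ u) {g : ℝ → ℂ} (hg : Measurable g) {c : ℝ}
    (hc : ∀ᵐ z, ‖g z‖ ≤ c * wt z ^ γ) : ∫ z, ‖hsK t u g z‖ ^ 2 ≤ c ^ 2 * hsBound t γ u := by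
  have hm := memLp_hsK_of_wt h hg hc
  have h1 : ∫ z, ‖hsK t u g z‖ ^ 2 ≤ ∫ z : ℝ × ℝ, c ^ 2 *
      ((wt z.1 ^ (-(t - γ))) ^ 2 * (wt z.2 ^ (t + γ) * u z.2) ^ 2) ∂(volume.prod volume) := by
    refine integral_mono_ae ((memLp_two_iff_integrable_sq_norm hm.1).1 hm)
      ((integrable_hsBound h).const_mul (c ^ 2)) ?_
    filter_upwards [ae_sub_of_ae hc] with z hz
    exact norm_hsK_sq_le h.gamma_pos.le hz
  refine h1.trans (le_of_eq ?_)
  rw [integral_const_mul, hsBound]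
  congr 1
  exact integral_prod_mul (fun x => (wt x ^ (-(t - γ))) ^ 2) fun y => (wt y ^ (t + γ) * u y) ^ 2

/-- The operator on `L²(ℝ)` with kernel `hsK t u g`, if that is square integrable. -/
def opOf (t : ℝ) (u : ℝ → ℝ) (g : ℝ → ℂ) :
    Lp ℂ 2 (volume : Measure ℝ) →L[ℂ] Lp ℂ 2 (volume : Measure ℝ) :=
  open Classical in if h : MemLp (hsK t u g) 2 then hsOp _ h else 0

lemma opOf_eq {g : ℝ → ℂ} (h : MemLp (hsK t u g) 2) : opOf t u g = hsOp _ h := dif_pos h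

lemma norm_opOf_le (h : Admissible r t γ u) {g : ℝ → ℂ} (hg : Measurable g) {c : ℝ} (hc0 : 0 ≤ c)
    (hc : ∀ᵐ z, ‖g z‖ ≤ c * wt z ^ γ) : ‖opOf t u g‖ ≤ c * √(hsBound t γ u) := by
  rw [opOf_eq (memLp_hsK_of_wt h hg hc)]
  refine (norm_hsOp_le _).trans ?_
  refine (Real.sqrt_le_sqrt (integral_norm_hsK_sq_le h hg hc)).trans (le_of_eq ?_)
  rw [Real.sqrt_mul (sq_nonneg c), Real.sqrt_sq hc0]

lemma opOf_sub {g k : ℝ → ℂ} (hg : MemLp (hsK t u g) 2) (hk : MemLp (hsK t u k) 2) :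
    opOf t u g - opOf t u k = opOf t u (g - k) := by
  have e : hsK t u g - hsK t u k = hsK t u (g - k) := by
    ext z
    simp only [hsK, Pi.sub_apply]; ring
  have h1 : MemLp (hsK t u (g - k)) 2 := by rw [← e]; exact hg.sub hk
  rw [opOf_eq hg, opOf_eq hk, opOf_eq h1, hsOp_sub]
  congr 1

lemma opOf_const_smul (c : ℂ) {g : ℝ → ℂ} (hg : MemLp (hsK t u g) 2) :
    c • opOf t u g = opOf t u (c • g) := by
  have e : c • hsK t u g = hsK t u (c • g) := by
    ext z
    simp only [hsK, Pi.smul_apply, smul_eq_mul]; ring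
  have h1 : MemLp (hsK t u (c • g)) 2 := by rw [← e]; exact hg.const_smul c
  rw [opOf_eq hg, opOf_eq h1, hsOp_const_smul]
  congr 1

lemma memLp_hsK_sub {g k : ℝ → ℂ} (hg : MemLp (hsK t u g) 2) (hk : MemLp (hsK t u k) 2) :
    MemLp (hsK t u (g - k)) 2 := by
  have e : hsK t u g - hsK t u k = hsK t u (g - k) := by
    ext z
    simp only [hsK, Pi.sub_apply]; ring
  rw [← e]; exact hg.sub hk

lemma memLp_hsK_const_smul (c : ℂ) {g : ℝ → ℂ} (hg : MemLp (hsK t u g) 2) :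
    MemLp (hsK t u (c • g)) 2 := by
  have e : c • hsK t u g = hsK t u (c • g) := by
    ext z
    simp only [hsK, Pi.smul_apply, smul_eq_mul]; ring
  rw [← e]; exact hg.const_smul c

/-- The boundary kernel with the oscillation `exp(i lam x)` removed. -/
def jostKer (σ : Side) (lam x : ℝ) : ℂ := Complex.exp (-(Complex.I * lam * x)) * kerG σ lam x

lemma measurable_jostKer (σ : Side) (lam : ℝ) : Measurable (jostKer σ lam) :=
  Measurable.mul (by fun_prop) (measurable_kerG σ lam)

lemma memLp_jostKer (h : Admissible r t γ u) (σ : Side) {lam : ℝ} (hl : 0 < lam) :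
    MemLp (hsK t u (jostKer σ lam)) 2 := by
  obtain ⟨C, -, hC⟩ := exists_norm_kerG_le σ hl
  refine memLp_hsK_of_kap h (measurable_jostKer σ lam) (C := C) fun z => ?_
  rw [jostKer, norm_mul, norm_exp_neg_I_mul, one_mul]
  exact (hC z).2

/-- The operator of the integral equation for the Jost functions, on `L²(ℝ)`. -/
def jostOp (t : ℝ) (u : ℝ → ℝ) (σ : Side) (lam : ℝ) :
    Lp ℂ 2 (volume : Measure ℝ) →L[ℂ] Lp ℂ 2 (volume : Measure ℝ) := opOf t u (jostKer σ lam)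

lemma isCompactOperator_jostOp (h : Admissible r t γ u) (σ : Side) {lam : ℝ} (hl : 0 < lam) :
    IsCompactOperator (jostOp t u σ lam) := by
  rw [jostOp, opOf_eq (memLp_jostKer h σ hl)]
  exact isCompactOperator_hsOp _

/-- The function on the line represented by an element of the weighted `L²` space. -/
def unweight (t lam : ℝ) (M : ℝ → ℂ) (x : ℝ) : ℂ :=
  ((wt x ^ t : ℝ) : ℂ) * (planeWave lam x * M x)

/-- The element of the weighted `L²` space represented by a function on the line. -/
def weight (t lam : ℝ) (m : ℝ → ℂ) (x : ℝ) : ℂ :=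
  ((wt x ^ (-t) : ℝ) : ℂ) * (Complex.exp (-(Complex.I * lam * x)) * m x)

lemma wt_rpow_mul_neg (x t : ℝ) : ((wt x ^ t : ℝ) : ℂ) * ((wt x ^ (-t) : ℝ) : ℂ) = 1 := by
  rw [← Complex.ofReal_mul, ← Real.rpow_add (wt_pos x), add_neg_cancel, Real.rpow_zero,
    Complex.ofReal_one]

lemma unweight_weight (t lam : ℝ) (m : ℝ → ℂ) (x : ℝ) :
    unweight t lam (weight t lam m) x = m x := by
  rw [unweight, weight]
  linear_combination (planeWave lam x * Complex.exp (-(Complex.I * lam * x)) * m x) *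
    wt_rpow_mul_neg x t + m x * planeWave_mul_exp_neg lam x

lemma weight_unweight (t lam : ℝ) (M : ℝ → ℂ) (x : ℝ) :
    weight t lam (unweight t lam M) x = M x := by
  rw [weight, unweight]
  linear_combination (planeWave lam x * Complex.exp (-(Complex.I * lam * x)) * M x) *
    wt_rpow_mul_neg x t + M x * planeWave_mul_exp_neg lam x

lemma integral_hsK_jostKer (t : ℝ) (u : ℝ → ℝ) (σ : Side) (lam : ℝ) (M : ℝ → ℂ) (x : ℝ) :
    ∫ y, hsK t u (jostKer σ lam) (x, y) * M y =
      weight t lam (cv σ lam fun y => (u y : ℂ) * unweight t lam M y) x := by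
  rw [weight, cv, ← integral_const_mul, ← integral_const_mul]
  congr 1; ext y
  have : Complex.exp (-(Complex.I * lam * ((x - y : ℝ) : ℂ))) =
      Complex.exp (-(Complex.I * lam * x)) * planeWave lam y := by
    rw [planeWave, ← Complex.exp_add]; congr 1; push_cast; ring
  simp only [hsK, jostKer, unweight]
  rw [this]
  push_cast
  ring

lemma jostOp_apply (h : Admissible r t γ u) (σ : Side) {lam : ℝ} (hl : 0 < lam)
    (M : Lp ℂ 2 (volume : Measure ℝ)) :
    jostOp t u σ lam M =ᵐ[volume]
      weight t lam (cv σ lam fun y => (u y : ℂ) * unweight t lam M y) := by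
  rw [jostOp, opOf_eq (memLp_jostKer h σ hl)]
  filter_upwards [hsOp_apply (memLp_jostKer h σ hl) M] with x hx
  rw [hx, integral_hsK_jostKer]

lemma mul_unweight (u : ℝ → ℝ) (t lam : ℝ) (M : ℝ → ℂ) (y : ℝ) : (u y : ℂ) * unweight t lam M y =
    ((wt y ^ t * u y : ℝ) : ℂ) * (planeWave lam y * M y) := by
  rw [unweight]; push_cast; ring

lemma memLp_planeWave_mul {M : ℝ → ℂ} (hM : MemLp M 2) (lam : ℝ) :
    MemLp (fun y => planeWave lam y * M y) 2 := by
  refine MemLp.of_le hM ((continuous_planeWave lam).aestronglyMeasurable.mul hM.1)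
    (Eventually.of_forall fun y => ?_)
  rw [norm_mul, norm_planeWave, one_mul]

lemma integrable_mul_unweight (h : Admissible r t γ u) {M : ℝ → ℂ} (hM : MemLp M 2) (lam : ℝ) :
    Integrable fun y => (u y : ℂ) * unweight t lam M y := by
  simp only [mul_unweight]
  exact (h.memLp_wt_mul.ofReal (K := ℂ)).integrable_mul (memLp_planeWave_mul hM lam)

lemma aestronglyMeasurable_unweight {M : ℝ → ℂ} (hM : AEStronglyMeasurable M volume) (t lam : ℝ) :
    AEStronglyMeasurable (unweight t lam M) volume :=
  (Complex.continuous_ofReal.comp (continuous_wt_rpow t)).aestronglyMeasurable.mul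
    ((continuous_planeWave lam).aestronglyMeasurable.mul hM)

/-- The inhomogeneity `w^{-t} exp(-i ν x)` of the integral equation. -/
def weightedWave (t ν x : ℝ) : ℂ := ((wt x ^ (-t) : ℝ) : ℂ) * Complex.exp (-(Complex.I * ν * x))

lemma memLp_weightedWave (h : Admissible r t γ u) (ν : ℝ) : MemLp (weightedWave t ν) 2 := by
  have h1 : Continuous fun x => wt x ^ (-t) := continuous_wt_rpow _
  refine MemLp.of_le (memLp_wt_rpow h.half_lt)
    (Continuous.aestronglyMeasurable (by unfold weightedWave; fun_prop))
    (Eventually.of_forall fun x => ?_)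
  rw [weightedWave, norm_mul, norm_exp_neg_I_mul, mul_one, Complex.norm_real]

lemma weight_planeWave (t lam μ x : ℝ) :
    weight t lam (planeWave μ) x = weightedWave t (lam - μ) x := by
  rw [weight, weightedWave, planeWave, ← Complex.exp_add]
  congr 2; push_cast; ring

lemma unweight_ae_eq (h : Admissible r t γ u) (σ : Side) {lam : ℝ} (hl : 0 < lam) {g : ℝ → ℂ}
    {M : Lp ℂ 2 (volume : Measure ℝ)}
    (heq : M =ᵐ[volume] fun x => weight t lam g x + jostOp t u σ lam M x) :
    ∀ᵐ x, unweight t lam M x = g x + cv σ lam (fun y => (u y : ℂ) * unweight t lam M y) x := by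
  filter_upwards [heq, jostOp_apply h σ hl M] with x h1 h2
  rw [h2] at h1
  rw [unweight, h1, mul_add, mul_add]
  exact congrArg₂ (· + ·) (unweight_weight t lam g x) (unweight_weight t lam _ x)

/-- Undoing the weight gives a homogeneous solution `m` for which a priori only `u m ∈ L¹` is known;
the iteration makes it bounded, and bounded homogeneous solutions vanish. -/
lemma eq_zero_of_jostOp_eq (h : Admissible r t γ u) (σ : Side) {lam : ℝ} (hl : 0 < lam)
    (M : Lp ℂ 2 (volume : Measure ℝ)) (hM : jostOp t u σ lam M = M) : M = 0 := by
  have h1 := unweight_ae_eq h σ hl (g := fun _ => 0) (M := M)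
    (Eventually.of_forall fun x => by rw [hM]; simp [weight])
  have hi := integrable_mul_unweight h (Lp.memLp M) lam
  obtain ⟨B, -, hB⟩ := exists_ae_bound_of_eq_add_cv σ hl h.integrable h.integrable_sq
    (g := fun _ => 0) (B := 0) (by simp) hi h1
  simp only [zero_add] at h1
  have h2 := h.ae_eq_zero hl σ (aestronglyMeasurable_unweight (Lp.memLp M).1 t lam) hB h1
  refine Lp.ext ?_
  filter_upwards [h2, Lp.coeFn_zero ℂ 2 (volume : Measure ℝ)] with x hx h0
  rw [h0, ← weight_unweight t lam M x, weight, hx]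
  simp

lemma isUnit_one_sub_jostOp (h : Admissible r t γ u) (σ : Side) {lam : ℝ} (hl : 0 < lam) :
    IsUnit (1 - jostOp t u σ lam) :=
  isUnit_one_sub_of_isCompactOperator (isCompactOperator_jostOp h σ hl)
    (eq_zero_of_jostOp_eq h σ hl)

/-- The resolvent `(1 - A)⁻¹` of the integral equation. -/
def jostRes (t : ℝ) (u : ℝ → ℝ) (σ : Side) (lam : ℝ) :
    Lp ℂ 2 (volume : Measure ℝ) →L[ℂ] Lp ℂ 2 (volume : Measure ℝ) :=
  Ring.inverse (1 - jostOp t u σ lam)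

lemma jostRes_mul (h : Admissible r t γ u) (σ : Side) {lam : ℝ} (hl : 0 < lam) :
    jostRes t u σ lam * (1 - jostOp t u σ lam) = 1 :=
  Ring.inverse_mul_cancel _ (isUnit_one_sub_jostOp h σ hl)

lemma mul_jostRes (h : Admissible r t γ u) (σ : Side) {lam : ℝ} (hl : 0 < lam) :
    (1 - jostOp t u σ lam) * jostRes t u σ lam = 1 :=
  Ring.mul_inverse_cancel _ (isUnit_one_sub_jostOp h σ hl)

/-! ### Jost solutions as images under the resolvent: existence and uniqueness -/

lemma IsJostSolution.aestronglyMeasurable {σ : Side} {lam : ℝ} {g m : ℝ → ℂ}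
    (hm : IsJostSolution r u σ lam g m) : AEStronglyMeasurable m volume := by
  have h1 : AEStronglyMeasurable (fun x => wt x ^ r • ((1 + |x|) ^ (-r) • m x)) volume :=
    (continuous_wt_rpow r).aestronglyMeasurable.smul hm.1.1
  refine h1.congr (Eventually.of_forall fun x => ?_)
  change wt x ^ r • (wt x ^ (-r) • m x) = m x
  rw [smul_smul, ← Real.rpow_add (wt_pos x), add_neg_cancel, Real.rpow_zero, one_smul]

/-- In modulus `w^{-t} m = w^{-(t-r)} (w^{-r} m)`, where the first factor is in `L²` because `t - r
> 1/2` and the second is bounded. -/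
lemma IsJostSolution.memLp_weight (h : Admissible r t γ u) {σ : Side} {lam : ℝ} {g m : ℝ → ℂ}
    (hm : IsJostSolution r u σ lam g m) : MemLp (weight t lam m) 2 := by
  have h1 : MemLp (fun x => wt x ^ (-(t - r)) • ((1 + |x|) ^ (-r) • m x)) 2 :=
    hm.1.smul (memLp_wt_rpow h.r_lt)
  have hc : AEStronglyMeasurable (weight t lam m) volume :=
    (Complex.continuous_ofReal.comp (continuous_wt_rpow (-t))).aestronglyMeasurable.mul
      ((Continuous.aestronglyMeasurable (by fun_prop)).mul hm.aestronglyMeasurable)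
  refine MemLp.of_le h1 hc (Eventually.of_forall fun x => le_of_eq ?_)
  change _ = ‖wt x ^ (-(t - r)) • (wt x ^ (-r) • m x)‖
  rw [smul_smul, ← Real.rpow_add (wt_pos x), weight, norm_mul, norm_mul, norm_exp_neg_I_mul,
    one_mul, Complex.norm_real, norm_smul]
  congr 3; ring

lemma IsJostSolution.ae_eq {σ : Side} {lam : ℝ} (hl : 0 < lam) {g m : ℝ → ℂ}
    (hm : IsJostSolution r u σ lam g m) :
    ∀ᵐ x, m x = g x + cv σ lam (fun y => (u y : ℂ) * m y) x := by
  filter_upwards [hm.2] with x hx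
  rw [hx, convolution_boundaryG σ hl]

/-- This gives uniqueness, and it later expresses the scattering coefficients through the resolvent.
-/
lemma IsJostSolution.toLp_eq (h : Admissible r t γ u) {σ : Side} {lam : ℝ} (hl : 0 < lam) {μ : ℝ}
    {m : ℝ → ℂ} (hm : IsJostSolution r u σ lam (planeWave μ) m) :
    (hm.memLp_weight h).toLp _ =
      jostRes t u σ lam ((memLp_weightedWave h (lam - μ)).toLp _) := by
  have hw := hm.memLp_weight h
  have key : (1 - jostOp t u σ lam) (hw.toLp _) = (memLp_weightedWave h (lam - μ)).toLp _ := by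
    refine Lp.ext ?_
    rw [sub_apply, one_apply_eq_self]
    filter_upwards [Lp.coeFn_sub (hw.toLp _) (jostOp t u σ lam (hw.toLp _)), hw.coeFn_toLp,
      jostOp_apply h σ hl (hw.toLp _), (memLp_weightedWave h (lam - μ)).coeFn_toLp, hm.ae_eq hl]
      with x h1 h2 h3 h4 h5
    have h6 : cv σ lam (fun y => (u y : ℂ) * unweight t lam (hw.toLp _) y) =
        cv σ lam (fun y => (u y : ℂ) * m y) := by
      refine cv_congr σ lam ?_
      filter_upwards [hw.coeFn_toLp] with y hy
      rw [unweight, hy]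
      exact congrArg _ (unweight_weight t lam m y)
    rw [h1, Pi.sub_apply, h2, h3, h4, h6, ← weight_planeWave]
    simp only [weight]
    rw [h5]
    ring
  rw [← key, ← mul_apply_eq_comp, jostRes_mul h σ hl, one_apply_eq_self]

lemma IsJostSolution.exists_ae_bound (h : Admissible r t γ u) {σ : Side} {lam : ℝ} (hl : 0 < lam)
    {μ : ℝ} {m : ℝ → ℂ} (hm : IsJostSolution r u σ lam (planeWave μ) m) :
    ∃ B, 0 ≤ B ∧ ∀ᵐ x, ‖m x‖ ≤ B := by
  refine exists_ae_bound_of_eq_add_cv σ hl h.integrable h.integrable_sq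
    (fun x => (norm_planeWave μ x).le) ?_ (hm.ae_eq hl)
  have := integrable_mul_unweight h (hm.memLp_weight h) lam
  simpa only [unweight_weight] using this

/-- The resolvent provides a solution in a weighted `L²` space only. Iterating the equation shows it
is bounded, hence in `L^∞_{-r}` as `r ≥ 0`. -/
lemma exists_isJostSolution (h : Admissible r t γ u) (σ : Side) {lam : ℝ} (hl : 0 < lam) (μ : ℝ) :
    ∃ m, IsJostSolution r u σ lam (planeWave μ) m := by
  set M := jostRes t u σ lam ((memLp_weightedWave h (lam - μ)).toLp _) with hM
  have h1 : M - jostOp t u σ lam M = (memLp_weightedWave h (lam - μ)).toLp _ := by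
    have := congrArg (fun T => T ((memLp_weightedWave h (lam - μ)).toLp _)) (mul_jostRes h σ hl)
    simpa [hM] using this
  have h2 := unweight_ae_eq h σ hl (g := planeWave μ) (M := M) (by
    filter_upwards [(memLp_weightedWave h (lam - μ)).coeFn_toLp,
      Lp.coeFn_sub M (jostOp t u σ lam M)] with x h3 h4
    rw [weight_planeWave, ← h3, ← h1, h4]
    simp)
  obtain ⟨B, -, hB⟩ := exists_ae_bound_of_eq_add_cv σ hl h.integrable h.integrable_sq
    (fun x => (norm_planeWave μ x).le) (integrable_mul_unweight h (Lp.memLp M) lam) h2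
  refine ⟨unweight t lam M, ?_, ?_⟩
  · refine memLp_top_of_bound (C := B) ?_ ?_
    · exact (continuous_wt_rpow (-r)).aestronglyMeasurable.smul
        (aestronglyMeasurable_unweight (Lp.memLp M).1 t lam)
    · filter_upwards [hB] with x hx
      change ‖wt x ^ (-r) • _‖ ≤ B
      rw [norm_smul, Real.norm_of_nonneg (wt_rpow_pos x _).le]
      refine (mul_le_of_le_one_left (norm_nonneg _) ?_).trans hx
      exact Real.rpow_le_one_of_one_le_of_nonpos (one_le_wt x) (by linarith [h.r_nonneg])
  · filter_upwards [h2] with x hx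
    rw [hx, convolution_boundaryG σ hl]

lemma IsJostSolution.ae_unique (h : Admissible r t γ u) {σ : Side} {lam : ℝ} (hl : 0 < lam) {μ : ℝ}
    {m m' : ℝ → ℂ} (hm : IsJostSolution r u σ lam (planeWave μ) m)
    (hm' : IsJostSolution r u σ lam (planeWave μ) m') : m =ᵐ[volume] m' := by
  have h1 := (hm.toLp_eq h hl).trans (hm'.toLp_eq h hl).symm
  rw [MemLp.toLp_eq_toLp_iff] at h1
  filter_upwards [h1] with x hx
  rw [← unweight_weight t lam m x, ← unweight_weight t lam m' x, unweight, hx, unweight]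

lemma isJostSolution_jostSolution (h : Admissible r t γ u) (σ : Side) {lam : ℝ} (hl : 0 < lam)
    (μ : ℝ) :
    IsJostSolution r u σ lam (planeWave μ) (jostSolution r u σ lam (planeWave μ)) :=
  Classical.epsilon_spec (exists_isJostSolution h σ hl μ)

/-- Makes `m_1` and `m_e` the cases `μ = 0` and `μ = lam` of one family of inhomogeneities. -/
lemma planeWave_zero : planeWave 0 = fun _ => 1 := by
  ext x; simp [planeWave]

lemma isJostSolution_jostOne (h : Admissible r t γ u) (σ : Side) {lam : ℝ} (hl : 0 < lam) :
    IsJostSolution r u σ lam (planeWave 0) (jostOne r u σ lam) := by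
  rw [jostOne, ← planeWave_zero]
  exact isJostSolution_jostSolution h σ hl 0

lemma isJostSolution_jostExp (h : Admissible r t γ u) (σ : Side) {lam : ℝ} (hl : 0 < lam) :
    IsJostSolution r u σ lam (planeWave lam) (jostExp r u σ lam) :=
  isJostSolution_jostSolution h σ hl lam

end Kernel

/-! ### Relations between the scattering coefficients -/

section Relations

variable {r t γ : ℝ} {u : ℝ → ℝ}

lemma IsJostSolution.L1L2_mul (h : Admissible r t γ u) {σ : Side} {lam : ℝ} (hl : 0 < lam)
    {μ : ℝ} {m : ℝ → ℂ} (hm : IsJostSolution r u σ lam (planeWave μ) m) :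
    L1L2 fun x => (u x : ℂ) * m x := by
  obtain ⟨B, -, hB⟩ := hm.exists_ae_bound h hl
  exact L1L2.of_bound h.integrable h.integrable_sq hm.aestronglyMeasurable hB

lemma integrable_mul_planeWave_mul {f : ℝ → ℂ} (hf : Integrable f) (μ : ℝ) :
    Integrable fun x => planeWave μ x * f x := by
  refine hf.norm.mono' ((continuous_planeWave μ).aestronglyMeasurable.mul hf.1)
    (Eventually.of_forall fun y => ?_)
  rw [norm_mul, norm_planeWave, one_mul]

lemma integrable_conj {f : ℝ → ℂ} (hf : Integrable f) : Integrable fun x => conj (f x) :=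
  Complex.conjCLE.toContinuousLinearMap.integrable_comp hf

lemma integrable_mul_of_bound {f g : ℝ → ℂ} (hf : Integrable f) (hg : AEStronglyMeasurable g volume)
    {B : ℝ} (hB : ∀ᵐ x, ‖g x‖ ≤ B) : Integrable fun x => g x * f x :=
  hf.bdd_mul hg hB

/-- Reciprocity. Pair the equation of `m` with `u n` and that of `n` with `u m`. The convolution
terms agree by adjointness, and the terms `m conj(u n)` agree since `u` is real, so the pairings
with the two inhomogeneities must agree as well. -/
lemma integral_mul_conj_planeWave (h : Admissible r t γ u) {lam : ℝ} (hl : 0 < lam) {μ ν : ℝ}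
    {m n : ℝ → ℂ} (hm : IsJostSolution r u .above lam (planeWave μ) m)
    (hn : IsJostSolution r u .below lam (planeWave ν) n) :
    ∫ x, (u x : ℂ) * m x * conj (planeWave ν x) = conj (∫ x, (u x : ℂ) * n x * conj (planeWave μ x)) := by
  have hh := hm.L1L2_mul h hl
  have hk := hn.L1L2_mul h hl
  obtain ⟨B, -, hB⟩ := hm.exists_ae_bound h hl
  have i1 : Integrable fun x => m x * conj ((u x : ℂ) * n x) :=
    integrable_mul_of_bound (integrable_conj hk.1) hm.aestronglyMeasurable hB
  have i2 : Integrable fun x => planeWave μ x * conj ((u x : ℂ) * n x) :=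
    integrable_mul_planeWave_mul (integrable_conj hk.1) μ
  have i3 : Integrable fun x => conj (planeWave ν x) * ((u x : ℂ) * m x) := by
    simpa only [conj_planeWave, mul_comm] using integrable_mul_exp hh.1 ν
  have hadj := integral_conj_mul_cv hl hh hk
  have e1 : ∫ x, conj ((u x : ℂ) * n x) * cv .above lam (fun y => (u y : ℂ) * m y) x =
      ∫ x, (m x * conj ((u x : ℂ) * n x) - planeWave μ x * conj ((u x : ℂ) * n x)) := by
    refine integral_congr_ae ?_
    filter_upwards [hm.ae_eq hl] with x hx
    linear_combination (-conj ((u x : ℂ) * n x)) * hx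
  have e2 : ∫ x, conj (cv .below lam (fun y => (u y : ℂ) * n y) x) * ((u x : ℂ) * m x) =
      ∫ x, (m x * conj ((u x : ℂ) * n x) - conj (planeWave ν x) * ((u x : ℂ) * m x)) := by
    refine integral_congr_ae ?_
    filter_upwards [hn.ae_eq hl] with x hx
    have hx' := congrArg conj hx
    rw [map_add] at hx'
    rw [map_mul, Complex.conj_ofReal]
    linear_combination (-((u x : ℂ) * m x)) * hx'
  rw [e1, e2, integral_sub i1 i2, integral_sub i1 i3, sub_right_inj] at hadj
  rw [← integral_conj]
  calc _ = ∫ x, conj (planeWave ν x) * ((u x : ℂ) * m x) := by congr 1; ext x; ring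
    _ = _ := by
      rw [← hadj]
      congr 1; ext x
      simp only [map_mul, Complex.conj_conj]; ring

/-- The Jost functions on the two sides differ by a multiple of `m_e(·, lam - 0i)`. -/
lemma IsJostSolution.above_ae_eq (h : Admissible r t γ u) {lam : ℝ} (hl : 0 < lam) {μ : ℝ}
    {m n e : ℝ → ℂ} (hm : IsJostSolution r u .above lam (planeWave μ) m)
    (hn : IsJostSolution r u .below lam (planeWave μ) n)
    (he : IsJostSolution r u .below lam (planeWave lam) e) :
    ∀ᵐ x, m x = n x + Complex.I * (∫ y, (u y : ℂ) * m y * conj (planeWave lam y)) * e x := by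
  set J := ∫ y, (u y : ℂ) * m y * conj (planeWave lam y) with hJ
  have hmL := hm.L1L2_mul h hl
  have hnL := hn.L1L2_mul h hl
  have heL := he.L1L2_mul h hl
  obtain ⟨B₁, -, hB₁⟩ := hm.exists_ae_bound h hl
  obtain ⟨B₂, -, hB₂⟩ := hn.exists_ae_bound h hl
  obtain ⟨B₃, -, hB₃⟩ := he.exists_ae_bound h hl
  -- The jump relation replaces the upper convolution of `u m` by the lower one plus `i J e^{iλx}`.
  -- That extra term is the inhomogeneity of `i J e`, so the difference solves the homogeneous
  -- equation.
  have key := h.ae_eq_zero hl .below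
    (m := fun x => m x - (n x + Complex.I * J * e x)) (B := B₁ + (B₂ + ‖Complex.I * J‖ * B₃))
    (hm.aestronglyMeasurable.sub (hn.aestronglyMeasurable.add (he.aestronglyMeasurable.const_mul _)))
    (by
      filter_upwards [hB₁, hB₂, hB₃] with x h1 h2 h3
      refine (norm_sub_le _ _).trans (add_le_add h1 ((norm_add_le _ _).trans (add_le_add h2 ?_)))
      rw [norm_mul]
      gcongr)
    (by
      filter_upwards [hm.ae_eq hl, hn.ae_eq hl, he.ae_eq hl] with x h1 h2 h3
      have h4 := cv_above_sub_below hl hmL x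
      have h5 : cv .below lam (fun y => (u y : ℂ) * (m y - (n y + Complex.I * J * e y))) x =
          cv .below lam (fun y => (u y : ℂ) * m y) x - (cv .below lam (fun y => (u y : ℂ) * n y) x +
            Complex.I * J * cv .below lam (fun y => (u y : ℂ) * e y) x) := by
        have i1 := integrable_kerG_mul .below hl hmL x
        have i2 := integrable_kerG_mul .below hl hnL x
        have i3 := (integrable_kerG_mul .below hl heL x).const_mul (Complex.I * J)
        rw [cv, cv, cv, cv, ← integral_const_mul (Complex.I * J), ← integral_add i2 i3]
        refine Eq.trans ?_ (integral_sub i1 (i2.add i3))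
        congr 1; ext y
        ring
      simp only [← conj_planeWave] at h4
      rw [h5]
      linear_combination h1 - h2 - Complex.I * J * h3 + h4)
  filter_upwards [key] with x hx
  exact sub_eq_zero.1 hx

lemma Gam_eq (r : ℝ) (u : ℝ → ℝ) (lam : ℝ) : Gam r u lam =
    1 + Complex.I * ∫ y, (u y : ℂ) * jostExp r u .above lam y * conj (planeWave lam y) := by
  simp only [Gam, conj_planeWave]

lemma beta_eq (r : ℝ) (u : ℝ → ℝ) (lam : ℝ) : beta r u lam =
    Complex.I * ∫ y, (u y : ℂ) * jostOne r u .above lam y * conj (planeWave lam y) := by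
  simp only [beta, conj_planeWave]

lemma jostExp_above_ae_eq (h : Admissible r t γ u) {lam : ℝ} (hl : 0 < lam) :
    ∀ᵐ x, jostExp r u .above lam x = Gam r u lam * jostExp r u .below lam x := by
  filter_upwards [(isJostSolution_jostExp h .above hl).above_ae_eq h hl
    (isJostSolution_jostExp h .below hl) (isJostSolution_jostExp h .below hl)] with x hx
  rw [Gam_eq, add_mul, one_mul, ← hx]

lemma jostOne_above_ae_eq (h : Admissible r t γ u) {lam : ℝ} (hl : 0 < lam) :
    ∀ᵐ x, jostOne r u .above lam x =
      jostOne r u .below lam x + beta r u lam * jostExp r u .below lam x := by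
  filter_upwards [(isJostSolution_jostOne h .above hl).above_ae_eq h hl
    (isJostSolution_jostOne h .below hl) (isJostSolution_jostExp h .below hl)] with x hx
  rw [beta_eq, ← hx]

/-- With `a`, `b` the upper and lower pairings of `u m_e` with the plane wave, `Γ = 1 + i a`,
proportionality gives `a = Γ b` and reciprocity gives `ā = b`. Hence `Γ Γ̄ = Γ - i Γ b = Γ - i a =
1`. -/
lemma norm_Gam (h : Admissible r t γ u) {lam : ℝ} (hl : 0 < lam) : ‖Gam r u lam‖ = 1 := by
  have h1 := integral_mul_conj_planeWave h hl (isJostSolution_jostExp h .above hl)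
    (isJostSolution_jostExp h .below hl)
  have h2 := Gam_eq r u lam
  set a := ∫ y, (u y : ℂ) * jostExp r u .above lam y * conj (planeWave lam y) with ha
  set b := ∫ y, (u y : ℂ) * jostExp r u .below lam y * conj (planeWave lam y) with hb
  have h3 : a = Gam r u lam * b := by
    rw [ha, hb, ← integral_const_mul]
    refine integral_congr_ae ?_
    filter_upwards [jostExp_above_ae_eq h hl] with x hx
    rw [hx]; ring
  have h4 : conj a = b := by rw [h1, Complex.conj_conj]
  have h5 : conj (Gam r u lam) = 1 - Complex.I * b := by
    rw [h2, map_add, map_mul, map_one, Complex.conj_I, h4]; ring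
  have h6 : Gam r u lam * conj (Gam r u lam) = 1 := by
    rw [h5]
    linear_combination h2 + Complex.I * h3
  rw [Complex.mul_conj, Complex.normSq_eq_norm_sq] at h6
  have h7 : ‖Gam r u lam‖ ^ 2 = 1 := by exact_mod_cast h6
  exact (pow_eq_one_iff_of_nonneg (norm_nonneg _) two_ne_zero).1 h7

lemma integral_mul_jostExp_below (h : Admissible r t γ u) {lam : ℝ} (hl : 0 < lam) :
    ∫ x, (u x : ℂ) * jostExp r u .below lam x = Complex.I * conj (beta r u lam) := by
  have h1 := integral_mul_conj_planeWave h hl (isJostSolution_jostOne h .above hl)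
    (isJostSolution_jostExp h .below hl)
  simp only [planeWave_zero, map_one, mul_one] at h1
  rw [beta_eq, h1, map_mul, Complex.conj_I, Complex.conj_conj, ← mul_assoc]
  simp

lemma integral_mul_jostExp_above (h : Admissible r t γ u) {lam : ℝ} (hl : 0 < lam) :
    ∫ x, (u x : ℂ) * jostExp r u .above lam x =
      Complex.I * conj (beta r u lam) * Gam r u lam := by
  rw [← integral_mul_jostExp_below h hl, ← integral_mul_const]
  refine integral_congr_ae ?_
  filter_upwards [jostExp_above_ae_eq h hl] with x hx
  rw [hx]; ring

lemma coeffF_eq (h : Admissible r t γ u) {lam : ℝ} (hl : 0 < lam) : coeffF r u lam =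
    conj (beta r u lam) / (2 * (Real.pi : ℂ) * Complex.I * lam) := by
  rw [coeffF, integral_mul_jostExp_below h hl]
  have h1 : (lam : ℂ) ≠ 0 := by exact_mod_cast hl.ne'
  have h2 : (Real.pi : ℂ) ≠ 0 := by exact_mod_cast Real.pi_ne_zero
  field_simp
  rw [Complex.I_sq]; ring

/-- Let `p`, `q` be the integrals of `u m_1` from above and below. Reciprocity gives `p = q̄`, while
the jump of `m_1` gives `p - q = i |β|²`; compare imaginary parts. -/
lemma norm_beta_sq (h : Admissible r t γ u) {lam : ℝ} (hl : 0 < lam) : ‖beta r u lam‖ ^ 2 =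
    2 * (∫ x : ℝ, (u x : ℂ) * jostOne r u .above lam x).im := by
  have h1 := integral_mul_conj_planeWave h hl (isJostSolution_jostOne h .above hl)
    (isJostSolution_jostOne h .below hl)
  simp only [planeWave_zero, map_one, mul_one] at h1
  have i1 := ((isJostSolution_jostOne h .below hl).L1L2_mul h hl).1
  have i2 := ((isJostSolution_jostExp h .below hl).L1L2_mul h hl).1.const_mul (beta r u lam)
  have h2 : ∫ x, (u x : ℂ) * jostOne r u .above lam x = (∫ x, (u x : ℂ) * jostOne r u .below lam x) +
      beta r u lam * (Complex.I * conj (beta r u lam)) := by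
    rw [← integral_mul_jostExp_below h hl, ← integral_const_mul, ← integral_add i1 i2]
    refine integral_congr_ae ?_
    filter_upwards [jostOne_above_ae_eq h hl] with x hx
    rw [hx]; ring
  set p := ∫ x, (u x : ℂ) * jostOne r u .above lam x
  set q := ∫ x, (u x : ℂ) * jostOne r u .below lam x
  have h3 : beta r u lam * (Complex.I * conj (beta r u lam)) =
      Complex.I * ((‖beta r u lam‖ ^ 2 : ℝ) : ℂ) := by
    rw [← Complex.normSq_eq_norm_sq, ← Complex.mul_conj]; ring
  rw [h3] at h2
  have h4 := congrArg Complex.im h1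
  have h5 := congrArg Complex.im h2
  rw [Complex.conj_im] at h4
  rw [Complex.add_im, Complex.I_mul_im, Complex.ofReal_re] at h5
  linarith

end Relations

/-! ### Local Hölder estimates -/

section Holder

variable {E F G : Type*} [NormedAddCommGroup E] [NormedAddCommGroup F] [NormedAddCommGroup G]
variable {γ : ℝ}

/-- Hölder estimates on the compact intervals of `(0,∞)`. -/
def HolderOnIcc (γ : ℝ) (g : ℝ → E) : Prop :=
  ∀ a b : ℝ, 0 < a → ∃ C, 0 ≤ C ∧ ∀ x ∈ Icc a b, ∀ y ∈ Icc a b, ‖g x - g y‖ ≤ C * |x - y| ^ γ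

lemma HolderOnIcc.locHolder {γ : ℝ≥0} {g : ℝ → ℂ} (h : HolderOnIcc γ g) : LocHolder γ g := by
  intro K hK hc
  rcases K.eq_empty_or_nonempty with rfl | hne
  · exact ⟨0, holderOnWith_empty _ _ _⟩
  obtain ⟨a, haK, ha⟩ := hc.exists_isLeast hne
  obtain ⟨b, hbK, hb⟩ := hc.exists_isGreatest hne
  obtain ⟨C, hC0, hC⟩ := h a b (hK haK)
  refine ⟨C.toNNReal, fun x hx y hy => ?_⟩
  have h1 := hC x ⟨ha hx, hb hx⟩ y ⟨ha hy, hb hy⟩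
  rw [edist_dist, edist_dist, dist_eq_norm, Real.dist_eq,
    ENNReal.ofReal_rpow_of_nonneg (abs_nonneg _) γ.coe_nonneg]
  refine (ENNReal.ofReal_le_ofReal h1).trans (le_of_eq ?_)
  rw [ENNReal.ofReal_mul hC0]
  rfl

lemma HolderOnIcc.congr {f g : ℝ → E} (hf : HolderOnIcc γ f) (h : ∀ x, 0 < x → g x = f x) :
    HolderOnIcc γ g := fun a b ha => by
  obtain ⟨C, hC0, hC⟩ := hf a b ha
  refine ⟨C, hC0, fun x hx y hy => ?_⟩
  rw [h x (ha.trans_le hx.1), h y (ha.trans_le hy.1)]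
  exact hC x hx y hy

lemma HolderOnIcc.exists_bound (hγ : 0 ≤ γ) {f : ℝ → E} (hf : HolderOnIcc γ f) {a b : ℝ}
    (ha : 0 < a) : ∃ B, 0 ≤ B ∧ ∀ x ∈ Icc a b, ‖f x‖ ≤ B := by
  obtain ⟨C, hC0, hC⟩ := hf a b ha
  refine ⟨‖f a‖ + C * |b - a| ^ γ, by positivity, fun x hx => ?_⟩
  have h1 := hC x hx a ⟨le_rfl, hx.1.trans hx.2⟩
  have h2 : |x - a| ^ γ ≤ |b - a| ^ γ := by
    refine Real.rpow_le_rpow (abs_nonneg _) ?_ hγ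
    rw [abs_of_nonneg (by linarith [hx.1]), abs_of_nonneg (by linarith [hx.1, hx.2])]
    linarith [hx.2]
  have h3 : ‖f x‖ ≤ ‖f a‖ + ‖f x - f a‖ := by
    simpa using norm_add_le (f a) (f x - f a)
  have := mul_le_mul_of_nonneg_left h2 hC0
  linarith

/-- Hölder estimates for products. -/
lemma HolderOnIcc.of_product (hγ : 0 ≤ γ) {f : ℝ → E} {g : ℝ → F} {k : ℝ → G}
    (hf : HolderOnIcc γ f) (hg : HolderOnIcc γ g)
    (hk : ∀ x y, 0 < x → 0 < y → ‖k x - k y‖ ≤ ‖f x‖ * ‖g x - g y‖ + ‖f x - f y‖ * ‖g y‖) :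
    HolderOnIcc γ k := fun a b ha => by
  obtain ⟨C₁, h1, hC₁⟩ := hf a b ha
  obtain ⟨C₂, h2, hC₂⟩ := hg a b ha
  obtain ⟨B₁, h3, hB₁⟩ := hf.exists_bound hγ (b := b) ha
  obtain ⟨B₂, h4, hB₂⟩ := hg.exists_bound hγ (b := b) ha
  refine ⟨B₁ * C₂ + C₁ * B₂, by positivity, fun x hx y hy => ?_⟩
  refine (hk x y (ha.trans_le hx.1) (ha.trans_le hy.1)).trans ?_
  calc _ ≤ B₁ * (C₂ * |x - y| ^ γ) + C₁ * |x - y| ^ γ * B₂ := by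
        gcongr
        exacts [hB₁ x hx, hC₂ x hx y hy, hC₁ x hx y hy, hB₂ y hy]
    _ = _ := by ring

lemma HolderOnIcc.mul (hγ : 0 ≤ γ) {f g : ℝ → ℂ} (hf : HolderOnIcc γ f) (hg : HolderOnIcc γ g) :
    HolderOnIcc γ fun x => f x * g x :=
  hf.of_product hγ hg fun x y _ _ => by
    rw [show f x * g x - f y * g y = f x * (g x - g y) + (f x - f y) * g y by ring, ← norm_mul,
      ← norm_mul]
    exact norm_add_le _ _

lemma HolderOnIcc.of_norm_sub_le {f : ℝ → E} {g : ℝ → F} (hf : HolderOnIcc γ f) {c : ℝ}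
    (hc : 0 ≤ c) (h : ∀ x y, ‖g x - g y‖ ≤ c * ‖f x - f y‖) : HolderOnIcc γ g := fun a b ha => by
  obtain ⟨C, hC0, hC⟩ := hf a b ha
  refine ⟨c * C, by positivity, fun x hx y hy => (h x y).trans ?_⟩
  rw [mul_assoc]
  exact mul_le_mul_of_nonneg_left (hC x hx y hy) hc

lemma HolderOnIcc.conj {f : ℝ → ℂ} (hf : HolderOnIcc γ f) : HolderOnIcc γ fun x => conj (f x) :=
  hf.of_norm_sub_le zero_le_one fun x y => by rw [← map_sub, RCLike.norm_conj, one_mul]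

lemma holderOnIcc_const (e : E) : HolderOnIcc γ fun _ : ℝ => e := fun _ _ _ =>
  ⟨0, le_rfl, fun _ _ _ _ => by simp⟩

/-- Functions that are Lipschitz on compact intervals. -/
lemma HolderOnIcc.of_lipschitz (hγ1 : γ ≤ 1) {f : ℝ → E} (h : HolderOnIcc 1 f) :
    HolderOnIcc γ f := fun a b ha => by
  obtain ⟨C, hC0, hC⟩ := h a b ha
  refine ⟨C * |b - a| ^ (1 - γ), by positivity, fun x hx y hy => (hC x hx y hy).trans ?_⟩
  rw [mul_assoc]
  refine mul_le_mul_of_nonneg_left ?_ hC0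
  rcases eq_or_ne x y with rfl | hxy
  · simp only [sub_self, abs_zero, Real.zero_rpow one_ne_zero]
    positivity
  have h1 : 0 < |x - y| := abs_pos.2 (sub_ne_zero.2 hxy)
  have h2 : |x - y| ≤ |b - a| := by
    rw [abs_of_nonneg (by linarith [hx.1, hx.2] : 0 ≤ b - a), abs_le]
    constructor <;> linarith [hx.1, hx.2, hy.1, hy.2]
  calc |x - y| ^ (1 : ℝ) = |x - y| ^ (1 - γ) * |x - y| ^ γ := by
        rw [← Real.rpow_add h1]; ring_nf
    _ ≤ _ := by
        gcongr

lemma holderOnIcc_inv : HolderOnIcc 1 fun x : ℝ => ((x : ℂ))⁻¹ := fun a b ha => by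
  refine ⟨(a * a)⁻¹, by positivity, fun x hx y hy => ?_⟩
  have hx0 := ha.trans_le hx.1
  have hy0 := ha.trans_le hy.1
  have h1 : ((x : ℂ))⁻¹ - ((y : ℂ))⁻¹ = (((x * y)⁻¹ * (y - x) : ℝ) : ℂ) := by
    have : (x : ℂ) ≠ 0 := by exact_mod_cast hx0.ne'
    have : (y : ℂ) ≠ 0 := by exact_mod_cast hy0.ne'
    push_cast; field_simp
  rw [h1, Complex.norm_real, norm_mul, Real.norm_of_nonneg (by positivity), Real.norm_eq_abs,
    abs_sub_comm, Real.rpow_one]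
  gcongr
  exacts [hx.1, hy.1]

end Holder

/-! ### Dependence of the integral operator on the spectral parameter -/

lemma norm_exp_neg_sub_le (l m x : ℝ) : ‖Complex.exp (-(Complex.I * l * x)) -
    Complex.exp (-(Complex.I * m * x))‖ ≤ |l - m| * |x| := by
  have h1 : Complex.exp (-(Complex.I * l * x)) - Complex.exp (-(Complex.I * m * x)) =
      Complex.exp (-(Complex.I * m * x)) *
        (Complex.exp (Complex.I * (((m - l) * x : ℝ) : ℂ)) - 1) := by
    rw [mul_sub, ← Complex.exp_add, mul_one]
    congr 2; push_cast; ring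
  rw [h1, norm_mul, norm_exp_neg_I_mul, one_mul]
  refine Real.norm_exp_I_mul_ofReal_sub_one_le.trans (le_of_eq ?_)
  rw [Real.norm_eq_abs, abs_mul, abs_sub_comm]

/-- Interpolation: with `z = |l - m| |x|` the difference is at most `z` and at most `2`, hence at
most `2 z^γ`. -/
lemma norm_exp_neg_sub_le_rpow {γ : ℝ} (h0 : 0 ≤ γ) (h1 : γ ≤ 1) (l m x : ℝ) :
    ‖Complex.exp (-(Complex.I * l * x)) - Complex.exp (-(Complex.I * m * x))‖ ≤
      2 * |l - m| ^ γ * wt x ^ γ := by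
  have h2 : |l - m| ^ γ * |x| ^ γ ≤ |l - m| ^ γ * wt x ^ γ := by
    gcongr; exact abs_le_wt x
  rw [← Real.mul_rpow (abs_nonneg _) (abs_nonneg _)] at h2
  have h3 := norm_exp_neg_sub_le l m x
  set z := |l - m| * |x|
  have hz0 : 0 ≤ z := by positivity
  have h4 : ‖Complex.exp (-(Complex.I * l * x)) - Complex.exp (-(Complex.I * m * x))‖ ≤ 2 * z ^ γ := by
    rcases le_total z 1 with hz | hz
    · have := Real.rpow_le_rpow_of_exponent_ge' hz0 hz h0 h1
      rw [Real.rpow_one] at this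
      linarith
    · have h5 := Real.one_le_rpow hz h0
      refine (norm_sub_le _ _).trans ?_
      rw [norm_exp_neg_I_mul, norm_exp_neg_I_mul]
      linarith
  linarith

/-- The derivative of the kernel `jostKer .above` in the spectral parameter. -/
def dKer (lam x : ℝ) : ℂ := -(Complex.exp (-(Complex.I * lam * x)) / (2 * Real.pi * lam))

lemma measurable_dKer (lam : ℝ) : Measurable (dKer lam) := by
  unfold dKer; fun_prop

/-- With the oscillation removed the plane-wave part is a step function independent of `l`.
Otherwise its derivative would grow like `|x|`. -/
lemma hasDerivAt_jostKer {lam : ℝ} (hl : 0 < lam) {x : ℝ} (hx : x ≠ 0) :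
    HasDerivAt (fun l => jostKer .above l x) (dKer lam x) lam := by
  have h1 : (fun l => jostKer .above l x) = fun l : ℝ =>
      (Ioi (0 : ℝ)).indicator (fun _ => Complex.I) x -
        Complex.exp (-(Complex.I * l * x)) * lapG l x := by
    ext l
    rw [jostKer, kerG, mul_sub]
    congr 1
    by_cases h : x ∈ Ioi (0 : ℝ)
    · rw [indicator_of_mem h, indicator_of_mem h]
      linear_combination Complex.I * planeWave_mul_exp_neg l x
    · rw [indicator_of_notMem h, indicator_of_notMem h, mul_zero]
  rw [h1]
  exact (hasDerivAt_exp_mul_lapG hl hx).const_sub _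

lemma norm_dKer {lam : ℝ} (hl : 0 < lam) (x : ℝ) : ‖dKer lam x‖ = 1 / (2 * Real.pi * lam) := by
  rw [dKer, norm_neg, norm_div, norm_exp_neg_I_mul]
  congr 1
  rw [← Complex.ofReal_ofNat, ← Complex.ofReal_mul, ← Complex.ofReal_mul, Complex.norm_real,
    Real.norm_of_nonneg (by positivity)]

lemma two_pi_gt_one : 1 < 2 * Real.pi := by linarith [Real.pi_gt_three]

lemma norm_dKer_le {a lam : ℝ} (ha : 0 < a) (hl : a ≤ lam) (x : ℝ) : ‖dKer lam x‖ ≤ a⁻¹ := by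
  rw [norm_dKer (ha.trans_le hl), one_div]
  gcongr
  nlinarith [two_pi_gt_one]

lemma norm_dKer_sub_le {γ : ℝ} (h0 : 0 ≤ γ) (h1 : γ ≤ 1) {a l m : ℝ} (ha : 0 < a) (hl : a ≤ l)
    (hm : a ≤ m) (hlm : |l - m| ≤ 1) (x : ℝ) :
    ‖dKer l x - dKer m x‖ ≤ (2 * a⁻¹ + (a * a)⁻¹) * |l - m| ^ γ * wt x ^ γ := by
  have hl0 := ha.trans_le hl
  have hm0 := ha.trans_le hm
  set c : ℝ → ℝ := fun l => (2 * Real.pi * l)⁻¹ with hc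
  have e : dKer l x - dKer m x = -((c l : ℂ) * (Complex.exp (-(Complex.I * l * x)) -
      Complex.exp (-(Complex.I * m * x)))) - ((c l - c m : ℝ) : ℂ) *
        Complex.exp (-(Complex.I * m * x)) := by
    simp only [dKer, hc]; push_cast; ring
  have hcl : ‖(c l : ℂ)‖ ≤ a⁻¹ := by
    rw [Complex.norm_real, Real.norm_of_nonneg (by positivity)]
    refine inv_anti₀ ha ?_
    nlinarith [two_pi_gt_one]
  have hcd : ‖((c l - c m : ℝ) : ℂ)‖ ≤ (a * a)⁻¹ * |l - m| := by
    have : c l - c m = (2 * Real.pi * (l * m))⁻¹ * (m - l) := by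
      simp only [hc]; field_simp
    rw [Complex.norm_real, this, norm_mul, Real.norm_of_nonneg (by positivity), Real.norm_eq_abs,
      abs_sub_comm]
    refine mul_le_mul_of_nonneg_right (inv_anti₀ (mul_pos ha ha) ?_) (abs_nonneg _)
    have := mul_le_mul hl hm ha.le hl0.le
    nlinarith [two_pi_gt_one, mul_pos ha ha]
  have hp : |l - m| ≤ |l - m| ^ γ := by
    have := Real.rpow_le_rpow_of_exponent_ge' (abs_nonneg (l - m)) hlm h0 h1
    rwa [Real.rpow_one] at this
  have hw := Real.one_le_rpow (one_le_wt x) h0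
  rw [e]
  refine (norm_sub_le _ _).trans ?_
  rw [norm_neg, norm_mul, norm_mul, norm_exp_neg_I_mul, mul_one]
  have h2 := mul_le_mul hcl (norm_exp_neg_sub_le_rpow h0 h1 l m x) (norm_nonneg _) (by positivity)
  have h3 : ‖((c l - c m : ℝ) : ℂ)‖ ≤ (a * a)⁻¹ * (|l - m| ^ γ * wt x ^ γ) := by
    refine hcd.trans (mul_le_mul_of_nonneg_left (hp.trans ?_) (by positivity))
    exact le_mul_of_one_le_right (by positivity) hw
  linarith

lemma norm_jostKer_sub_le {a l m : ℝ} (ha : 0 < a) (hl : a ≤ l) (hm : a ≤ m) {x : ℝ} (hx : x ≠ 0) :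
    ‖jostKer .above l x - jostKer .above m x‖ ≤ a⁻¹ * |l - m| :=
  (convex_Ici a).norm_image_sub_le_of_norm_hasDerivWithin_le
    (f := fun l => jostKer .above l x) (f' := fun l => dKer l x)
    (fun _ hy => (hasDerivAt_jostKer (ha.trans_le hy) hx).hasDerivWithinAt)
    (fun _ hy => norm_dKer_le ha hy x) hm hl

/-- The mean value inequality on the segment from `m` to `l` for `y ↦ jostKer y - y * dKer m`, whose
derivative is controlled by `norm_dKer_sub_le`. -/
lemma norm_jostKer_sub_sub_le {γ : ℝ} (h0 : 0 ≤ γ) (h1 : γ ≤ 1) {a l m : ℝ} (ha : 0 < a)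
    (hl : a ≤ l) (hm : a ≤ m) (hlm : |l - m| ≤ 1) {x : ℝ} (hx : x ≠ 0) :
    ‖jostKer .above l x - jostKer .above m x - ((l - m : ℝ) : ℂ) * dKer m x‖ ≤
      (2 * a⁻¹ + (a * a)⁻¹) * |l - m| ^ γ * wt x ^ γ * |l - m| := by
  have hs : ∀ y ∈ uIcc m l, a ≤ y ∧ |y - m| ≤ |l - m| := fun y hy => by
    refine ⟨(le_min hm hl).trans hy.1, ?_⟩
    have := abs_sub_left_of_mem_uIcc hy
    exact this
  have h2 := (convex_uIcc m l).norm_image_sub_le_of_norm_hasDerivWithin_le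
    (f := fun y : ℝ => jostKer .above y x - (y : ℂ) * dKer m x)
    (f' := fun y => dKer y x - 1 * dKer m x)
    (C := (2 * a⁻¹ + (a * a)⁻¹) * |l - m| ^ γ * wt x ^ γ)
    (fun y hy => ((hasDerivAt_jostKer (ha.trans_le (hs y hy).1) hx).sub
      ((hasDerivAt_id y).ofReal_comp.mul_const _)).hasDerivWithinAt)
    (fun y hy => by
      rw [one_mul]
      refine (norm_dKer_sub_le h0 h1 ha (hs y hy).1 hm ((hs y hy).2.trans hlm) x).trans ?_
      have := (hs y hy).2
      have := (wt_rpow_pos x γ).le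
      gcongr)
    left_mem_uIcc right_mem_uIcc
  refine le_trans (le_of_eq (congrArg norm ?_)) h2
  push_cast; ring

section Regularity

variable {r t γ : ℝ} {u : ℝ → ℝ}

lemma memLp_dKer (h : Admissible r t γ u) {lam : ℝ} (hl : 0 < lam) :
    MemLp (hsK t u (dKer lam)) 2 :=
  memLp_hsK_of_wt h (measurable_dKer lam) (c := lam⁻¹) <| Eventually.of_forall fun x =>
    (norm_dKer_le hl le_rfl x).trans (le_mul_of_one_le_right (by positivity)
      (Real.one_le_rpow (one_le_wt x) h.gamma_pos.le))

lemma ae_ne_zero : ∀ᵐ x : ℝ, x ≠ 0 := compl_mem_ae_iff.2 (measure_singleton (0 : ℝ))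

lemma norm_jostOp_sub_le (h : Admissible r t γ u) {a l m : ℝ} (ha : 0 < a) (hl : a ≤ l)
    (hm : a ≤ m) :
    ‖jostOp t u .above l - jostOp t u .above m‖ ≤ a⁻¹ * |l - m| * √(hsBound t γ u) := by
  rw [jostOp, jostOp, opOf_sub (memLp_jostKer h _ (ha.trans_le hl))
    (memLp_jostKer h _ (ha.trans_le hm))]
  refine norm_opOf_le h ((measurable_jostKer _ _).sub (measurable_jostKer _ _)) (by positivity) ?_
  filter_upwards [ae_ne_zero] with x hx
  exact (norm_jostKer_sub_le ha hl hm hx).trans (le_mul_of_one_le_right (by positivity)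
    (Real.one_le_rpow (one_le_wt x) h.gamma_pos.le))

lemma norm_jostOp_sub_sub_le (h : Admissible r t γ u) {a l m : ℝ} (ha : 0 < a) (hl : a ≤ l)
    (hm : a ≤ m) (hlm : |l - m| ≤ 1) :
    ‖jostOp t u .above l - jostOp t u .above m - ((l - m : ℝ) : ℂ) • opOf t u (dKer m)‖ ≤
      (2 * a⁻¹ + (a * a)⁻¹) * |l - m| ^ γ * |l - m| * √(hsBound t γ u) := by
  have hl' := memLp_jostKer h .above (ha.trans_le hl)
  have hm' := memLp_jostKer h .above (ha.trans_le hm)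
  have hd := memLp_dKer h (ha.trans_le hm)
  rw [jostOp, jostOp, opOf_sub hl' hm', opOf_const_smul _ hd,
    opOf_sub (memLp_hsK_sub hl' hm') (memLp_hsK_const_smul _ hd)]
  refine norm_opOf_le h (((measurable_jostKer _ _).sub (measurable_jostKer _ _)).sub
    ((measurable_dKer m).const_smul _)) (by positivity) ?_
  filter_upwards [ae_ne_zero] with x hx
  refine (norm_jostKer_sub_sub_le h.gamma_pos.le h.gamma_lt_one.le ha hl hm hlm hx).trans
    (le_of_eq ?_)
  ring

lemma hasDerivAt_jostOp (h : Admissible r t γ u) {lam : ℝ} (hl : 0 < lam) :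
    HasDerivAt (jostOp t u .above) (opOf t u (dKer lam)) lam := by
  rw [hasDerivAt_iff_isLittleO]
  set K := (2 * (lam / 2)⁻¹ + (lam / 2 * (lam / 2))⁻¹) * √(hsBound t γ u) with hK
  have h1 : Tendsto (fun l => K * |l - lam| ^ γ) (𝓝 lam) (𝓝 0) := by
    have : ContinuousAt (fun l => K * |l - lam| ^ γ) lam :=
      ContinuousAt.mul continuousAt_const (ContinuousAt.rpow_const
        (by fun_prop) (Or.inr h.gamma_pos.le))
    have h2 := this.tendsto
    simpa [Real.zero_rpow h.gamma_pos.ne'] using h2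
  refine Asymptotics.isLittleO_iff.2 fun ε hε => ?_
  filter_upwards [h1.eventually (gt_mem_nhds hε), Ioi_mem_nhds (show lam / 2 < lam by linarith),
    Metric.ball_mem_nhds lam one_pos] with l h2 h3 h4
  have h5 := norm_jostOp_sub_sub_le h (half_pos hl) (le_of_lt h3) (half_le_self hl.le)
    (le_of_lt (by rwa [Metric.mem_ball, Real.dist_eq] at h4))
  rw [Complex.coe_smul] at h5
  refine h5.trans ?_
  rw [Real.norm_eq_abs]
  calc _ = K * |l - lam| ^ γ * |l - lam| := by rw [hK]; ring
    _ ≤ _ := by gcongr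

/-- The resolvent identity, from which both the Lipschitz bound and the derivative of the resolvent
are read off. -/
lemma jostRes_sub (h : Admissible r t γ u) {l m : ℝ} (hl : 0 < l) (hm : 0 < m) :
    jostRes t u .above l - jostRes t u .above m = jostRes t u .above l *
      ((jostOp t u .above l - jostOp t u .above m) * jostRes t u .above m) := by
  have h1 := jostRes_mul h .above hl
  have h2 := mul_jostRes h .above hm
  calc _ = jostRes t u .above l * ((1 - jostOp t u .above m) * jostRes t u .above m) -
        (jostRes t u .above l * (1 - jostOp t u .above l)) * jostRes t u .above m := by
        rw [h1, h2, mul_one, one_mul]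
    _ = _ := by noncomm_ring

lemma continuousAt_jostRes (h : Admissible r t γ u) {lam : ℝ} (hl : 0 < lam) :
    ContinuousAt (jostRes t u .above) lam := by
  have h1 := isUnit_one_sub_jostOp h .above hl
  have h2 := NormedRing.inverse_continuousAt h1.unit
  have h3 : ContinuousAt (fun l => 1 - jostOp t u .above l) lam :=
    continuousAt_const.sub (hasDerivAt_jostOp h hl).continuousAt
  exact ContinuousAt.comp (f := fun l => 1 - jostOp t u .above l) h2 h3

lemma holderOnIcc_jostRes (h : Admissible r t γ u) : HolderOnIcc 1 (jostRes t u .above) :=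
    fun a b ha => by
  have hc : ContinuousOn (jostRes t u .above) (Icc a b) := fun x hx =>
    (continuousAt_jostRes h (ha.trans_le hx.1)).continuousWithinAt
  obtain ⟨B, hB⟩ := isCompact_Icc.exists_bound_of_continuousOn hc
  rcases lt_or_ge b a with hab | hab
  · exact ⟨0, le_rfl, fun x hx => absurd (hx.1.trans hx.2) (not_le.2 hab)⟩
  have hB0 := (norm_nonneg _).trans (hB a ⟨le_rfl, hab⟩)
  refine ⟨B * (a⁻¹ * √(hsBound t γ u) * B), by positivity, fun x hx y hy => ?_⟩
  rw [jostRes_sub h (ha.trans_le hx.1) (ha.trans_le hy.1), Real.rpow_one]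
  calc _ ≤ ‖jostRes t u .above x‖ * (‖jostOp t u .above x - jostOp t u .above y‖ *
        ‖jostRes t u .above y‖) := (norm_mul_le _ _).trans (by gcongr; exact norm_mul_le _ _)
    _ ≤ B * (a⁻¹ * |x - y| * √(hsBound t γ u) * B) := by
        gcongr
        exacts [hB x hx, norm_jostOp_sub_le h ha hx.1 hy.1, hB y hy]
    _ = _ := by ring

/-- The inhomogeneity of the integral equation as an element of `L²(ℝ)`. -/
def waveLp (h : Admissible r t γ u) (ν : ℝ) : Lp ℂ 2 (volume : Measure ℝ) :=
  (memLp_weightedWave h ν).toLp _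

/-- A difference of oscillations costs a factor `w^γ`, and `w^{-(t-γ)}` is in `L²` only because `t -
γ > 1/2`. This limits the Hölder exponent obtained for `β`. -/
lemma holderOnIcc_waveLp (h : Admissible r t γ u) : HolderOnIcc γ (waveLp h) := fun a b ha => by
  set W := (memLp_wt_rpow h.gamma_lt).toLp _ with hW
  refine ⟨2 * ‖W‖, by positivity, fun x _ y _ => ?_⟩
  have h1 : ‖waveLp h x - waveLp h y‖ ≤ 2 * |x - y| ^ γ * ‖W‖ := by
    refine Lp.norm_le_mul_norm_of_ae_le_mul ?_
    filter_upwards [Lp.coeFn_sub (waveLp h x) (waveLp h y), (memLp_weightedWave h x).coeFn_toLp,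
      (memLp_weightedWave h y).coeFn_toLp, (memLp_wt_rpow h.gamma_lt).coeFn_toLp] with z h2 h3 h4 h5
    rw [h2, Pi.sub_apply, waveLp, waveLp, h3, h4, hW, h5, weightedWave, weightedWave, ← mul_sub,
      norm_mul, Complex.norm_real, Real.norm_of_nonneg (wt_rpow_pos _ _).le,
      Real.norm_of_nonneg (wt_rpow_pos _ _).le]
    have h6 := mul_le_mul_of_nonneg_left
      (norm_exp_neg_sub_le_rpow h.gamma_pos.le h.gamma_lt_one.le x y z) (wt_rpow_pos z (-t)).le
    refine h6.trans (le_of_eq ?_)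
    rw [show -(t - γ) = -t + γ by ring, Real.rpow_add (wt_pos z)]
    ring
  linarith

/-- The functional `M ↦ ∫ w^t u M` on `L²(ℝ)`. -/
def potFun (h : Admissible r t γ u) : Lp ℂ 2 (volume : Measure ℝ) →L[ℂ] ℂ :=
  innerSL ℂ ((h.memLp_wt_mul.ofReal (K := ℂ)).toLp _)

lemma potFun_apply (h : Admissible r t γ u) (M : Lp ℂ 2 (volume : Measure ℝ)) :
    potFun h M = ∫ x, ((wt x ^ t * u x : ℝ) : ℂ) * M x := by
  rw [potFun, innerSL_apply_apply, L2.inner_def]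
  refine integral_congr_ae ?_
  filter_upwards [(h.memLp_wt_mul.ofReal (K := ℂ)).coeFn_toLp] with x hx
  rw [hx, RCLike.inner_apply, RCLike.conj_ofReal, mul_comm]
  rfl

lemma integral_eq_potFun (h : Admissible r t γ u) {lam : ℝ} (hl : 0 < lam) {μ : ℝ} {m : ℝ → ℂ}
    (hm : IsJostSolution r u .above lam (planeWave μ) m) :
    ∫ x, (u x : ℂ) * m x * Complex.exp (-(Complex.I * lam * x)) =
      potFun h (jostRes t u .above lam (waveLp h (lam - μ))) := by
  rw [waveLp, ← hm.toLp_eq h hl, potFun_apply]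
  refine integral_congr_ae ?_
  filter_upwards [(hm.memLp_weight h).coeFn_toLp] with x hx
  rw [hx, weight]
  push_cast
  linear_combination (-((u x : ℂ) * m x * Complex.exp (-(Complex.I * lam * x)))) *
    wt_rpow_mul_neg x t

/-- The inhomogeneity `waveLp h 0` does not depend on `lam`, so `Γ` varies only through the
resolvent. -/
lemma Gam_eq_potFun (h : Admissible r t γ u) {lam : ℝ} (hl : 0 < lam) : Gam r u lam =
    1 + Complex.I * potFun h (jostRes t u .above lam (waveLp h 0)) := by
  rw [Gam, integral_eq_potFun h hl (isJostSolution_jostExp h .above hl), sub_self]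

lemma beta_eq_potFun (h : Admissible r t γ u) {lam : ℝ} (hl : 0 < lam) : beta r u lam =
    Complex.I * potFun h (jostRes t u .above lam (waveLp h lam)) := by
  rw [beta, integral_eq_potFun h hl (isJostSolution_jostOne h .above hl), sub_zero]

/-- The derivative kernel factors through `e^{-iλ(x-y)} = e^{-iλx} e^{iλy}`, so the operator has
rank one. The `y` factor integrates to a multiple of `∫ u m_e`, and the `x` factor is the
inhomogeneity of `m_1`. -/
lemma opOf_dKer_apply (h : Admissible r t γ u) {lam : ℝ} (hl : 0 < lam) :
    opOf t u (dKer lam) (jostRes t u .above lam (waveLp h 0)) =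
      (-(1 / (2 * Real.pi * lam)) * ∫ x, (u x : ℂ) * jostExp r u .above lam x) • waveLp h lam := by
  have hm := isJostSolution_jostExp h .above hl
  have h1 : jostRes t u .above lam (waveLp h 0) = (hm.memLp_weight h).toLp _ := by
    rw [hm.toLp_eq h hl, sub_self, waveLp]
  rw [h1, opOf_eq (memLp_dKer h hl)]
  refine Lp.ext ?_
  filter_upwards [hsOp_apply (memLp_dKer h hl) ((hm.memLp_weight h).toLp _),
    Lp.coeFn_smul (-(1 / (2 * Real.pi * lam)) * ∫ x, (u x : ℂ) * jostExp r u .above lam x : ℂ)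
      (waveLp h lam), (memLp_weightedWave h lam).coeFn_toLp] with x h2 h3 h4
  rw [h2, h3, Pi.smul_apply, waveLp, h4, smul_eq_mul, mul_assoc, ← integral_mul_const,
    ← integral_const_mul]
  refine integral_congr_ae ?_
  filter_upwards [(hm.memLp_weight h).coeFn_toLp] with y hy
  rw [hy, hsK, dKer, weight, weightedWave]
  have e1 : Complex.exp (-(Complex.I * lam * ((x - y : ℝ) : ℂ))) =
      Complex.exp (-(Complex.I * lam * x)) * planeWave lam y := by
    rw [planeWave, ← Complex.exp_add]; congr 1; push_cast; ring
  have e2 := planeWave_mul_exp_neg lam y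
  have e3 := wt_rpow_mul_neg y t
  dsimp only
  rw [e1]
  push_cast
  set A := ((wt x ^ (-t) : ℝ) : ℂ)
  set X := Complex.exp (-(Complex.I * lam * x))
  set Y := Complex.exp (-(Complex.I * lam * y))
  set P := planeWave lam y
  set a := ((wt y ^ t : ℝ) : ℂ)
  set b := ((wt y ^ (-t) : ℝ) : ℂ)
  calc _ = -(1 / (2 * Real.pi * lam)) * ((u y : ℂ) * jostExp r u .above lam y * (A * X)) *
        ((P * Y) * (a * b)) := by ring
    _ = _ := by rw [e2, e3]; ring

/-- Divide `jostRes_sub` by `l - lam` and pass to the limit, using continuity of the resolvent and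
differentiability of the operator. -/
lemma hasDerivAt_jostRes_apply (h : Admissible r t γ u) {lam : ℝ} (hl : 0 < lam)
    (v : Lp ℂ 2 (volume : Measure ℝ)) :
    HasDerivAt (fun l => jostRes t u .above l v)
      (jostRes t u .above lam (opOf t u (dKer lam) (jostRes t u .above lam v))) lam := by
  have h1 := hasDerivAt_iff_tendsto_slope.1 (hasDerivAt_jostOp h hl)
  have h2 : Tendsto (jostRes t u .above) (𝓝[≠] lam) (𝓝 (jostRes t u .above lam)) :=
    (continuousAt_jostRes h hl).tendsto.mono_left nhdsWithin_le_nhds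
  rw [hasDerivAt_iff_tendsto_slope]
  have hb := (isBoundedBilinearMap_apply (𝕜 := ℂ) (E := Lp ℂ 2 (volume : Measure ℝ))
    (F := Lp ℂ 2 (volume : Measure ℝ))).continuous
  have h3 := (hb.tendsto _).comp (h2.prodMk_nhds ((hb.tendsto _).comp
    (h1.prodMk_nhds (tendsto_const_nhds (x := jostRes t u .above lam v)))))
  refine h3.congr' ?_
  filter_upwards [nhdsWithin_le_nhds (Ioi_mem_nhds hl)] with l hl'
  simp only [Function.comp_apply]
  rw [slope_def_module, slope_def_module, ← sub_apply, jostRes_sub h hl' hl, mul_apply_eq_comp,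
    mul_apply_eq_comp, smul_apply, ContinuousLinearMap.map_smul_of_tower]

lemma hasDerivAt_Gam (h : Admissible r t γ u) {lam : ℝ} (hl : 0 < lam) :
    HasDerivAt (Gam r u) (((‖beta r u lam‖ ^ 2 : ℝ) : ℂ) /
      (2 * (Real.pi : ℂ) * Complex.I * lam) * Gam r u lam) lam := by
  have h1 := hasDerivAt_jostRes_apply h hl (waveLp h 0)
  have h2 := (((((potFun h).restrictScalars ℝ).hasFDerivAt.comp_hasDerivAt lam h1)).const_mul
    Complex.I).const_add (1 : ℂ)
  have h3 : Gam r u =ᶠ[𝓝 lam] fun l =>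
      1 + Complex.I * potFun h (jostRes t u .above l (waveLp h 0)) := by
    filter_upwards [Ioi_mem_nhds hl] with l hl'
    exact Gam_eq_potFun h hl'
  refine (h2.congr_of_eventuallyEq h3).congr_deriv ?_
  rw [opOf_dKer_apply h hl, map_smul]
  simp only [ContinuousLinearMap.coe_restrictScalars', map_smul, smul_eq_mul]
  -- One factor `β` comes from the resolvent applied to the inhomogeneity of `m_1`; the factor `β̄
  -- Γ` comes from `∫ u m_e`.
  rw [mul_left_comm, ← beta_eq_potFun h hl, integral_mul_jostExp_above h hl,
    ← Complex.normSq_eq_norm_sq, ← Complex.mul_conj]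
  have h1 : (lam : ℂ) ≠ 0 := by exact_mod_cast hl.ne'
  have h2 : (Real.pi : ℂ) ≠ 0 := by exact_mod_cast Real.pi_ne_zero
  field_simp
  rw [Complex.I_sq]; ring

/-! ### Hölder continuity of the scattering coefficients -/

lemma holderOnIcc_beta (h : Admissible r t γ u) : HolderOnIcc γ (beta r u) := by
  have h1 : HolderOnIcc γ fun l => jostRes t u .above l (waveLp h l) :=
    ((holderOnIcc_jostRes h).of_lipschitz h.gamma_lt_one.le).of_product h.gamma_pos.le
      (holderOnIcc_waveLp h) fun x y _ _ => by
        have : jostRes t u .above x (waveLp h x) - jostRes t u .above y (waveLp h y) =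
            jostRes t u .above x (waveLp h x - waveLp h y) +
              (jostRes t u .above x - jostRes t u .above y) (waveLp h y) := by
          rw [map_sub, sub_apply]; abel
        rw [this]
        exact (norm_add_le _ _).trans (add_le_add (ContinuousLinearMap.le_opNorm _ _)
          (ContinuousLinearMap.le_opNorm _ _))
  have h2 : HolderOnIcc γ fun l => Complex.I * potFun h (jostRes t u .above l (waveLp h l)) :=
    h1.of_norm_sub_le (norm_nonneg (potFun h)) fun x y => by
      rw [← mul_sub, ← map_sub, norm_mul, Complex.norm_I, one_mul]
      exact ContinuousLinearMap.le_opNorm _ _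
  exact h2.congr fun x hx => beta_eq_potFun h hx

lemma holderOnIcc_Gam (h : Admissible r t γ u) : HolderOnIcc γ (Gam r u) := by
  have h1 : HolderOnIcc γ fun l =>
      1 + Complex.I * potFun h (jostRes t u .above l (waveLp h 0)) :=
    ((holderOnIcc_jostRes h).of_lipschitz h.gamma_lt_one.le).of_norm_sub_le
      (c := ‖potFun h‖ * ‖waveLp h 0‖) (by positivity) fun x y => by
        rw [add_sub_add_left_eq_sub, ← mul_sub, ← map_sub, ← sub_apply, norm_mul, Complex.norm_I,
          one_mul, mul_right_comm, mul_assoc]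
        exact (ContinuousLinearMap.le_opNorm _ _).trans (mul_le_mul_of_nonneg_left
          (ContinuousLinearMap.le_opNorm _ _) (norm_nonneg _))
  exact h1.congr fun x hx => Gam_eq_potFun h hx

lemma holderOnIcc_const_mul_inv (h : Admissible r t γ u) (c : ℂ) :
    HolderOnIcc γ fun x : ℝ => c * (x : ℂ)⁻¹ :=
  (holderOnIcc_const c).mul h.gamma_pos.le (holderOnIcc_inv.of_lipschitz h.gamma_lt_one.le)

lemma holderOnIcc_coeffF (h : Admissible r t γ u) : HolderOnIcc γ (coeffF r u) := by
  refine ((holderOnIcc_beta h).conj.mul h.gamma_pos.le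
    (holderOnIcc_const_mul_inv h (2 * (Real.pi : ℂ) * Complex.I)⁻¹)).congr fun x hx => ?_
  rw [coeffF_eq h hx, div_eq_mul_inv, mul_inv]

/-- The derivative formula exhibits `Γ'` as a product of `β`, `β̄`, `1/λ` and `Γ`, all already known
to be Hölder, so no second look at the resolvent is needed. -/
lemma holderOnIcc_deriv_Gam (h : Admissible r t γ u) : HolderOnIcc γ (deriv (Gam r u)) := by
  have hγ := h.gamma_pos.le
  refine ((((holderOnIcc_beta h).mul hγ (holderOnIcc_beta h).conj).mul hγ
    (holderOnIcc_const_mul_inv h (2 * (Real.pi : ℂ) * Complex.I)⁻¹)).mul hγ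
      (holderOnIcc_Gam h)).congr fun x hx => ?_
  rw [(hasDerivAt_Gam h hx).deriv, Complex.mul_conj, Complex.normSq_eq_norm_sq, div_eq_mul_inv,
    mul_inv]

end Regularity

/-- The exponents used for `u ∈ L²_s`. -/
lemma admissible_of_memWeightedLp {s s₁ : ℝ} (hs₁ : 1 / 2 < s₁) (hs : s₁ < s) {u : ℝ → ℝ}
    (hu : MemWeightedLp 2 s u) :
    Admissible (s - s₁) (s - (s₁ - 1 / 2) / 2) (min ((s₁ - 1 / 2) / 2) (1 / 2)) u := by
  have h1 := min_le_left ((s₁ - 1 / 2) / 2) (1 / 2)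
  have h2 := min_le_right ((s₁ - 1 / 2) / 2) (1 / 2)
  -- With `δ = (s₁ - 1/2)/2`, `t = s - δ` and `γ ≤ δ`: `t - r = s₁ - δ > 1/2`, `t - γ ≥ s - s₁ + 1/2
  -- > 1/2`, and `t + γ ≤ s`. The minimum with `1/2` ensures `γ < 1`.
  exact ⟨lt_min (by linarith) (by norm_num), by linarith, by linarith, by linarith, by linarith,
    s, by linarith, hu⟩

end BenjaminOno

end

theorem lemma4p4 (s s₁ : ℝ) (hs₁ : 1 / 2 < s₁) (hs : s₁ < s) (u : ℝ → ℝ)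
    (hu : BenjaminOno.MemWeightedLp 2 s u) :
    -- the Jost functions exist and are unique in `L^∞_{-(s-s₁)}`
    (∀ lam : ℝ, 0 < lam → ∀ σ : BenjaminOno.Side,
      (BenjaminOno.IsJostSolution (s - s₁) u σ lam (fun _ => 1)
          (BenjaminOno.jostOne (s - s₁) u σ lam) ∧
        ∀ m : ℝ → ℂ, BenjaminOno.IsJostSolution (s - s₁) u σ lam (fun _ => 1) m →
          m =ᵐ[volume] BenjaminOno.jostOne (s - s₁) u σ lam) ∧
      (BenjaminOno.IsJostSolution (s - s₁) u σ lam (BenjaminOno.planeWave lam)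
          (BenjaminOno.jostExp (s - s₁) u σ lam) ∧
        ∀ m : ℝ → ℂ, BenjaminOno.IsJostSolution (s - s₁) u σ lam (BenjaminOno.planeWave lam) m →
          m =ᵐ[volume] BenjaminOno.jostExp (s - s₁) u σ lam)) ∧
    -- regularity of the scattering coefficients
    (∃ γ : ℝ≥0, 0 < γ ∧ γ < 1 ∧
      BenjaminOno.LocC1Holder γ (BenjaminOno.Gam (s - s₁) u) ∧
      BenjaminOno.LocHolder γ (BenjaminOno.beta (s - s₁) u) ∧
      BenjaminOno.LocHolder γ (BenjaminOno.coeffF (s - s₁) u)) ∧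
    -- relations between the scattering coefficients
    (∀ lam : ℝ, 0 < lam →
      ‖BenjaminOno.Gam (s - s₁) u lam‖ = 1 ∧
      BenjaminOno.coeffF (s - s₁) u lam =
        conj (BenjaminOno.beta (s - s₁) u lam) / (2 * (Real.pi : ℂ) * Complex.I * lam) ∧
      ‖BenjaminOno.beta (s - s₁) u lam‖ ^ 2 =
        2 * (∫ x : ℝ, (u x : ℂ) * BenjaminOno.jostOne (s - s₁) u .above lam x).im ∧
      HasDerivAt (BenjaminOno.Gam (s - s₁) u)
        (((‖BenjaminOno.beta (s - s₁) u lam‖ ^ 2 : ℝ) : ℂ) /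
            (2 * (Real.pi : ℂ) * Complex.I * lam) * BenjaminOno.Gam (s - s₁) u lam)
        lam) := by
  have h := BenjaminOno.admissible_of_memWeightedLp hs₁ hs hu
  obtain ⟨γ, hγ⟩ : ∃ γ : ℝ≥0, (γ : ℝ) = min ((s₁ - 1 / 2) / 2) (1 / 2) :=
    ⟨⟨_, h.gamma_pos.le⟩, rfl⟩
  rw [← hγ] at h
  refine ⟨fun lam hl σ => ⟨⟨?_, fun m hm => ?_⟩, ?_, fun m hm => ?_⟩,
    ⟨γ, h.gamma_pos, h.gamma_lt_one,
      ⟨fun _ hx => (BenjaminOno.hasDerivAt_Gam h hx).differentiableAt.differentiableWithinAt,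
        (BenjaminOno.holderOnIcc_deriv_Gam h).locHolder⟩,
      (BenjaminOno.holderOnIcc_beta h).locHolder, (BenjaminOno.holderOnIcc_coeffF h).locHolder⟩,
    fun lam hl => ⟨BenjaminOno.norm_Gam h hl, BenjaminOno.coeffF_eq h hl,
      BenjaminOno.norm_beta_sq h hl, BenjaminOno.hasDerivAt_Gam h hl⟩⟩
  · rw [← BenjaminOno.planeWave_zero]
    exact BenjaminOno.isJostSolution_jostOne h σ hl
  · rw [← BenjaminOno.planeWave_zero] at hm
    exact hm.ae_unique h hl (BenjaminOno.isJostSolution_jostOne h σ hl)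
  · exact BenjaminOno.isJostSolution_jostExp h σ hl
  · exact hm.ae_unique h hl (BenjaminOno.isJostSolution_jostExp h σ hl)
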